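/- \textbf{Model.} A pointer machine has a constant number of registers and a memory of dynamically allocated nodes, each with a constant number of fields. A register or field holds nil, a pointer, an integer, a real coordinate, or a colour. Pointers can be copied, followed and tested for equality; reals and colours can be copied and compared; integers can be copied, compared, added and subtracted (with truncation at $0$), and must not exceed $Cn$ for a constant $C$. Each elementary instruction (including the allocation of a node) and each test costs one step. The \emph{size} of a data structure is the number of nodes reachable from the registers. $O(\cdot)$ hides absolute constants. \textbf{Lemma (2D dominance tradeoff).} There are a fixed construction program and a fixed query program for the pointer machine with the following property. Let $p_1,\dots,p_n$ be points in $\mathbb{R}^2$ (not necessarily distinct), each of which has a colour from $\{1,\dots,\varphi\}$, and let $2\le s\le n$ be an integer parameter. Given $s$ and a linked list of the coloured points, the construction program builds in $O(n s\log n\,\log_s n)$ time a data structure of size $O(n s\log_s n)$. From then on, the query program answers any finite sequence of dominance colour-frequency reporting queries, posed one after the other: for a query $Q=(-\infty,x]\times(-\infty,y]$ with $x,y\in\mathbb{R}$ it outputs a linked list that contains, for each colour $c$ with at least one point in $Q$, exactly once the pair $(c,f)$, where $f$ is the number of points of colour $c$ in $Q$, and contains nothing else. If $k$ is the number of distinct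 colours in $Q$, the query takes $O(\log n+k\log_s n)$ time. After each query the size is still $O(n s\log_s n)$. The constants do not depend on $n$, $s$, $\varphi$, the points, the colours or the queries. -/

import Mathlib

namespace ColourFrequency

/-! ### The pointer machine

Memory is a growing collection of nodes with fields; a fixed program mentions only finitely many
registers and fields, so every node it uses has a constant number of fields. A register or field
holds `nil`, a pointer, an integer, a real coordinate, or a colour. Pointers can only be followed
and tested for equality (there is no address arithmetic), reals and colours can only be copied and
compared, and integers can be compared, added and subtracted as long as they stay within the word
limit `W`. Each elementary instruction and each test costs one step. -/

/-- A value held by a register or by a field of a node. -/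
inductive Val : Type
  | nil : Val
  | ptr (a : ℕ) : Val
  | int (m : ℕ) : Val
  | real (x : ℝ) : Val
  | colour (c : ℕ) : Val

/-- `u ≤ v`, meaningful for two integers, two reals or two colours only. -/
def Val.Le : Val → Val → Prop
  | .int a, .int b => a ≤ b
  | .real x, .real y => x ≤ y
  | .colour c, .colour d => c ≤ d
  | _, _ => False

/-- A machine state. The allocated nodes are those with address below `next`;
`heap a f` is the content of field `f` of node `a`. -/
structure State : Type where
  reg : ℕ → Val
  heap : ℕ → ℕ → Val
  next : ℕ

/-- The state after writing `v` to register `r`. -/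
def State.set (σ : State) (r : ℕ) (v : Val) : State :=
  { σ with reg := Function.update σ.reg r v }

/-- The state after writing `v` to field `f` of node `a`. -/
def State.write (σ : State) (a f : ℕ) (v : Val) : State :=
  { σ with heap := Function.update σ.heap a (Function.update (σ.heap a) f v) }

/-- The state after allocating a fresh node, all of whose fields are `nil`, and putting a pointer
to it in register `r`. -/
def State.alloc (σ : State) (r : ℕ) : State :=
  { reg := Function.update σ.reg r (.ptr σ.next)
    heap := Function.update σ.heap σ.next (fun _ => .nil)
    next := σ.next + 1 }

/-- Tests on registers. -/
inductive Test : Type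
  | isNil (r : ℕ) : Test
  | eq (r r' : ℕ) : Test
  | le (r r' : ℕ) : Test

def Test.Holds : Test → State → Prop
  | .isNil r, σ => σ.reg r = .nil
  | .eq r r', σ => σ.reg r = σ.reg r'
  | .le r r', σ => (σ.reg r).Le (σ.reg r')

/-- Programs. In `load r p f` and `store p f r`, register `p` holds a pointer and `f` is the
(constant) name of a field. -/
inductive Cmd : Type
  | skip : Cmd
  | clear (r : ℕ) : Cmd
  | const (r m : ℕ) : Cmd
  | move (r r' : ℕ) : Cmd
  | add (r a b : ℕ) : Cmd
  | sub (r a b : ℕ) : Cmd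
  | load (r p f : ℕ) : Cmd
  | store (p f r : ℕ) : Cmd
  | new (r : ℕ) : Cmd
  | seq (c d : Cmd) : Cmd
  | ite (b : Test) (c d : Cmd) : Cmd
  | while (b : Test) (c : Cmd) : Cmd

/-- `Exec W c σ t σ'`: on a machine with word limit `W`, the program `c` started in `σ` halts in
`σ'` after exactly `t` steps. A program that uses a value of the wrong kind, or whose integers
exceed the word limit, is stuck. -/
inductive Exec (W : ℕ) : Cmd → State → ℕ → State → Prop
  | skip (σ : State) : Exec W .skip σ 0 σ
  | clear (σ : State) (r : ℕ) : Exec W (.clear r) σ 1 (σ.set r .nil)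
  | const (σ : State) (r m : ℕ) (hm : m ≤ W) : Exec W (.const r m) σ 1 (σ.set r (.int m))
  | move (σ : State) (r r' : ℕ) : Exec W (.move r r') σ 1 (σ.set r (σ.reg r'))
  | add (σ : State) (r a b m k : ℕ) (ha : σ.reg a = .int m) (hb : σ.reg b = .int k)
      (hW : m + k ≤ W) : Exec W (.add r a b) σ 1 (σ.set r (.int (m + k)))
  | sub (σ : State) (r a b m k : ℕ) (ha : σ.reg a = .int m) (hb : σ.reg b = .int k) :
      Exec W (.sub r a b) σ 1 (σ.set r (.int (m - k)))
  | load (σ : State) (r p f a : ℕ) (hp : σ.reg p = .ptr a) :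
      Exec W (.load r p f) σ 1 (σ.set r (σ.heap a f))
  | store (σ : State) (p f r a : ℕ) (hp : σ.reg p = .ptr a) :
      Exec W (.store p f r) σ 1 (σ.write a f (σ.reg r))
  | new (σ : State) (r : ℕ) : Exec W (.new r) σ 1 (σ.alloc r)
  | seq {c d : Cmd} {σ σ' σ'' : State} {t u : ℕ} (hc : Exec W c σ t σ')
      (hd : Exec W d σ' u σ'') : Exec W (.seq c d) σ (t + u) σ''
  | iteTrue {b : Test} {c d : Cmd} {σ σ' : State} {t : ℕ} (hb : b.Holds σ)
      (hc : Exec W c σ t σ') : Exec W (.ite b c d) σ (t + 1) σ'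
  | iteFalse {b : Test} {c d : Cmd} {σ σ' : State} {t : ℕ} (hb : ¬ b.Holds σ)
      (hd : Exec W d σ t σ') : Exec W (.ite b c d) σ (t + 1) σ'
  | whileTrue {b : Test} {c : Cmd} {σ σ' σ'' : State} {t u : ℕ} (hb : b.Holds σ)
      (hc : Exec W c σ t σ') (hw : Exec W (.while b c) σ' u σ'') :
      Exec W (.while b c) σ (t + u + 1) σ''
  | whileFalse {b : Test} {c : Cmd} {σ : State} (hb : ¬ b.Holds σ) :
      Exec W (.while b c) σ 1 σ

/-- The nodes that can be reached by following pointers from the registers. -/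
inductive Reachable (σ : State) : ℕ → Prop
  | reg (r a : ℕ) (h : σ.reg r = .ptr a) : Reachable σ a
  | field (a f b : ℕ) (ha : Reachable σ a) (h : σ.heap a f = .ptr b) : Reachable σ b

/-- The structure stored in `σ` has size at most `B`: at most `B` nodes are reachable. -/
def SizeAtMost (σ : State) (B : ℝ) : Prop :=
  ∃ S : Finset ℕ, (∀ a, Reachable σ a → a ∈ S) ∧ (S.card : ℝ) ≤ B

/-! ### Dominance colour-frequency reporting -/

/-- The number of points of colour `c` in the quadrant `(-∞, q.1] × (-∞, q.2]`. -/
noncomputable def freq {n : ℕ} (p : Fin n → ℝ × ℝ) (col : Fin n → ℕ) (q : ℝ × ℝ) (c : ℕ) : ℕ :=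
  Set.ncard {i : Fin n | col i = c ∧ (p i).1 ≤ q.1 ∧ (p i).2 ≤ q.2}

/-- The number of distinct colours in the quadrant `(-∞, q.1] × (-∞, q.2]`. -/
noncomputable def numColours {n : ℕ} (p : Fin n → ℝ × ℝ) (col : Fin n → ℕ) (q : ℝ × ℝ) : ℕ :=
  Set.ncard (col '' {i : Fin n | (p i).1 ≤ q.1 ∧ (p i).2 ≤ q.2})

/-- The input of the construction: a linked list of `n` nodes, node `i` holding the coordinates
(fields `0`, `1`) and the colour (field `2`) of the `i`-th point and a pointer to the next node
(field `3`, `nil` at the end). Register `0` points to the head, register `1` holds `s`. -/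
def inputState {n : ℕ} (p : Fin n → ℝ × ℝ) (col : Fin n → ℕ) (s : ℕ) : State where
  reg r :=
    match r with
    | 0 => if 0 < n then .ptr 0 else .nil
    | 1 => .int s
    | _ => .nil
  heap a f :=
    if h : a < n then
      match f with
      | 0 => .real (p ⟨a, h⟩).1
      | 1 => .real (p ⟨a, h⟩).2
      | 2 => .colour (col ⟨a, h⟩)
      | 3 => if a + 1 < n then .ptr (a + 1) else .nil
      | _ => .nil
    else .nil
  next := n

/-- A query is posed by writing its corner to registers `0` and `1`. -/
def State.pose (σ : State) (q : ℝ × ℝ) : State :=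
  (σ.set 0 (.real q.1)).set 1 (.real q.2)

/-- `v` is the head of a linked list in `heap` that spells out `L`: each node holds a colour
(field `0`), a frequency (field `1`) and a pointer to the next node (field `2`). -/
def SpellsOut (heap : ℕ → ℕ → Val) : Val → List (ℕ × ℕ) → Prop
  | v, [] => v = .nil
  | v, e :: L => ∃ a : ℕ, v = .ptr a ∧ heap a 0 = .colour e.1 ∧ heap a 1 = .int e.2 ∧
      SpellsOut heap (heap a 2) L

/-- Register `0` of `σ` holds the answer to the query `q`: a list, in some order and without
repetitions, of the pairs `(c, f)` such that exactly `f > 0` points in the quadrant have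
colour `c`. -/
def Reports {n : ℕ} (p : Fin n → ℝ × ℝ) (col : Fin n → ℕ) (q : ℝ × ℝ) (σ : State) : Prop :=
  ∃ L : List (ℕ × ℕ), SpellsOut σ.heap (σ.reg 0) L ∧ L.Nodup ∧
    ∀ c f : ℕ, (c, f) ∈ L ↔ f = freq p col q c ∧ 0 < f

/-- Started from `σ`, the program `query` answers the given queries one after the other, each
starting from the state that the previous one left behind. A query that meets `k` colours takes at
most `time k` steps, and the size stays at most `size`. -/
def Answers {n : ℕ} (W : ℕ) (query : Cmd) (p : Fin n → ℝ × ℝ) (col : Fin n → ℕ)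
    (size : ℝ) (time : ℕ → ℝ) : List (ℝ × ℝ) → State → Prop
  | [], _ => True
  | q :: qs, σ => ∃ (t : ℕ) (σ' : State), Exec W query (σ.pose q) t σ' ∧
      (t : ℝ) ≤ time (numColours p col q) ∧ Reports p col q σ' ∧ SizeAtMost σ' size ∧
      Answers W query p col size time qs σ'

end ColourFrequency

namespace ColourFrequency

/-! ### Program logic -/

-- Replace `y`-coordinates by ranks and put a balanced binary tree on the ranks. A query then
-- becomes a binary search for the number of points with `y ≤ z`. A tree node with rank range `[lo,
-- lo + 2 ^ i)` owns a list of elements in `x`-order, and an element stands for the prefix of that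
-- list which ends at it. Each element points to the corresponding elements in the lists of the two
-- children, so the query searches for its `x` once, at the root, and afterwards spends constant
-- time per level apart from the collection of colours.
--
-- When the walk enters a range that starts at `lo`, all points of rank below `lo` are known to
-- satisfy `y ≤ z`. Let `h = Nat.log 2 s`. Only on entering a level divisible by `h` are these
-- points removed from the list and handed over as a chain, that is, a list of colours with weights
-- for the current prefix. On the other levels they are carried along in the list. A query therefore
-- meets `O(log_s n)` chains with weights, and each has length `O(k)`, because all its colours
-- belong to the answer. In exchange a point may be copied into both children of a node on a level
-- without a cut. The copies double at most `h - 1` times before the next cut, which gives `O(2 ^ h)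
-- = O(s)` copies per block of `h` levels and `O(s log_s n)` in total (`eltRate_mul_add_le`,
-- `eltRate_le`, `ownRate_le`).
--
-- The chains for all prefixes of one list share their tails. A point is added by prepending an
-- entry of weight one, and a chain is compacted once it has received about as many entries as it
-- had after the last compaction. This keeps its length below twice the number of colours plus one,
-- in constant amortised time per point (`wp_chainCmd`).
--
-- During a query the weights are summed in one node per colour, and these nodes, linked together,
-- are the answer. So a query allocates nothing (`queryCmd_noNew`). During the construction every
-- allocation costs a step (`Exec.next_le_add`), so the size bound follows from a bound on the
-- construction time. That time is in fact `O(n s log_s n)` (`build_bound`), which is better than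
-- what is asked for.
--
-- Programs are verified with a weakest precondition that carries a clock (`Wp`), a loop rule with a
-- potential (`Wp.while`) and a frame rule read off from the program text (`Exec.keep`). The
-- construction rests on `wp_descendCmd`, `wp_splitCmd` and `wp_task`, the query on `wp_searchCmd`,
-- `wp_turnCmd`, `wp_walkCmd` and `wp_queryCmd`, and the arithmetic on `log_estimates`.

infixr:60 " ;; " => Cmd.seq

@[simp] theorem State.set_reg (σ : State) (r : ℕ) (v : Val) (r' : ℕ) :
    (σ.set r v).reg r' = if r' = r then v else σ.reg r' := by
  simp [State.set, Function.update_apply]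

@[simp] theorem State.set_heap (σ : State) (r : ℕ) (v : Val) : (σ.set r v).heap = σ.heap := rfl

@[simp] theorem State.set_next (σ : State) (r : ℕ) (v : Val) : (σ.set r v).next = σ.next := rfl

@[simp] theorem State.write_reg (σ : State) (a f : ℕ) (v : Val) : (σ.write a f v).reg = σ.reg := rfl

@[simp] theorem State.write_next (σ : State) (a f : ℕ) (v : Val) :
    (σ.write a f v).next = σ.next := rfl

@[simp] theorem State.write_heap (σ : State) (a f : ℕ) (v : Val) (a' f' : ℕ) :
    (σ.write a f v).heap a' f' = if a' = a ∧ f' = f then v else σ.heap a' f' := by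
  by_cases h : a' = a
  · subst h; simp [State.write, Function.update_apply]
  · simp [State.write, h]

@[simp] theorem State.alloc_reg (σ : State) (r r' : ℕ) :
    (σ.alloc r).reg r' = if r' = r then .ptr σ.next else σ.reg r' := by
  simp [State.alloc, Function.update_apply]

@[simp] theorem State.alloc_next (σ : State) (r : ℕ) : (σ.alloc r).next = σ.next + 1 := rfl

@[simp] theorem State.alloc_heap (σ : State) (r a f : ℕ) :
    (σ.alloc r).heap a f = if a = σ.next then .nil else σ.heap a f := by
  by_cases h : a = σ.next
  · subst h; simp [State.alloc]
  · simp [State.alloc, h]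

/-! ### Footprints of programs, read off from their text -/

/-- `c` never writes to register `r`. -/
def Cmd.keepsReg (r : ℕ) : Cmd → Bool
  | .skip => true
  | .clear r' => r' != r
  | .const r' _ => r' != r
  | .move r' _ => r' != r
  | .add r' _ _ => r' != r
  | .sub r' _ _ => r' != r
  | .load r' _ _ => r' != r
  | .store _ _ _ => true
  | .new r' => r' != r
  | .seq c d => c.keepsReg r && d.keepsReg r
  | .ite _ c d => c.keepsReg r && d.keepsReg r
  | .while _ c => c.keepsReg r

/-- If `o` is a register that holds a pointer to a new node, forget it when register `r` is
overwritten. -/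
def forget (o : Option ℕ) (r : ℕ) : Option ℕ := if o = some r then none else o

/-- A register that is known to point to a new node after the execution of a program, given one
that is known to do so before. -/
def Cmd.newReg : Option ℕ → Cmd → Option ℕ
  | o, .skip => o
  | o, .clear r => forget o r
  | o, .const r _ => forget o r
  | o, .move r _ => forget o r
  | o, .add r _ _ => forget o r
  | o, .sub r _ _ => forget o r
  | o, .load r _ _ => forget o r
  | o, .store _ _ _ => o
  | _, .new r => some r
  | o, .seq c d => d.newReg (c.newReg o)
  | _, .ite _ _ _ => none
  | _, .while _ _ => none

/-- The program writes to field `f` of new nodes only. -/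
def Cmd.keepsFld (f : ℕ) : Option ℕ → Cmd → Bool
  | o, .store p g _ => o == some p || g != f
  | o, .seq c d => c.keepsFld f o && d.keepsFld f (c.newReg o)
  | o, .ite _ c d => c.keepsFld f o && d.keepsFld f o
  | _, .while _ c => c.keepsFld f none
  | _, _ => true

/-- The program allocates no nodes. -/
def Cmd.noNew : Cmd → Bool
  | .new _ => false
  | .seq c d => c.noNew && d.noNew
  | .ite _ c d => c.noNew && d.noNew
  | .while _ c => c.noNew
  | _ => true

theorem Exec.reg_eq {W c σ t σ'} (h : Exec W c σ t σ') {r : ℕ} (hr : c.keepsReg r = true) :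
    σ'.reg r = σ.reg r := by
  induction h <;> simp_all [Cmd.keepsReg] <;> intro h <;> simp_all

theorem Exec.next_le {W c σ t σ'} (h : Exec W c σ t σ') : σ.next ≤ σ'.next := by
  induction h <;> first | omega | (simp only [State.set_next, State.write_next, State.alloc_next]; omega)

/-- An allocation costs one step, so time bounds memory. All size bounds come from here. -/
theorem Exec.next_le_add {W c σ t σ'} (h : Exec W c σ t σ') : σ'.next ≤ σ.next + t := by
  induction h <;> first | omega | (simp only [State.set_next, State.write_next, State.alloc_next]; omega)

theorem Exec.next_eq {W c σ t σ'} (h : Exec W c σ t σ') (hc : c.noNew = true) :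
    σ'.next = σ.next := by
  induction h <;> simp_all [Cmd.noNew]

theorem forget_eq_some {o : Option ℕ} {r s : ℕ} (h : forget o r = some s) : o = some s ∧ s ≠ r := by
  unfold forget at h
  split at h
  · simp at h
  · refine ⟨h, fun e => ?_⟩
    subst e; contradiction

/-- `N` separates old nodes from new ones. A store is harmless for old nodes if its pointer register
was last filled by an allocation, which is what `Cmd.newReg` tracks along straight-line code. After
branches and loops this knowledge is dropped, and loop bodies are checked without it, since an
earlier round may have changed the register. -/
theorem Exec.keep {W c σ t σ'} (h : Exec W c σ t σ') {N : ℕ} (hN : N ≤ σ.next) (o : Option ℕ)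
    (ho : ∀ r, o = some r → ∃ a, σ.reg r = .ptr a ∧ N ≤ a) :
    (∀ r, c.newReg o = some r → ∃ a, σ'.reg r = .ptr a ∧ N ≤ a) ∧
      ∀ f, c.keepsFld f o = true → ∀ a < N, σ'.heap a f = σ.heap a f := by
  have key : ∀ (σ : State) (r : ℕ) (v : Val) (o : Option ℕ),
      (∀ r, o = some r → ∃ a, σ.reg r = .ptr a ∧ N ≤ a) →
      ∀ r', forget o r = some r' → ∃ a, (σ.set r v).reg r' = .ptr a ∧ N ≤ a := by
    intro σ r v o ho r' h
    obtain ⟨h1, h2⟩ := forget_eq_some h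
    simpa [h2] using ho r' h1
  induction h generalizing o with
  | skip σ => exact ⟨ho, fun _ _ _ _ => rfl⟩
  | clear σ r => exact ⟨key _ _ _ _ ho, fun _ _ _ _ => rfl⟩
  | const σ r m hm => exact ⟨key _ _ _ _ ho, fun _ _ _ _ => rfl⟩
  | move σ r r' => exact ⟨key _ _ _ _ ho, fun _ _ _ _ => rfl⟩
  | add => exact ⟨key _ _ _ _ ho, fun _ _ _ _ => rfl⟩
  | sub => exact ⟨key _ _ _ _ ho, fun _ _ _ _ => rfl⟩
  | load => exact ⟨key _ _ _ _ ho, fun _ _ _ _ => rfl⟩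
  | store σ p f r a hp =>
    refine ⟨ho, fun g hg b hb => ?_⟩
    simp only [Cmd.keepsFld, Bool.or_eq_true, bne_iff_ne, ne_eq, beq_iff_eq] at hg
    simp only [State.write_heap, ite_eq_right_iff, and_imp]
    rintro rfl rfl
    rcases hg.symm with hg | hg
    · exact absurd rfl hg
    · obtain ⟨a', h1, h2⟩ := ho p hg
      rw [hp] at h1
      cases h1
      omega
  | new σ r =>
    refine ⟨fun r' h => ?_, fun f _ a ha => ?_⟩
    · simp only [Cmd.newReg, Option.some.injEq] at h
      subst h
      exact ⟨σ.next, by simp, hN⟩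
    · simp only [State.alloc_heap, ite_eq_right_iff]
      intro h
      omega
  | seq hc hd ihc ihd =>
    obtain ⟨h1, h2⟩ := ihc hN o ho
    obtain ⟨h3, h4⟩ := ihd (hN.trans hc.next_le) _ h1
    refine ⟨h3, fun f hf a ha => ?_⟩
    simp only [Cmd.keepsFld, Bool.and_eq_true] at hf
    rw [h4 f hf.2 a ha, h2 f hf.1 a ha]
  | iteTrue hb hc ih =>
    refine ⟨by simp [Cmd.newReg], fun f hf a ha => ?_⟩
    simp only [Cmd.keepsFld, Bool.and_eq_true] at hf
    exact (ih hN o ho).2 f hf.1 a ha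
  | iteFalse hb hc ih =>
    refine ⟨by simp [Cmd.newReg], fun f hf a ha => ?_⟩
    simp only [Cmd.keepsFld, Bool.and_eq_true] at hf
    exact (ih hN o ho).2 f hf.2 a ha
  | whileTrue hb hc hw ih1 ih2 =>
    refine ⟨by simp [Cmd.newReg], fun f hf a ha => ?_⟩
    rw [(ih2 (hN.trans hc.next_le) none (by simp)).2 f hf a ha,
      (ih1 hN none (by simp)).2 f hf a ha]
  | whileFalse => exact ⟨by simp [Cmd.newReg], fun _ _ _ _ => rfl⟩

/-- What a look at the text of `c` tells about an execution of `c` from `σ` to `σ'`. -/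
structure Frame (c : Cmd) (σ σ' : State) : Prop where
  reg : ∀ r, c.keepsReg r = true → σ'.reg r = σ.reg r
  heap : ∀ f, c.keepsFld f none = true → ∀ a < σ.next, σ'.heap a f = σ.heap a f
  next : σ.next ≤ σ'.next

theorem Exec.frame {W c σ t σ'} (h : Exec W c σ t σ') : Frame c σ σ' :=
  ⟨fun _ hr => h.reg_eq hr, (h.keep le_rfl none (by simp)).2, h.next_le⟩

theorem Frame.refl (c : Cmd) (σ : State) : Frame c σ σ :=
  ⟨fun _ _ => rfl, fun _ _ _ _ => rfl, le_rfl⟩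

theorem Frame.trans {c : Cmd} {σ₁ σ₂ σ₃ : State} (h : Frame c σ₁ σ₂) (h' : Frame c σ₂ σ₃) :
    Frame c σ₁ σ₃ :=
  ⟨fun r hr => (h'.reg r hr).trans (h.reg r hr),
    fun f hf a ha => (h'.heap f hf a (ha.trans_le h.next)).trans (h.heap f hf a ha),
    h.next.trans h'.next⟩

/-! ### Well-formed states and their size -/

/-- All pointers lead to allocated nodes. -/
structure State.WF (σ : State) : Prop where
  reg : ∀ r a, σ.reg r = .ptr a → a < σ.next
  heap : ∀ b f a, σ.heap b f = .ptr a → a < σ.next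

theorem State.WF.set {σ : State} (h : σ.WF) (r : ℕ) {v : Val} (hv : ∀ a, v = .ptr a → a < σ.next) :
    (σ.set r v).WF := by
  refine ⟨fun r' a ha => ?_, h.heap⟩
  simp only [State.set_reg] at ha
  split at ha
  · exact hv a ha
  · exact h.reg r' a ha

/-- Without address arithmetic, a pointer is either copied from somewhere in the state or created by
an allocation. -/
theorem Exec.wf {W c σ t σ'} (h : Exec W c σ t σ') (hσ : σ.WF) : σ'.WF := by
  induction h with
  | skip σ => exact hσ
  | clear σ r => exact hσ.set r (by simp)
  | const σ r m hm => exact hσ.set r (by simp)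
  | move σ r r' => exact hσ.set r (hσ.reg r')
  | add => exact hσ.set _ (by simp)
  | sub => exact hσ.set _ (by simp)
  | load => exact hσ.set _ (hσ.heap _ _)
  | store σ p f r a hp =>
    refine ⟨hσ.reg, fun b g a' h => ?_⟩
    simp only [State.write_heap] at h
    split at h
    · exact hσ.reg r a' h
    · exact hσ.heap b g a' h
  | new σ r =>
    refine ⟨fun r' a h => ?_, fun b f a h => ?_⟩
    · simp only [State.alloc_reg] at h
      split at h
      · cases h; simp
      · exact (hσ.reg _ _ h).trans (Nat.lt_succ_self _)
    · simp only [State.alloc_heap] at h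
      split at h
      · cases h
      · exact (hσ.heap _ _ _ h).trans (Nat.lt_succ_self _)
  | seq hc hd ihc ihd => exact ihd (ihc hσ)
  | iteTrue hb hc ih => exact ih hσ
  | iteFalse hb hc ih => exact ih hσ
  | whileTrue hb hc hw ih1 ih2 => exact ih2 (ih1 hσ)
  | whileFalse => exact hσ

theorem State.WF.sizeAtMost {σ : State} (h : σ.WF) {B : ℝ} (hB : (σ.next : ℝ) ≤ B) :
    SizeAtMost σ B := by
  refine ⟨Finset.range σ.next, fun a ha => ?_, by simpa using hB⟩
  rw [Finset.mem_range]
  cases ha with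
  | reg r a h' => exact h.reg r a h'
  | field _ _ _ _ h1 => exact h.heap _ _ _ h1

/-! ### Weakest preconditions with a clock -/

/-- The program `c`, started in `σ` at time `t`, halts at a time and in a state that satisfy `Q`. -/
def Wp (W : ℕ) (c : Cmd) (Q : ℕ → State → Prop) (t : ℕ) (σ : State) : Prop :=
  ∃ u σ', Exec W c σ u σ' ∧ Q (t + u) σ'

variable {W : ℕ}

theorem Wp.mono {c : Cmd} {Q Q' : ℕ → State → Prop} {t : ℕ} {σ : State} (h : Wp W c Q t σ)
    (hQ : ∀ u σ', Frame c σ σ' → Q u σ' → Q' u σ') : Wp W c Q' t σ := by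
  obtain ⟨u, σ', h1, h2⟩ := h
  exact ⟨u, σ', h1, hQ _ _ h1.frame h2⟩

/-- Makes the footprint of a whole program available when its postcondition is proved; most program
proofs begin with it. -/
theorem Wp.frame {c : Cmd} {Q : ℕ → State → Prop} {t : ℕ} {σ : State}
    (h : Wp W c (fun u σ' => Frame c σ σ' → Q u σ') t σ) : Wp W c Q t σ :=
  h.mono fun _ _ hf hq => hq hf

/-- Hides the postcondition behind an opaque `G`, so that symbolic execution by `simp` does not
rewrite it. -/
theorem Wp.abstract {c : Cmd} {Q : ℕ → State → Prop} {t : ℕ} {σ : State}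
    (h : ∀ G : ℕ → State → Prop, (∀ u σ', Q u σ' → G u σ') → Wp W c G t σ) : Wp W c Q t σ :=
  h Q fun _ _ h => h

/-- The clock enters additively only, so a loop body can be analysed from time `0`. -/
theorem Wp.shift {c : Cmd} {Q : ℕ → State → Prop} {t : ℕ} {σ : State}
    (h : Wp W c (fun u σ' => Q (t + u) σ') 0 σ) : Wp W c Q t σ := by
  obtain ⟨u, σ', h1, h2⟩ := h
  exact ⟨u, σ', h1, by simpa using h2⟩

section

variable {Q : ℕ → State → Prop} {t : ℕ} {σ : State}

@[simp] theorem wp_skip : Wp W .skip Q t σ ↔ Q t σ := by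
  constructor
  · rintro ⟨u, σ', ⟨⟩, h⟩; exact h
  · intro h; exact ⟨0, σ, .skip σ, h⟩

@[simp] theorem wp_clear {r} : Wp W (.clear r) Q t σ ↔ Q (t + 1) (σ.set r .nil) := by
  constructor
  · rintro ⟨u, σ', ⟨⟩, h⟩; exact h
  · intro h; exact ⟨1, _, .clear σ r, h⟩

@[simp] theorem wp_const {r m} :
    Wp W (.const r m) Q t σ ↔ m ≤ W ∧ Q (t + 1) (σ.set r (.int m)) := by
  constructor
  · rintro ⟨u, σ', ⟨⟩, h⟩; exact ⟨‹_›, h⟩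
  · rintro ⟨h1, h⟩; exact ⟨1, _, .const σ r m h1, h⟩

@[simp] theorem wp_move {r r'} : Wp W (.move r r') Q t σ ↔ Q (t + 1) (σ.set r (σ.reg r')) := by
  constructor
  · rintro ⟨u, σ', ⟨⟩, h⟩; exact h
  · intro h; exact ⟨1, _, .move σ r r', h⟩

@[simp] theorem wp_add {r a b} : Wp W (.add r a b) Q t σ ↔
    ∃ m k, σ.reg a = .int m ∧ σ.reg b = .int k ∧ m + k ≤ W ∧
      Q (t + 1) (σ.set r (.int (m + k))) := by
  constructor
  · rintro ⟨u, σ', ⟨⟩, h⟩; exact ⟨_, _, ‹_›, ‹_›, ‹_›, h⟩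
  · rintro ⟨m, k, h1, h2, h3, h⟩; exact ⟨1, _, .add σ r a b m k h1 h2 h3, h⟩

@[simp] theorem wp_sub {r a b} : Wp W (.sub r a b) Q t σ ↔
    ∃ m k, σ.reg a = .int m ∧ σ.reg b = .int k ∧ Q (t + 1) (σ.set r (.int (m - k))) := by
  constructor
  · rintro ⟨u, σ', ⟨⟩, h⟩; exact ⟨_, _, ‹_›, ‹_›, h⟩
  · rintro ⟨m, k, h1, h2, h⟩; exact ⟨1, _, .sub σ r a b m k h1 h2, h⟩

@[simp] theorem wp_load {r p f} : Wp W (.load r p f) Q t σ ↔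
    ∃ a, σ.reg p = .ptr a ∧ Q (t + 1) (σ.set r (σ.heap a f)) := by
  constructor
  · rintro ⟨u, σ', ⟨⟩, h⟩; exact ⟨_, ‹_›, h⟩
  · rintro ⟨a, h1, h⟩; exact ⟨1, _, .load σ r p f a h1, h⟩

@[simp] theorem wp_store {r p f} : Wp W (.store p f r) Q t σ ↔
    ∃ a, σ.reg p = .ptr a ∧ Q (t + 1) (σ.write a f (σ.reg r)) := by
  constructor
  · rintro ⟨u, σ', ⟨⟩, h⟩; exact ⟨_, ‹_›, h⟩
  · rintro ⟨a, h1, h⟩; exact ⟨1, _, .store σ p f r a h1, h⟩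

@[simp] theorem wp_new {r} : Wp W (.new r) Q t σ ↔ Q (t + 1) (σ.alloc r) := by
  constructor
  · rintro ⟨u, σ', ⟨⟩, h⟩; exact h
  · intro h; exact ⟨1, _, .new σ r, h⟩

@[simp] theorem wp_seq {c d} : Wp W (.seq c d) Q t σ ↔ Wp W c (Wp W d Q) t σ := by
  constructor
  · rintro ⟨u, σ', h1, h⟩
    cases h1 with
    | seq hc hd => exact ⟨_, _, hc, _, _, hd, by rwa [add_assoc]⟩
  · rintro ⟨u, σ', hc, u', σ'', hd, h⟩
    exact ⟨_, _, .seq hc hd, by rwa [← add_assoc]⟩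

@[simp] theorem wp_ite {b c d} : Wp W (.ite b c d) Q t σ ↔
    (b.Holds σ → Wp W c Q (t + 1) σ) ∧ (¬ b.Holds σ → Wp W d Q (t + 1) σ) := by
  constructor
  · rintro ⟨u, σ', h1, h⟩
    cases h1 with
    | iteTrue hb hc =>
      exact ⟨fun _ => ⟨_, _, hc, by rwa [add_assoc, add_comm 1]⟩, fun h => absurd hb h⟩
    | iteFalse hb hc =>
      exact ⟨fun h => absurd h hb, fun _ => ⟨_, _, hc, by rwa [add_assoc, add_comm 1]⟩⟩
  · rintro ⟨h1, h2⟩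
    by_cases hb : b.Holds σ
    · obtain ⟨u, σ', hc, h⟩ := h1 hb
      exact ⟨_, _, .iteTrue hb hc, by rwa [add_assoc, add_comm 1] at h⟩
    · obtain ⟨u, σ', hc, h⟩ := h2 hb
      exact ⟨_, _, .iteFalse hb hc, by rwa [add_assoc, add_comm 1] at h⟩

theorem Wp.while_true {b c} (hb : b.Holds σ)
    (h : Wp W c (fun u σ' => Wp W (.while b c) Q (u + 1) σ') t σ) :
    Wp W (.while b c) Q t σ := by
  obtain ⟨u, σ', hc, u', σ'', hw, h⟩ := h
  exact ⟨_, _, .whileTrue hb hc hw, by convert h using 1; omega⟩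

theorem Wp.while_false {b c} (hb : ¬ b.Holds σ) (h : Q (t + 1) σ) : Wp W (.while b c) Q t σ :=
  ⟨_, _, .whileFalse hb, h⟩

end

/-- Loop rule with a potential: `P i` is the invariant, indexed by ghost data `i`. -/
theorem Wp.while {ι : Type*} {b : Test} {c : Cmd} {Q : ℕ → State → Prop} {σ : State}
    (P : ι → State → Prop) (cost : ι → ℕ)
    (hstep : ∀ i τ, Frame (.while b c) σ τ → P i τ → b.Holds τ →
      Wp W c (fun u τ' => Frame c τ τ' → ∃ j, P j τ' ∧ u + 1 + cost j ≤ cost i) 0 τ)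
    {i : ι} {t : ℕ} (hi : P i σ)
    (hend : ∀ j τ u, Frame (.while b c) σ τ → P j τ → ¬ b.Holds τ → u ≤ t + cost i + 1 → Q u τ) :
    Wp W (.while b c) Q t σ := by
  -- Strong induction on the potential, which serves as the termination measure too: the test alone
  -- makes it drop in every round.
  have key : ∀ k i τ t', cost i = k → Frame (.while b c) σ τ → P i τ →
      (∀ j τ u, Frame (.while b c) σ τ → P j τ → ¬ b.Holds τ → u ≤ t' + cost i + 1 → Q u τ) →
      Wp W (.while b c) Q t' τ := by
    intro k
    induction k using Nat.strong_induction_on with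
    | _ k ih =>
      intro i τ t' hk hf hP hend
      by_cases hb : b.Holds τ
      · refine Wp.while_true hb (Wp.shift ((hstep i τ hf hP hb).mono ?_))
        rintro u τ' hf' h
        obtain ⟨j, hj, hc⟩ := h hf'
        have hf2 : Frame (.while b c) σ τ' :=
          hf.trans ⟨fun r hr => hf'.reg r hr, fun f h => hf'.heap f h, hf'.next⟩
        refine ih (cost j) (by omega) j τ' _ rfl hf2 hj fun j' τ'' u' h1 h2 h3 h4 => ?_
        exact hend j' τ'' u' h1 h2 h3 (by omega)
      · exact Wp.while_false hb (hend i τ _ hf hP hb (by omega))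
  exact key _ i σ t rfl (Frame.refl _ _) hi hend

/-- Repeat `c` while register `r` is not `nil`, with register `flag` as a flag. -/
def whileSome (flag r : ℕ) (c : Cmd) : Cmd :=
  .clear flag ;; .while (.isNil flag) (.ite (.isNil r) (.const flag 0) c)

/-- Tests cannot be negated, so the loop runs while a flag is `nil` and sets the flag when the
register becomes `nil`. The two tests of a round give the `2` in the step. The `5` is the initial
clearing, the three steps of the round that sets the flag, and the final test. -/
theorem Wp.whileSome {ι : Type*} {flag r : ℕ} {c : Cmd} {Q : ℕ → State → Prop} {σ : State}
    (P : ι → State → Prop) (cost : ι → ℕ) (hc : c.keepsReg flag = true) {i : ι} {t : ℕ}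
    (hi : P i (σ.set flag .nil))
    (hstep : ∀ i τ, Frame (whileSome flag r c) σ τ → P i τ → τ.reg r ≠ .nil →
      Wp W c (fun u τ' => Frame c τ τ' → ∃ j, P j τ' ∧ u + 2 + cost j ≤ cost i) 0 τ)
    (hend : ∀ j τ u, Frame (whileSome flag r c) σ τ → P j τ → τ.reg r = .nil →
      u ≤ t + cost i + 5 → Q u (τ.set flag (.int 0))) :
    Wp W (whileSome flag r c) Q t σ := by
  rw [ColourFrequency.whileSome, wp_seq, wp_clear]
  have hf0 : Frame (ColourFrequency.whileSome flag r c) σ (σ.set flag .nil) := by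
    refine ⟨fun s hs => ?_, fun _ _ _ _ => rfl, le_rfl⟩
    simp only [ColourFrequency.whileSome, Cmd.keepsReg, Bool.and_eq_true, bne_iff_ne] at hs
    simp [Ne.symm hs.1]
  have hfw : ∀ {τ τ'}, Frame (.while (.isNil flag) (.ite (.isNil r) (.const flag 0) c)) τ τ' →
      Frame (ColourFrequency.whileSome flag r c) τ τ' := by
    intro τ τ' h
    refine ⟨fun s hs => h.reg s ?_, fun f hf => h.heap f ?_, h.next⟩
    · simp only [ColourFrequency.whileSome, Cmd.keepsReg, Bool.and_eq_true] at hs ⊢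
      exact hs.2
    · simpa [ColourFrequency.whileSome, Cmd.keepsFld, Cmd.newReg, forget] using hf
  -- The ghost value `none` marks the situation after the flag has been set; it remembers the state
  -- just before that.
  refine Wp.while (ι := Option ι)
    (fun o τ => match o with
      | some j => P j τ ∧ τ.reg flag = .nil
      | none => ∃ j τ', P j τ' ∧ τ'.reg r = .nil ∧ τ = τ'.set flag (.int 0) ∧
          Frame (ColourFrequency.whileSome flag r c) σ τ')
    (fun o => match o with | some j => cost j + 3 | none => 0) ?_ (i := some i) ⟨hi, by simp⟩ ?_
  · rintro (_ | j) τ hf hP hb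
    · obtain ⟨j, τ', -, -, rfl, -⟩ := hP
      simp [Test.Holds] at hb
    · rw [wp_ite]
      have hf' := hf0.trans (hfw hf)
      refine ⟨fun hr => ?_, fun hr => ?_⟩
      · rw [wp_const]
        refine ⟨Nat.zero_le _, fun _ => ⟨none, ⟨j, τ, hP.1, hr, rfl, hf'⟩, ?_⟩⟩
        simp only
        omega
      · refine Wp.shift ((hstep j τ hf' hP.1 hr).mono ?_)
        intro u τ' hf1 h _
        obtain ⟨j', h1, h2⟩ := h hf1
        refine ⟨some j', ⟨h1, ?_⟩, ?_⟩
        · rw [hf1.reg flag hc, hP.2]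
        · simp only
          omega
  · rintro (_ | j) τ u hf hP hb hu
    · obtain ⟨j, τ', h1, h2, rfl, h3⟩ := hP
      exact hend j τ' u h3 h1 h2 (by simp only at hu; omega)
    · exact absurd hP.2 hb

/-! ### Linked lists -/

/-- Field `f` of all old nodes is the same in `σ` and `σ'`. -/
def Keeps (f : ℕ) (σ σ' : State) : Prop :=
  σ.next ≤ σ'.next ∧ ∀ a < σ.next, σ'.heap a f = σ.heap a f

theorem Frame.keeps {c : Cmd} {σ σ' : State} (h : Frame c σ σ') (f : ℕ)
    (hf : c.keepsFld f none = true) : Keeps f σ σ' := ⟨h.next, h.heap f hf⟩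

theorem Keeps.set (f : ℕ) (σ : State) (r : ℕ) (v : Val) : Keeps f σ (σ.set r v) :=
  ⟨le_rfl, fun _ _ => rfl⟩

/-- `v` is the head of a linked list in `σ` with entries `l`. -/
def Lst (σ : State) : Val → List Val → Prop
  | v, [] => v = .nil
  | v, x :: l => ∃ c < σ.next, v = .ptr c ∧ σ.heap c 4 = x ∧ Lst σ (σ.heap c 5) l

/-- The cells are required to be old nodes, so changes to newly allocated nodes cannot affect the
list. -/
theorem Lst.keeps {σ σ' : State} {v : Val} {l : List Val} (h : Lst σ v l) (h4 : Keeps 4 σ σ')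
    (h5 : Keeps 5 σ σ') : Lst σ' v l := by
  induction l generalizing v with
  | nil => exact h
  | cons x l ih =>
    obtain ⟨c, hc, e, hx, hl⟩ := h
    refine ⟨c, hc.trans_le h4.1, e, by rw [h4.2 c hc, hx], ?_⟩
    rw [h5.2 c hc]
    exact ih hl

@[simp] theorem lst_set {σ : State} {r : ℕ} {w v : Val} {l : List Val} :
    Lst (σ.set r w) v l ↔ Lst σ v l :=
  ⟨fun h => h.keeps ⟨le_rfl, fun _ _ => rfl⟩ ⟨le_rfl, fun _ _ => rfl⟩,
    fun h => h.keeps ⟨le_rfl, fun _ _ => rfl⟩ ⟨le_rfl, fun _ _ => rfl⟩⟩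

theorem Lst.eq_nil {σ : State} {l : List Val} (h : Lst σ .nil l) : l = [] := by
  cases l with
  | nil => rfl
  | cons x l => obtain ⟨c, -, h, -⟩ := h; cases h

theorem Lst.exists_cons {σ : State} {v : Val} {l : List Val} (h : Lst σ v l) (hv : v ≠ .nil) :
    ∃ c x l', c < σ.next ∧ l = x :: l' ∧ v = .ptr c ∧ σ.heap c 4 = x ∧ Lst σ (σ.heap c 5) l' := by
  cases l with
  | nil => exact absurd h hv
  | cons x l => obtain ⟨c, h⟩ := h; exact ⟨c, x, l, h.1, rfl, h.2⟩

/-- The state after allocating a list cell with head `reg x` and tail `reg l` and putting a pointer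
to it in register `l`. -/
def State.push (σ : State) (t x l : ℕ) : State :=
  (((σ.alloc t).write σ.next 4 (σ.reg x)).write σ.next 5 (σ.reg l)).set l (.ptr σ.next)

/-- Push the content of register `x` onto the list in register `l`, using register `t`. -/
def push (t x l : ℕ) : Cmd := .new t ;; .store t 4 x ;; .store t 5 l ;; .move l t

@[simp] theorem State.push_reg (σ : State) (t x l r : ℕ) : (σ.push t x l).reg r =
    if r = l then .ptr σ.next else if r = t then .ptr σ.next else σ.reg r := by
  simp [State.push]

@[simp] theorem State.push_next (σ : State) (t x l : ℕ) : (σ.push t x l).next = σ.next + 1 := rfl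

theorem State.push_heap (σ : State) (t x l a f : ℕ) : (σ.push t x l).heap a f =
    if a = σ.next then if f = 4 then σ.reg x else if f = 5 then σ.reg l else .nil
    else σ.heap a f := by
  by_cases h : a = σ.next
  · simp only [State.push, State.set_heap, State.write_heap, State.alloc_heap, h]
    split_ifs <;> simp_all
  · simp [State.push, h]

theorem Keeps.push (f : ℕ) (σ : State) (t x l : ℕ) : Keeps f σ (σ.push t x l) :=
  ⟨Nat.le_succ _, fun a ha => by simp [State.push_heap, ha.ne]⟩

theorem Keeps.trans {f : ℕ} {σ σ' σ'' : State} (h : Keeps f σ σ') (h' : Keeps f σ' σ'') :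
    Keeps f σ σ'' :=
  ⟨h.1.trans h'.1, fun a ha => (h'.2 a (ha.trans_le h.1)).trans (h.2 a ha)⟩

@[simp] theorem wp_push {Q : ℕ → State → Prop} {u : ℕ} {σ : State} {t x l : ℕ} (hx : x ≠ t)
    (hl : l ≠ t) : Wp W (push t x l) Q u σ ↔ Q (u + 4) (σ.push t x l) := by
  simp [ColourFrequency.push, State.push, hx, hl]

@[simp] theorem keepsFld_push {f t x l : ℕ} {o : Option ℕ} :
    (push t x l).keepsFld f o = true := by
  simp [push, Cmd.keepsFld, Cmd.newReg]

@[simp] theorem keepsReg_push {r t x l : ℕ} :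
    (push t x l).keepsReg r = (t != r && l != r) := by
  simp [push, Cmd.keepsReg]

theorem Lst.push {σ : State} {t x l : ℕ} {vs : List Val} (h : Lst σ (σ.reg l) vs) :
    Lst (σ.push t x l) (.ptr σ.next) (σ.reg x :: vs) :=
  ⟨σ.next, by simp, rfl, by simp [State.push_heap], by
    simpa [State.push_heap] using h.keeps (.push 4 σ t x l) (.push 5 σ t x l)⟩

/-- Push the entries of the list in register `40` one by one onto the list in register `41`. -/
def rev : Cmd :=
  whileSome 42 40 (.load 43 40 4 ;; .load 40 40 5 ;; push 44 43 41)

theorem wp_rev {Q : ℕ → State → Prop} {t : ℕ} {σ : State} {l₁ l₂ : List Val}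
    (h₁ : Lst σ (σ.reg 40) l₁) (h₂ : Lst σ (σ.reg 41) l₂)
    (hQ : ∀ u σ', Frame rev σ σ' → Lst σ' (σ'.reg 41) (l₁.reverse ++ l₂) →
      u ≤ t + 8 * l₁.length + 5 → Q u σ') : Wp W rev Q t σ := by
  refine Wp.frame (Wp.whileSome (ι := List Val × List Val)
    (fun i τ => Lst τ (τ.reg 40) i.1 ∧ Lst τ (τ.reg 41) i.2 ∧
      i.1.reverse ++ i.2 = l₁.reverse ++ l₂)
    (fun i => 8 * i.1.length) rfl (i := (l₁, l₂)) ?_ ?_ ?_)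
  · simp [h₁, h₂]
  · rintro ⟨l, acc⟩ τ hf ⟨h1, h2, h3⟩ hr
    obtain ⟨c, x, l, hc, rfl, hv, hx, hl⟩ := h1.exists_cons hr
    simp only [wp_seq, wp_load, hv, Val.ptr.injEq, exists_eq_left', State.set_reg,
      State.set_heap, hx]
    simp [-Prod.exists]
    refine fun _ => ⟨(l, x :: acc), ⟨?_, ?_, ?_⟩, ?_⟩
    · exact Lst.keeps (by simpa) (.push _ _ _ _ _) (.push _ _ _ _ _)
    · have := Lst.push (σ := (τ.set 43 x).set 40 (τ.heap c 5)) (t := 44) (x := 43) (l := 41)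
        (vs := acc) (by simpa using h2)
      simpa using this
    · simpa using h3
    · simp only; omega
  · rintro ⟨l, acc⟩ τ u hf ⟨h1, h2, h3⟩ hr hu hf2
    rw [hr] at h1
    simp only at h1
    obtain rfl := h1.eq_nil
    refine hQ _ _ hf2 ?_ hu
    simpa [← h3] using h2

/-! ### Merging neighbours in passes -/

/-- Join the neighbours in a list of lists. -/
def pairUp (join : List ℕ → List ℕ → List ℕ) : List (List ℕ) → List (List ℕ)
  | a :: b :: ls => join a b :: pairUp join ls
  | ls => ls

/-- Halving with rounding up is the recursion of `Nat.clog 2`, which is why that function counts the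
passes. -/
theorem length_pairUp (join : List ℕ → List ℕ → List ℕ) (ls : List (List ℕ)) :
    (pairUp join ls).length = (ls.length + 1) / 2 := by
  induction ls using pairUp.induct with
  | case1 a b ls ih => simp only [pairUp, List.length_cons, ih]; omega
  | case2 ls h =>
    match ls, h with
    | [], _ => rfl
    | [a], _ => simp [pairUp]
    | a :: b :: ls, h => exact absurd rfl (h a b ls)

theorem sum_length_pairUp {join : List ℕ → List ℕ → List ℕ}
    (hj : ∀ a b, (join a b).length = a.length + b.length) (ls : List (List ℕ)) :
    ((pairUp join ls).map List.length).sum = (ls.map List.length).sum := by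
  induction ls using pairUp.induct with
  | case1 a b ls ih => simp [pairUp, ih, hj, add_assoc]
  | case2 ls h =>
    match ls, h with
    | [], _ => rfl
    | [a], _ => rfl
    | a :: b :: ls, h => exact absurd rfl (h a b ls)

theorem forall_pairUp {join : List ℕ → List ℕ → List ℕ} {p : List ℕ → Prop}
    (hj : ∀ a b, p a → p b → p (join a b)) {ls : List (List ℕ)} (h : ∀ l ∈ ls, p l) :
    ∀ l ∈ pairUp join ls, p l := by
  induction ls using pairUp.induct with
  | case1 a b ls ih =>
    simp only [List.mem_cons, forall_eq_or_imp] at h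
    simp only [pairUp, List.mem_cons, forall_eq_or_imp]
    exact ⟨hj a b h.1 h.2.1, ih h.2.2⟩
  | case2 ls h' =>
    match ls, h' with
    | [], _ => exact h
    | [a], _ => exact h
    | a :: b :: ls, h' => exact absurd rfl (h' a b ls)

/-- `v` is the head of a linked list whose entries satisfy `I`. -/
def ItemLst (I : State → Val → List ℕ → Prop) (σ : State) (v : Val) (ls : List (List ℕ)) : Prop :=
  ∃ vs, Lst σ v vs ∧ List.Forall₂ (I σ) vs ls

theorem ItemLst.mono {I I' : State → Val → List ℕ → Prop} {σ σ' : State} {v : Val}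
    {ls : List (List ℕ)} (h : ItemLst I σ v ls) (h4 : Keeps 4 σ σ') (h5 : Keeps 5 σ σ')
    (hI : ∀ v l, I σ v l → I' σ' v l) : ItemLst I' σ' v ls := by
  obtain ⟨vs, h1, h2⟩ := h
  exact ⟨vs, h1.keeps h4 h5, h2.imp hI⟩

theorem ItemLst.nil_iff {I : State → Val → List ℕ → Prop} {σ : State} {v : Val} :
    ItemLst I σ v [] ↔ v = .nil := by
  constructor
  · rintro ⟨vs, h1, h2⟩
    cases h2
    exact h1
  · rintro rfl
    exact ⟨[], rfl, .nil⟩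

theorem ItemLst.cons_iff {I : State → Val → List ℕ → Prop} {σ : State} {v : Val} {l : List ℕ}
    {ls : List (List ℕ)} : ItemLst I σ v (l :: ls) ↔
      ∃ c < σ.next, v = .ptr c ∧ I σ (σ.heap c 4) l ∧ ItemLst I σ (σ.heap c 5) ls := by
  constructor
  · rintro ⟨vs, h1, h2⟩
    cases h2 with
    | cons hx hl =>
      obtain ⟨c, hc, e, rfl, h⟩ := h1
      exact ⟨c, hc, e, hx, _, h, hl⟩
  · rintro ⟨c, hc, e, hx, vs, h, hl⟩
    exact ⟨_ :: vs, ⟨c, hc, e, rfl, h⟩, .cons hx hl⟩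

theorem ItemLst.exists_cons {I : State → Val → List ℕ → Prop} {σ : State} {v : Val}
    {ls : List (List ℕ)} (h : ItemLst I σ v ls) (hv : v ≠ .nil) :
    ∃ c l ls', c < σ.next ∧ ls = l :: ls' ∧ v = .ptr c ∧ I σ (σ.heap c 4) l ∧
      ItemLst I σ (σ.heap c 5) ls' := by
  cases ls with
  | nil => exact absurd (ItemLst.nil_iff.1 h) hv
  | cons l ls =>
    obtain ⟨c, hc, h1, h2, h3⟩ := ItemLst.cons_iff.1 h
    exact ⟨c, l, ls, hc, rfl, h1, h2, h3⟩

/-- Join neighbours in the list in register `52`, by a program that joins the items in registers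
`45` and `46` into an item in register `41`. The result is in register `53`, in reverse order. -/
def pairPass (cmb : Cmd) : Cmd :=
  whileSome 54 52 (.load 45 52 4 ;; .load 52 52 5 ;;
    .ite (.isNil 52) (.move 41 45) (.load 46 52 4 ;; .load 52 52 5 ;; cmb) ;;
    push 44 41 53)

/-- Join neighbours in the nonempty list in register `55` until a single item is left, and put it
into register `41`. -/
def pairLoop (cmb : Cmd) : Cmd :=
  .load 56 55 5 ;; whileSome 57 56 (.move 52 55 ;; .clear 53 ;; pairPass cmb ;; .move 40 53 ;;
    .clear 41 ;; rev ;; .move 55 41 ;; .load 56 55 5) ;; .load 41 55 4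

/-- The program `cmb` joins items of level `d` in registers `45` and `46` into an item of level
`d + 1` in register `41`, in linear time. -/
structure Joins (W : ℕ) (cmb : Cmd) (I : ℕ → State → Val → List ℕ → Prop)
    (join : List ℕ → List ℕ → List ℕ) (fs : List ℕ) (K : ℕ) : Prop where
  fld : ∀ f ∈ fs, cmb.keepsFld f none = true
  reg : ∀ r ∈ [52, 53, 54, 55, 57], cmb.keepsReg r = true
  four : 4 ∈ fs
  five : 5 ∈ fs
  keeps : ∀ d σ σ' v l, I d σ v l → (∀ f ∈ fs, Keeps f σ σ') → I d σ' v l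
  succ : ∀ d σ v l, I d σ v l → I (d + 1) σ v l
  length : ∀ a b, (join a b).length = a.length + b.length
  wp : ∀ d σ t Q l₁ l₂, I d σ (σ.reg 45) l₁ → I d σ (σ.reg 46) l₂ →
    (∀ u σ', Frame cmb σ σ' → I (d + 1) σ' (σ'.reg 41) (join l₁ l₂) →
      u ≤ t + K * (l₁.length + l₂.length) + K → Q u σ') → Wp W cmb Q t σ

section

variable {cmb : Cmd} {I : ℕ → State → Val → List ℕ → Prop} {join : List ℕ → List ℕ → List ℕ}
  {fs : List ℕ} {K : ℕ}

/-- Results are pushed onto an accumulator, hence the reversed order. A join is linear in the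
lengths of its items, so a pass is linear in the number of items plus their total length. -/
theorem Joins.wp_pairPass (hJ : Joins W cmb I join fs K) {Q : ℕ → State → Prop} {t d : ℕ}
    {σ : State} {ls : List (List ℕ)} (h : ItemLst (I d) σ (σ.reg 52) ls) (h53 : σ.reg 53 = .nil)
    (hQ : ∀ u σ', Frame (pairPass cmb) σ σ' →
      ItemLst (I (d + 1)) σ' (σ'.reg 53) (pairUp join ls).reverse →
      u ≤ t + ((K + 11) * ls.length + K * (ls.map List.length).sum) + 5 → Q u σ') :
    Wp W (pairPass cmb) Q t σ := by
  have hf : ∀ {τ τ'}, Frame cmb τ τ' → ∀ f ∈ fs, Keeps f τ τ' :=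
    fun h f hf => h.keeps f (hJ.fld f hf)
  have hk : ∀ r ∈ [52, 53, 54, 55, 57], cmb.keepsReg r = true := hJ.reg
  simp only [List.mem_cons, List.not_mem_nil, or_false, forall_eq_or_imp, forall_eq] at hk
  obtain ⟨k52, k53, k54, k55, k57⟩ := hk
  refine Wp.frame (Wp.whileSome (ι := List (List ℕ) × List (List ℕ))
    (fun i τ => ItemLst (I d) τ (τ.reg 52) i.1 ∧ ItemLst (I (d + 1)) τ (τ.reg 53) i.2 ∧
      (pairUp join i.1).reverse ++ i.2 = (pairUp join ls).reverse)
    (fun i => (K + 11) * i.1.length + K * (i.1.map List.length).sum)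
    (by simp [Cmd.keepsReg, k54]) (i := (ls, [])) ?_ ?_ ?_)
  · refine ⟨?_, ItemLst.nil_iff.2 (by simpa using h53), by simp⟩
    exact h.mono (Keeps.set _ _ _ _) (Keeps.set _ _ _ _)
      fun v l hI => hJ.keeps _ _ _ _ _ hI fun f _ => Keeps.set _ _ _ _
  · rintro ⟨ls', acc⟩ τ hfr ⟨h1, h2, h3⟩ hr
    obtain ⟨c, l, ls', hc, rfl, hv, hI, hls⟩ := h1.exists_cons hr
    -- the end of the body
    have fin : ∀ (u : ℕ) (τ' : State) (l' : List ℕ) (ls'' : List (List ℕ)),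
        ItemLst (I d) τ' (τ'.reg 52) ls'' → ItemLst (I (d + 1)) τ' (τ'.reg 53) acc →
        I (d + 1) τ' (τ'.reg 41) l' →
        (pairUp join ls'').reverse ++ l' :: acc = (pairUp join ls).reverse →
        u + 6 + ((K + 11) * ls''.length + K * (ls''.map List.length).sum) ≤
          (K + 11) * (l :: ls').length + K * ((l :: ls').map List.length).sum →
        ∃ j : List (List ℕ) × List (List ℕ), (ItemLst (I d) (τ'.push 44 41 53) (τ'.reg 52) j.1 ∧
            ItemLst (I (d + 1)) (τ'.push 44 41 53) (.ptr τ'.next) j.2 ∧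
            (pairUp join j.1).reverse ++ j.2 = (pairUp join ls).reverse) ∧
            u + 4 + 2 + ((K + 11) * j.1.length + K * (j.1.map List.length).sum) ≤
            (K + 11) * (l :: ls').length + K * ((l :: ls').map List.length).sum := by
      intro u τ' l' ls'' a1 a2 a3 a4 a5
      have hk : ∀ f, Keeps f τ' (τ'.push 44 41 53) := fun f => .push _ _ _ _ _
      refine ⟨(ls'', l' :: acc), ⟨?_, ?_, a4⟩, a5⟩
      · exact a1.mono (hk 4) (hk 5) fun v l hI => hJ.keeps _ _ _ _ _ hI fun f _ => hk f
      · refine ItemLst.cons_iff.2 ⟨τ'.next, by simp, rfl, ?_, ?_⟩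
        · simpa [State.push_heap] using hJ.keeps _ _ _ _ _ a3 fun f _ => hk f
        · simpa [State.push_heap] using a2.mono (hk 4) (hk 5) 
            fun v l hI => hJ.keeps _ _ _ _ _ hI fun f _ => hk f
    have hs : ∀ {d τ r v w ls}, ItemLst (I d) τ w ls → ItemLst (I d) (τ.set r v) w ls :=
      fun h => h.mono (Keeps.set _ _ _ _) (Keeps.set _ _ _ _) fun v l hI =>
        hJ.keeps _ _ _ _ _ hI fun f _ => Keeps.set _ _ _ _
    have hs' : ∀ {d τ r v w l}, I d τ w l → I d (τ.set r v) w l :=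
      fun h => hJ.keeps _ _ _ _ _ h fun f _ => Keeps.set _ _ _ _
    simp [hv, Test.Holds, -Prod.exists, -List.map_cons, -List.length_cons]
    refine ⟨fun hn _ => ?_, fun hn => ?_⟩
    -- With an odd number of items the last one has no partner. It moves up unchanged, and
    -- `Joins.succ` lifts its level.
    · rw [hn] at hls
      have hls' : ls' = [] := by
        cases ls' with
        | nil => rfl
        | cons l ls' => obtain ⟨_, _, h, _⟩ := ItemLst.cons_iff.1 hls; cases h
      subst hls'
      have := fin 4 (((τ.set 45 (τ.heap c 4)).set 52 (τ.heap c 5)).set 41 (τ.heap c 4)) l []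
        (by simpa using hs (hs (hs (hn ▸ hls)))) (by simpa using hs (hs (hs h2)))
        (by simpa using hs' (hs' (hs' (hJ.succ _ _ _ _ hI)))) (by simpa [pairUp] using h3)
        (by simp; nlinarith)
      simpa using this
    · obtain ⟨c', l', ls', hc', rfl, hv', hI', hls'⟩ := hls.exists_cons hn
      refine ⟨c', hv', c', hv', ?_⟩
      refine hJ.wp d _ _ _ l l' (by simpa using hs' (hs' (hs' (hs' hI))))
        (by simpa using hs' (hs' (hs' (hs' hI')))) fun u τ' hf1 hI1 hu => ?_
      have hks : ∀ f ∈ fs, Keeps f τ τ' := fun f hh => ⟨(hf hf1 f hh).1, (hf hf1 f hh).2⟩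
      rw [wp_push (by decide) (by decide)]
      intro _
      have := fin u τ' (join l l') ls' ?_ ?_ hI1 (by simpa [pairUp] using h3) ?_
      · simpa [hf1.reg 52 k52] using this
      · rw [hf1.reg 52 k52]
        simpa using hls'.mono (hks 4 hJ.four) (hks 5 hJ.five)
          fun v l hI => hJ.keeps _ _ _ _ _ hI hks
      · rw [hf1.reg 53 k53]
        simpa using h2.mono (hks 4 hJ.four) (hks 5 hJ.five)
          fun v l hI => hJ.keeps _ _ _ _ _ hI hks
      · simp only [List.length_cons, List.map_cons, List.sum_cons]
        linarith
  · rintro ⟨ls', acc⟩ τ u hfr ⟨h1, h2, h3⟩ hr hu hf2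
    rw [hr] at h1
    simp only at h1 h2 h3
    have hls' : ls' = [] := by
      cases ls' with
      | nil => rfl
      | cons l ls' => obtain ⟨_, _, h, _⟩ := ItemLst.cons_iff.1 h1; cases h
    subst hls'
    refine hQ _ _ hf2 ?_ hu
    have hacc : acc = (pairUp join ls).reverse := by simpa [pairUp] using h3
    rw [← hacc]
    simpa using h2.mono (Keeps.set 4 _ _ _) (Keeps.set 5 _ _ _)
      fun v l hI => hJ.keeps _ _ _ _ _ hI fun f _ => Keeps.set f _ 54 (.int 0)

theorem ItemLst.rev {I : State → Val → List ℕ → Prop} {σ σ' : State} {v' : Val}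
    {ls : List (List ℕ)} {vs : List Val} (h : List.Forall₂ (I σ) vs ls)
    (hv : Lst σ' v' vs.reverse) (hI : ∀ v l, I σ v l → I σ' v l) :
    ItemLst I σ' v' ls.reverse :=
  ⟨vs.reverse, hv, List.rel_reverse (h.imp hI)⟩

/-- The number of items halves while their total length stays at most `N`, so `Nat.clog 2` passes of
linear time suffice. The predicate `M` is any property that passes preserve; it brings sortedness or
the order of the leaves to the last item. -/
theorem Joins.wp_pairLoop (hJ : Joins W cmb I join fs K) {Q : ℕ → State → Prop} {t d N : ℕ}
    {σ : State} {ls : List (List ℕ)} (h : ItemLst (I d) σ (σ.reg 55) ls) (hls : ls ≠ [])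
    (hN : ls.length ≤ N) (hN' : (ls.map List.length).sum ≤ N) (M : List (List ℕ) → Prop)
    (hM : ∀ ls, M ls → M (pairUp join ls)) (hM0 : M ls)
    (hQ : ∀ u σ' l, Frame (pairLoop cmb) σ σ' →
      I (d + Nat.clog 2 ls.length) σ' (σ'.reg 41) l → M [l] →
      u ≤ t + (2 * K + 40) * N * Nat.clog 2 ls.length + 10 → Q u σ') :
    Wp W (pairLoop cmb) Q t σ := by
  have hf : ∀ {τ τ'}, Frame cmb τ τ' → ∀ f ∈ fs, Keeps f τ τ' :=
    fun h f hf => h.keeps f (hJ.fld f hf)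
  have hfp : ∀ {τ τ'}, Frame (pairPass cmb) τ τ' → ∀ f ∈ fs, Keeps f τ τ' :=
    fun h f hf => h.keeps f (by
      simp [pairPass, whileSome, Cmd.keepsFld, Cmd.newReg, forget, hJ.fld f hf])
  have hk : ∀ r ∈ [52, 53, 54, 55, 57], cmb.keepsReg r = true := hJ.reg
  simp only [List.mem_cons, List.not_mem_nil, or_false, forall_eq_or_imp, forall_eq] at hk
  obtain ⟨k52, k53, k54, k55, k57⟩ := hk
  have hs : ∀ {d τ r v w ls}, ItemLst (I d) τ w ls → ItemLst (I d) (τ.set r v) w ls :=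
    fun h => h.mono (Keeps.set _ _ _ _) (Keeps.set _ _ _ _) fun v l hI =>
      hJ.keeps _ _ _ _ _ hI fun f _ => Keeps.set _ _ _ _
  refine Wp.frame ?_
  rw [pairLoop, wp_seq, wp_load]
  obtain ⟨c, l, ls', hc, e, hv, hI, hls'⟩ := h.exists_cons (by
    intro hn
    rw [hn] at h
    cases ls with
    | nil => exact hls rfl
    | cons l ls => obtain ⟨_, _, h, _⟩ := ItemLst.cons_iff.1 h; cases h)
  refine ⟨c, hv, ?_⟩
  rw [wp_seq]
  refine Wp.whileSome (ι := List (List ℕ))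
    (fun i τ => ∃ d', d' + Nat.clog 2 i.length = d + Nat.clog 2 ls.length ∧
      ItemLst (I d') τ (τ.reg 55) i ∧ (∃ c, τ.reg 55 = .ptr c ∧ τ.reg 56 = τ.heap c 5) ∧
      i.length ≤ N ∧ (i.map List.length).sum ≤ N ∧ M i)
    (fun i => (2 * K + 40) * N * Nat.clog 2 i.length) (i := ls) ?_ ?_ ?_ ?_
  · simp [Cmd.keepsReg, pairPass, whileSome, rev, k57]
  · refine ⟨d, rfl, by simpa using hs (hs h), ⟨c, by simpa using hv, by simp⟩, hN, hN', hM0⟩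
  · rintro i τ hfr ⟨d', h1, h2, ⟨c, h3, h3'⟩, h4, h5, h6⟩ hr
    obtain ⟨c', l, i', hc', rfl, hv', hI', hls''⟩ := h2.exists_cons (by simp [h3])
    rw [h3] at hv'
    cases hv'
    rw [h3'] at hr
    obtain ⟨c2, l2, i', hc2, rfl, hv2, hI2, hls2⟩ := hls''.exists_cons hr
    simp only [wp_seq, wp_move, wp_clear]
    refine hJ.wp_pairPass (d := d') (ls := l :: l2 :: i') (by simpa using hs (hs h2)) (by simp) ?_
    intro u τ' hf1 hacc hu
    simp only [wp_seq, wp_move, wp_clear]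
    obtain ⟨vs, hv1, hv2⟩ := hacc
    refine wp_rev (l₁ := vs) (l₂ := []) (by simpa using hv1) (by simp [Lst]) ?_
    intro u' τ'' hf2 hl hu'
    have hlen := hv2.length_eq
    rw [List.length_reverse, length_pairUp] at hlen
    have hit : ItemLst (I (d' + 1)) τ'' (τ''.reg 41) (pairUp join (l :: l2 :: i')) := by
      have := ItemLst.rev hv2 (by simpa using hl) fun v l hI => hJ.keeps _ _ τ'' _ _ hI
        fun f _ => (Keeps.set f _ _ _).trans ((Keeps.set f _ _ _).trans (hf2.keeps f ?_))
      · simpa using this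
      · simp [rev, whileSome, Cmd.keepsFld]
    obtain ⟨c3, hc3, hv3, hI3, hls3⟩ := ItemLst.cons_iff.1 hit
    simp [hv3, -Prod.exists]
    -- One pass lowers the ceiling logarithm by exactly one. This pays for the pass in the
    -- potential, and it balances the increase of the level.
    have hclog : Nat.clog 2 (i'.length + 1 + 1) =
        Nat.clog 2 (pairUp join (l :: l2 :: i')).length + 1 := by
      rw [length_pairUp, Nat.clog_of_two_le one_lt_two (by omega)]
      rfl
    refine fun _ => ⟨pairUp join (l :: l2 :: i'), ⟨d' + 1, ?_, ?_, ?_, ?_, hM _ h6⟩, ?_⟩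
    · rw [← h1, List.length_cons, List.length_cons, hclog]
      omega
    · simpa using hs (hs (hv3 ▸ hit))
    · rw [length_pairUp]; simp only [List.length_cons] at h4 ⊢; omega
    · rw [sum_length_pairUp hJ.length]
      exact h5
    · rw [hclog, Nat.mul_succ]
      have h7 : K * (l :: l2 :: i').length ≤ K * N := Nat.mul_le_mul_left _ h4
      have h8 : K * ((l :: l2 :: i').map List.length).sum ≤ K * N := Nat.mul_le_mul_left _ h5
      have h9 : 2 ≤ N := le_trans (by simp) h4
      have h10 : vs.length ≤ N := by rw [hlen]; omega
      generalize (l :: l2 :: i').length = L at *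
      generalize ((l :: l2 :: i').map List.length).sum = S at *
      have : u' + 4 ≤ (2 * K + 40) * N := by linarith
      omega
  · rintro i τ u hfr ⟨d', h1, h2, ⟨c, h3, h3'⟩, h4, h5, h6⟩ hr hu
    obtain ⟨c', l, i', hc', rfl, hv', hI', hls''⟩ := h2.exists_cons (by simp [h3])
    rw [h3] at hv'
    cases hv'
    rw [← h3', hr] at hls''
    have hi' : i' = [] := by
      cases i' with
      | nil => rfl
      | cons l i' => obtain ⟨_, _, h, _⟩ := ItemLst.cons_iff.1 hls''; cases h
    subst hi'
    rw [wp_load]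
    refine ⟨c, by simpa using h3, fun hfr' => hQ _ _ l hfr' ?_ h6 (by omega)⟩
    have h7 : d' = d + Nat.clog 2 ls.length := by simpa using h1
    rw [← h7]
    simpa using hJ.keeps _ _ _ _ _ hI' fun f _ =>
      (Keeps.set f τ 57 (.int 0)).trans (Keeps.set f _ 41 (τ.heap c 4))

end

/-! ### Sorting -/

/-- Merge the sorted lists in registers `45` and `46` by field `k` of their entries, into register
`41`. -/
def mergeCmd (k : ℕ) : Cmd :=
  .clear 41 ;; whileSome 51 45
    (.ite (.isNil 46) (.load 47 45 4 ;; .load 45 45 5 ;; push 44 47 41)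
      (.load 47 45 4 ;; .load 48 46 4 ;; .load 49 47 k ;; .load 50 48 k ;;
        .ite (.le 49 50) (.load 47 45 4 ;; .load 45 45 5 ;; push 44 47 41)
          (.load 48 46 4 ;; .load 46 46 5 ;; push 44 48 41))) ;;
  .move 40 46 ;; rev ;; .move 40 41 ;; .clear 41 ;; rev

/-- `v` is the head of a list of nodes `l`, whose fields `k` are given by `key`. -/
def KeyLst (k : ℕ) (key : ℕ → Val) (σ : State) (v : Val) (l : List ℕ) : Prop :=
  Lst σ v (l.map .ptr) ∧ ∀ a ∈ l, a < σ.next ∧ σ.heap a k = key a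

/-- Merge two lists by their keys. -/
noncomputable def mergeBy (key : ℕ → Val) (l₁ l₂ : List ℕ) : List ℕ :=
  open Classical in l₁.merge l₂ fun a b => decide ((key a).Le (key b))

theorem KeyLst.keeps {k : ℕ} {key : ℕ → Val} {σ σ' : State} {v : Val} {l : List ℕ}
    (h : KeyLst k key σ v l) (h4 : Keeps 4 σ σ') (h5 : Keeps 5 σ σ') (hk : Keeps k σ σ') :
    KeyLst k key σ' v l :=
  ⟨h.1.keeps h4 h5, fun a ha => ⟨(h.2 a ha).1.trans_le hk.1, by
    rw [hk.2 a (h.2 a ha).1, (h.2 a ha).2]⟩⟩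

theorem KeyLst.exists_cons {k : ℕ} {key : ℕ → Val} {σ : State} {v : Val} {l : List ℕ}
    (h : KeyLst k key σ v l) (hv : v ≠ .nil) :
    ∃ c a l', c < σ.next ∧ l = a :: l' ∧ v = .ptr c ∧ σ.heap c 4 = .ptr a ∧ a < σ.next ∧
      σ.heap a k = key a ∧ KeyLst k key σ (σ.heap c 5) l' := by
  cases l with
  | nil => exact absurd h.1 hv
  | cons a l =>
    obtain ⟨⟨c, hc, h1, h2, h3⟩, h4⟩ := h
    have := h4 a (by simp)
    exact ⟨c, a, l, hc, rfl, h1, h2, this.1, this.2, h3, fun b hb => h4 b (by simp [hb])⟩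

theorem KeyLst.push {k : ℕ} {key : ℕ → Val} {σ : State} {t x r a : ℕ} {l : List ℕ}
    (h : KeyLst k key σ (σ.reg r) l) (hx : σ.reg x = .ptr a) (ha : a < σ.next)
    (hk : σ.heap a k = key a) : KeyLst k key (σ.push t x r) (.ptr σ.next) (a :: l) := by
  refine ⟨?_, ?_⟩
  · simpa [hx] using h.1.push (t := t) (x := x)
  · have h' := (h.keeps (.push 4 σ t x r) (.push 5 σ t x r) (.push k σ t x r)).2
    simp only [List.mem_cons, forall_eq_or_imp]
    refine ⟨⟨by simp; omega, ?_⟩, h'⟩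
    rw [(Keeps.push k σ t x r).2 a ha, hk]

@[simp] theorem keyLst_set {k : ℕ} {key : ℕ → Val} {σ : State} {r : ℕ} {w v : Val} {l : List ℕ} :
    KeyLst k key (σ.set r w) v l ↔ KeyLst k key σ v l := by
  simp [KeyLst]

theorem keepsFld_mergeCmd (f k : ℕ) : (mergeCmd k).keepsFld f none = true := by
  simp [mergeCmd, rev, whileSome, Cmd.keepsFld, Cmd.newReg, forget]

theorem Val.le_trans {key : ℕ → Val} : ∀ a b c, (key a).Le (key b) → (key b).Le (key c) →
    (key a).Le (key c) := by
  intro a b c h1 h2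
  cases ha : key a <;> cases hb : key b <;> cases hc : key c <;>
    simp_all only [Val.Le] <;> exact _root_.le_trans h1 h2

/-- The loop invariant is that the output so far, reversed, followed by the merge of the remainders,
is the full merge. The loop ends when the first list is empty; the second may still have entries. -/
theorem wp_mergeCmd {k : ℕ} {key : ℕ → Val} {Q : ℕ → State → Prop} {t : ℕ} {σ : State}
    {l₁ l₂ : List ℕ} (h₁ : KeyLst k key σ (σ.reg 45) l₁) (h₂ : KeyLst k key σ (σ.reg 46) l₂)
    (hQ : ∀ u σ', Frame (mergeCmd k) σ σ' → KeyLst k key σ' (σ'.reg 41) (mergeBy key l₁ l₂) →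
      u ≤ t + 30 * (l₁.length + l₂.length) + 30 → Q u σ') : Wp W (mergeCmd k) Q t σ := by
  refine Wp.frame ?_
  simp only [mergeCmd, wp_seq, wp_clear]
  refine Wp.whileSome (ι := List ℕ × List ℕ × List ℕ)
    (fun i τ => KeyLst k key τ (τ.reg 45) i.1 ∧ KeyLst k key τ (τ.reg 46) i.2.1 ∧
      KeyLst k key τ (τ.reg 41) i.2.2 ∧
      i.2.2.reverse ++ mergeBy key i.1 i.2.1 = mergeBy key l₁ l₂ ∧
      i.2.2.length + i.1.length + i.2.1.length = l₁.length + l₂.length)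
    (fun i => 14 * (i.1.length + i.2.1.length)) rfl (i := (l₁, l₂, [])) ?_ ?_ ?_
  · simp [h₁, h₂]
    exact ⟨rfl, by simp⟩
  · rintro ⟨la, lb, out⟩ τ hf ⟨h1, h2, h3, h4, h5⟩ hr
    obtain ⟨c, a, la, hc, rfl, hv, hx, ha, hk, hl⟩ := h1.exists_cons hr
    have hkk : ∀ τ' : State, ∀ f, Keeps f τ' (τ'.push 44 47 41) := fun τ' f => .push _ _ _ _ _
    have hkk' : ∀ τ' : State, ∀ f, Keeps f τ' (τ'.push 44 48 41) := fun τ' f => .push _ _ _ _ _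
    rw [wp_ite]
    refine ⟨fun hn => ?_, fun hn => ?_⟩
    · simp only [Test.Holds] at hn
      have hlb : lb = [] := by
        cases lb with
        | nil => rfl
        | cons b lb => obtain ⟨c, -, h, -⟩ := h2.1; rw [hn] at h; cases h
      subst hlb
      simp [hv, hx, -Prod.exists]
      refine fun _ => ⟨(la, [], a :: out), ⟨?_, ?_, ?_, ?_, ?_⟩, ?_⟩
      · exact KeyLst.keeps (by simpa using hl) (hkk _ _) (hkk _ _) (hkk _ _)
      · exact KeyLst.keeps (by simpa using h2) (hkk _ _) (hkk _ _) (hkk _ _)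
      · exact KeyLst.push (by simpa using h3) (by simp) ha hk
      · simpa [mergeBy] using h4
      · simp only [List.length_cons] at h5 ⊢; omega
      · simp only [List.length_nil]; omega
    · simp only [Test.Holds] at hn
      obtain ⟨c', b, lb, hc', rfl, hv', hx', hb, hk', hl'⟩ := h2.exists_cons hn
      simp [hv, hx, hv', hx', Test.Holds, hk, hk', -Prod.exists]
      refine ⟨fun hle _ => ⟨(la, b :: lb, a :: out), ⟨?_, ?_, ?_, ?_, ?_⟩, ?_⟩,
        fun hle _ => ⟨(a :: la, lb, b :: out), ⟨?_, ?_, ?_, ?_, ?_⟩, ?_⟩⟩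
      · exact KeyLst.keeps (by simpa using hl) (hkk _ _) (hkk _ _) (hkk _ _)
      · exact KeyLst.keeps (by simpa [hv'] using h2) (hkk _ _) (hkk _ _) (hkk _ _)
      · exact KeyLst.push (by simpa using h3) (by simp) ha hk
      · rw [← h4]; simp [mergeBy, List.cons_merge_cons, hle]
      · simp only [List.length_cons] at h5 ⊢; omega
      · simp only [List.length_cons]; omega
      · exact KeyLst.keeps (by simpa [hv] using h1) (hkk' _ _) (hkk' _ _) (hkk' _ _)
      · exact KeyLst.keeps (by simpa using hl') (hkk' _ _) (hkk' _ _) (hkk' _ _)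
      · exact KeyLst.push (by simpa using h3) (by simp) hb hk'
      · rw [← h4]; simp [mergeBy, List.cons_merge_cons, hle]
      · simp only [List.length_cons] at h5 ⊢; omega
      · simp only [List.length_cons]; omega
  · rintro ⟨la, lb, out⟩ τ u hf ⟨h1, h2, h3, h4, h5⟩ hr hu
    rw [hr] at h1
    simp only at h1 h2 h3 h4 h5 hu
    have hla : la = [] := by
      cases la with
      | nil => rfl
      | cons b lb => obtain ⟨c, -, h, -⟩ := h1.1; cases h
    subst hla
    simp only [wp_seq, wp_move, wp_clear]
    -- The rest of the second list is poured onto the reversed output; reversing everything once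
    -- more yields the merged order.
    refine wp_rev (l₁ := lb.map .ptr) (l₂ := out.map .ptr) (by simpa using h2.1)
      (by simpa using h3.1) fun u1 τ1 hf1 hl1 hu1 => ?_
    simp only [wp_seq, wp_move, wp_clear]
    refine wp_rev (l₁ := (lb.map .ptr).reverse ++ out.map .ptr) (l₂ := []) (by simpa using hl1)
      (by simp [Lst]) fun u2 τ2 hf2 hl2 hu2 hff => hQ _ _ hff ⟨?_, ?_⟩ ?_
    · rw [← h4]
      simpa [mergeBy] using hl2
    · intro a ha
      have ha' : a ∈ l₁ ++ l₂ := (List.merge_perm_append _).subset ha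
      have h12 : a < σ.next ∧ σ.heap a k = key a := by
        rcases List.mem_append.1 ha' with h | h
        · exact h₁.2 a h
        · exact h₂.2 a h
      have := hff.keeps k (keepsFld_mergeCmd k k)
      exact ⟨h12.1.trans_le this.1, by rw [this.2 a h12.1, h12.2]⟩
    · simp only [List.length_append, List.length_map, List.length_reverse] at hu1 hu2
      simp only [List.length_nil] at h5
      omega

theorem joins_mergeCmd (k : ℕ) (key : ℕ → Val) :
    Joins W (mergeCmd k) (fun _ => KeyLst k key) (mergeBy key) [4, 5, k] 30 where
  fld f _ := keepsFld_mergeCmd f k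
  reg := by
    simp [mergeCmd, rev, whileSome, Cmd.keepsReg]
  four := by simp
  five := by simp
  keeps d σ σ' v l h hf := h.keeps (hf 4 (by simp)) (hf 5 (by simp)) (hf k (by simp))
  succ _ _ _ _ h := h
  length a b := List.length_merge ..
  wp d σ t Q l₁ l₂ h1 h2 hQ := wp_mergeCmd h1 h2 hQ

/-- Sort the list in register `10` by field `k` of its entries. -/
def sortCmd (k : ℕ) : Cmd :=
  .clear 55 ;; whileSome 58 10 (.load 47 10 4 ;; .load 10 10 5 ;; .clear 48 ;; push 44 47 48 ;;
    push 44 48 55) ;; pairLoop (mergeCmd k) ;; .move 10 41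

/-- Merge sort from below, starting with singletons. Totality is a hypothesis because `Val.Le`
compares only values of the same kind. -/
theorem wp_sortCmd {k : ℕ} {key : ℕ → Val} (htot : ∀ a b, (key a).Le (key b) ∨ (key b).Le (key a))
    {Q : ℕ → State → Prop} {t : ℕ} {σ : State} {l : List ℕ} (hl : l ≠ [])
    (h : KeyLst k key σ (σ.reg 10) l)
    (hQ : ∀ u σ' l', Frame (sortCmd k) σ σ' → KeyLst k key σ' (σ'.reg 10) l' → l'.Perm l →
      l'.Pairwise (fun a b => (key a).Le (key b)) →
      u ≤ t + 100 * l.length * Nat.clog 2 l.length + 20 * l.length + 20 → Q u σ') :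
    Wp W (sortCmd k) Q t σ := by
  classical
  refine Wp.frame ?_
  simp only [sortCmd, wp_seq, wp_clear]
  refine Wp.whileSome (ι := List ℕ × List (List ℕ))
    (fun i τ => KeyLst k key τ (τ.reg 10) i.1 ∧ ItemLst (KeyLst k key) τ (τ.reg 55) i.2 ∧
      (i.2.flatten ++ i.1).Perm l ∧ i.2.length + i.1.length = l.length ∧ ∀ l' ∈ i.2, l'.length = 1)
    (fun i => 13 * i.1.length) rfl (i := (l, [])) ?_ ?_ ?_
  · simpa [h] using ItemLst.nil_iff.2 rfl
  · rintro ⟨l1, ls⟩ τ hf ⟨h1, h2, h3, h4, h5⟩ hr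
    obtain ⟨c, a, l1, hc, rfl, hv, hx, ha, hk, hl1⟩ := h1.exists_cons hr
    simp [hv, hx, -Prod.exists]
    intro _
    set τ1 := (((τ.set 47 (Val.ptr a)).set 10 (τ.heap c 5)).set 48 Val.nil).push 44 47 48 with hτ1
    have hk1 : ∀ f, Keeps f τ τ1 := fun f => Keeps.push f (((τ.set 47 _).set 10 _).set 48 _) _ _ _
    have hk2 : ∀ f, Keeps f τ (τ1.push 44 48 55) := fun f => (hk1 f).trans (Keeps.push f _ _ _ _)
    refine ⟨(l1, [a] :: ls), ⟨?_, ?_, ?_, ?_, ?_⟩, ?_⟩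
    · exact hl1.keeps (hk2 _) (hk2 _) (hk2 _)
    · have hnew : KeyLst k key τ1 (.ptr τ.next) [a] := by
        refine KeyLst.push (σ := ((τ.set 47 (Val.ptr a)).set 10 (τ.heap c 5)).set 48 Val.nil)
          (by simp [KeyLst, Lst]) (by simp) ha hk
      refine ItemLst.cons_iff.2 ⟨τ1.next, by simp [hτ1], by simp [hτ1], ?_, ?_⟩
      · simpa [State.push_heap, hτ1] using hnew.keeps (.push 4 τ1 44 48 55) (.push 5 τ1 44 48 55)
          (.push k τ1 44 48 55)
      · have := h2.mono (hk2 4) (hk2 5) fun v l hI => KeyLst.keeps hI (hk2 4) (hk2 5) (hk2 k)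
        have e : (τ1.push 44 48 55).heap τ1.next 5 = τ.reg 55 := by
          rw [State.push_heap]; simp [hτ1]
        rw [e]
        exact this
    · refine List.Perm.trans ?_ h3
      simp only [List.flatten_cons, List.cons_append, List.nil_append]
      exact List.perm_middle.symm
    · simp only [List.length_cons] at h4 ⊢; omega
    · simpa using h5
    · simp only; omega
  · rintro ⟨l1, ls⟩ τ u hf ⟨h1, h2, h3, h4, h5⟩ hr hu
    rw [hr] at h1
    simp only at h1 h2 h3 h4 h5 hu
    have hl1 : l1 = [] := by
      cases l1 with
      | nil => rfl
      | cons b lb => obtain ⟨c, -, h, -⟩ := h1.1; cases h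
    subst hl1
    have hlen : ls.length = l.length := by simpa using h4
    have hsum : (ls.map List.length).sum = l.length := by
      rw [← List.length_flatten, ← h3.length_eq]; simp
    rw [wp_seq]
    -- The property preserved by passes: together the lists are a permutation of the input, and each
    -- of them is sorted.
    refine (joins_mergeCmd k key).wp_pairLoop (d := 0) (N := l.length) (ls := ls) ?_ ?_ hlen.le
      hsum.le (fun ls => ls.flatten.Perm l ∧ ∀ l' ∈ ls, l'.Pairwise (fun a b => (key a).Le (key b)))
      ?_ ?_ ?_
    · have := h2.mono (Keeps.set 4 τ 58 (.int 0)) (Keeps.set 5 τ 58 (.int 0)) fun v l hI =>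
        KeyLst.keeps hI (Keeps.set 4 τ 58 (.int 0)) (Keeps.set 5 τ 58 (.int 0))
          (Keeps.set k τ 58 (.int 0))
      simpa using this
    · rintro rfl
      exact hl (List.length_eq_zero_iff.1 hlen.symm)
    · rintro ls ⟨hp, hs⟩
      refine ⟨List.Perm.trans ?_ hp, forall_pairUp (fun a b ha hb => ?_) hs⟩
      · clear hp hs
        induction ls using pairUp.induct with
        | case1 a b ls ih =>
          simp only [pairUp, List.flatten_cons, ← List.append_assoc]
          exact List.Perm.append (List.merge_perm_append _) ih
        | case2 ls h =>
          match ls, h with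
          | [], _ => exact .refl _
          | [a], _ => exact .refl _
          | a :: b :: ls, h => exact absurd rfl (h a b ls)
      · have := List.pairwise_merge (le := fun a b => decide ((key a).Le (key b)))
          (by simpa using Val.le_trans) (by simpa using htot) a b (by simpa using ha)
          (by simpa using hb)
        simpa [mergeBy] using this
    · refine ⟨by simpa using h3, fun l' hl' => ?_⟩
      obtain ⟨a, rfl⟩ := List.length_eq_one_iff.1 (h5 l' hl')
      simp
    · intro u' σ' l' hf1 h6 ⟨h7, h8⟩ hu'
      rw [wp_move]
      intro hff
      refine hQ _ _ l' hff (by simpa using h6) (by simpa using h7) (h8 l' (by simp)) ?_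
      rw [hlen] at hu'
      norm_num at hu'
      omega

/-! ### Reading the input -/

/-- The `x`-coordinate of point `a`. -/
def xOf {n : ℕ} (p : Fin n → ℝ × ℝ) (a : ℕ) : ℝ := if h : a < n then (p ⟨a, h⟩).1 else 0

/-- The `y`-coordinate of point `a`. -/
def yOf {n : ℕ} (p : Fin n → ℝ × ℝ) (a : ℕ) : ℝ := if h : a < n then (p ⟨a, h⟩).2 else 0

/-- The colour of point `a`. -/
def colOf {n : ℕ} (col : Fin n → ℕ) (a : ℕ) : ℕ := if h : a < n then col ⟨a, h⟩ else 0

/-- List the points in register `10`, count them in register `3`, and copy their coordinates and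
colours to the fields `7`, `8`, `9`. -/
def readCmd : Cmd :=
  .clear 10 ;; .const 3 0 ;; .const 4 1 ;; whileSome 5 0
    (.load 11 0 0 ;; .store 0 7 11 ;; .load 11 0 1 ;; .store 0 8 11 ;; .load 11 0 2 ;;
      .store 0 9 11 ;; push 12 0 10 ;; .add 3 3 4 ;; .load 0 0 3)

/-- Footprints are tracked by field name. Later programs write the fields `1` and `2` of colour
nodes, so the data of the points are moved to field names that those programs leave alone. -/
theorem wp_readCmd {n s : ℕ} {p : Fin n → ℝ × ℝ} {col : Fin n → ℕ} (hn : 0 < n) (hW : n ≤ W)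
    {Q : ℕ → State → Prop} {t : ℕ}
    (hQ : ∀ u σ', Frame readCmd (inputState p col s) σ' →
      Lst σ' (σ'.reg 10) ((List.range n).reverse.map .ptr) → σ'.reg 3 = .int n →
      σ'.reg 4 = .int 1 → (∀ a < n, σ'.heap a 7 = .real (xOf p a) ∧
        σ'.heap a 8 = .real (yOf p a) ∧ σ'.heap a 9 = .colour (colOf col a)) →
      u ≤ t + 14 * n + 8 → Q u σ') :
    Wp W readCmd Q t (inputState p col s) := by
  refine Wp.frame ?_
  simp only [readCmd, wp_seq, wp_clear, wp_const]
  refine ⟨Nat.zero_le _, by omega, ?_⟩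
  refine Wp.whileSome (ι := ℕ)
    (fun i τ => i ≤ n ∧ τ.reg 0 = (if i < n then .ptr i else .nil) ∧
      Lst τ (τ.reg 10) ((List.range i).reverse.map .ptr) ∧ τ.reg 3 = .int i ∧ τ.reg 4 = .int 1 ∧
      ∀ a < i, τ.heap a 7 = .real (xOf p a) ∧
        τ.heap a 8 = .real (yOf p a) ∧ τ.heap a 9 = .colour (colOf col a))
    (fun i => 14 * (n - i)) rfl (i := 0) ?_ ?_ ?_
  · simp [hn, Lst, inputState]
  · rintro i τ hf ⟨h0, h1, h2, h3, h4, h5⟩ hr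
    have hi : i < n := by
      by_contra hi
      simp [hi] at h1
      exact hr h1
    rw [if_pos hi] at h1
    have hnext : n ≤ τ.next := hf.next
    have e0 := hf.heap 0 rfl i hi
    have e1 := hf.heap 1 rfl i hi
    have e2 := hf.heap 2 rfl i hi
    have e3 := hf.heap 3 rfl i hi
    simp [inputState, hi] at e0 e1 e2 e3
    refine Wp.abstract fun G hG => ?_
    simp [h1, h3, h4, e0, e1, e2, State.push_heap, (hi.trans_le hnext).ne]
    refine ⟨by omega, hG _ _ fun hfr => ⟨i + 1, ⟨by omega, ?_, ?_, by simp, by simp [h4], ?_⟩,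
      by omega⟩⟩
    · simp [e3]
    · simp only [List.range_succ, List.reverse_append, List.reverse_cons, List.reverse_nil,
        List.nil_append, List.cons_append, List.map_cons]
      have h2' := h2.keeps (hfr.keeps 4 rfl) (hfr.keeps 5 rfl)
      simp only [lst_set] at h2'
      refine ⟨τ.next, by simp, by simp, ?_, ?_⟩
      · simp [State.push_heap, h1]
      · simpa [State.push_heap] using h2'
    · intro a ha
      rcases Nat.lt_succ_iff_lt_or_eq.1 ha with ha | rfl
      · have : a ≠ i := ha.ne
        have h6 : a ≠ τ.next := by omega
        simpa [this, h6, State.push_heap] using h5 a ha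
      · simp [xOf, yOf, colOf, hi]
        have h6 : a ≠ τ.next := by omega
        simp [h6, State.push_heap]
  · rintro i τ u hf ⟨h0, h1, h2, h3, h4, h5⟩ hr hu hfr
    have hi : i = n := by
      by_contra hi
      rw [hr, if_pos (by omega)] at h1
      cases h1
    subst hi
    refine hQ _ _ hfr (by simpa using h2) (by simpa using h3) (by simpa using h4)
      (by simpa using h5) (by omega)

/-! ### Colour nodes -/

/-- Sort the points in the list in register `10` by colour, and let field `10` of each point
contain a pointer to a node for its colour. -/
def colourCmd : Cmd :=
  sortCmd 9 ;; .move 11 10 ;; .clear 12 ;; .clear 13 ;; whileSome 14 11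
    (.load 15 11 4 ;; .load 11 11 5 ;; .load 16 15 9 ;;
      .ite (.eq 16 12) .skip (.new 13 ;; .store 13 0 16 ;; .move 12 16) ;; .store 15 10 13)

/-- After sorting, points of one colour are consecutive, so comparing with the last colour decides
whether a new colour node is needed. The ghost function `cn` sends a point to its colour node and
grows along the scan. -/
theorem wp_colourCmd {C : ℕ → ℕ} {Q : ℕ → State → Prop} {t : ℕ} {σ : State} {l : List ℕ}
    (hl : l ≠ []) (hd : l.Nodup) (h : KeyLst 9 (fun a => .colour (C a)) σ (σ.reg 10) l)
    (hQ : ∀ u σ' (l' : List ℕ) (cn : ℕ → ℕ), Frame colourCmd σ σ' → Lst σ' (σ'.reg 10) (l'.map .ptr) → l'.Perm l →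
      (∀ a ∈ l, σ'.heap a 10 = .ptr (cn a) ∧ cn a < σ'.next ∧ σ'.heap (cn a) 0 = .colour (C a) ∧
        σ'.heap (cn a) 18 = .nil) → (∀ a ∈ l, ∀ b ∈ l, C a = C b → cn a = cn b) →
      u ≤ t + 100 * l.length * Nat.clog 2 l.length + 31 * l.length + 28 → Q u σ') :
    Wp W colourCmd Q t σ := by
  refine Wp.frame ?_
  rw [colourCmd, wp_seq]
  refine wp_sortCmd (key := fun a => .colour (C a)) (fun a b => le_total (C a) (C b)) hl h fun u σ₁ l₁ hf₁ h₁ hp hs hu => ?_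
  have hd₁ : l₁.Nodup := hp.nodup_iff.2 hd
  simp only [wp_seq, wp_move, wp_clear]
  refine Wp.whileSome (ι := List ℕ × List ℕ × (ℕ → ℕ))
    (fun i τ => KeyLst 9 (fun a => .colour (C a)) τ (τ.reg 11) i.1 ∧
      i.2.1.reverse ++ i.1 = l₁ ∧
      (∀ a ∈ i.2.1, τ.heap a 10 = .ptr (i.2.2 a) ∧ i.2.2 a < τ.next ∧
        τ.heap (i.2.2 a) 0 = .colour (C a) ∧ τ.heap (i.2.2 a) 18 = .nil) ∧
      (∀ a ∈ i.2.1, ∀ b ∈ i.2.1, C a = C b → i.2.2 a = i.2.2 b) ∧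
      (i.2.1 = [] ∧ τ.reg 12 = .nil ∨ ∃ a pre, i.2.1 = a :: pre ∧ τ.reg 12 = .colour (C a) ∧
        τ.reg 13 = .ptr (i.2.2 a)))
    (fun i => 11 * i.1.length) rfl (i := (l₁, [], id)) ?_ ?_ ?_
  · simpa using h₁
  · rintro ⟨rest, pre, cn⟩ τ hf ⟨h1, h2, h3, h4, h5⟩ hr
    obtain ⟨c, a, rest, hc, rfl, hv, hx, ha, hk, hrest⟩ := h1.exists_cons hr
    simp only at h2 h3 h4 h5
    have hapre : a ∉ pre := by
      intro hm
      rw [← h2, List.nodup_append] at hd₁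
      exact hd₁.2.2 a (by simpa using hm) a (by simp) rfl
    have hpre : ∀ b ∈ pre, C b ≤ C a := by
      intro b hb
      rw [← h2, List.pairwise_append] at hs
      exact hs.2.2 b (by simpa using hb) a (by simp)
    -- The list `pre` is in reverse order, so its head was processed last and has the greatest
    -- colour so far.
    have hpre' : ∀ b pre', pre = b :: pre' → ∀ b' ∈ pre, C b' ≤ C b := by
      rintro b pre' rfl b' hb'
      rcases List.mem_cons.1 hb' with rfl | hb'
      · exact le_rfl
      · rw [← h2, List.pairwise_append, List.reverse_cons, List.pairwise_append] at hs
        exact hs.1.2.2 b' (by simpa using hb') b (by simp)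
    have hlt : ∀ b ∈ pre, b < τ.next ∧ b ≠ a := fun b hb =>
      ⟨(h₁.2 b (by rw [← h2]; simp [hb])).1.trans_le hf.next, fun e => hapre (e ▸ hb)⟩
    have hupd : ∀ w, ∀ b ∈ pre, Function.update cn a w b = cn b := fun w b hb =>
      Function.update_of_ne (hlt b hb).2 _ _
    refine Wp.abstract fun G hG => ?_
    simp [hv, hx, hk, Test.Holds]
    refine ⟨fun he => hG _ _ fun hfr => ?_, fun he => hG _ _ fun hfr => ?_⟩
    · obtain ⟨rfl, h5⟩ | ⟨b, pre, rfl, h5, h6⟩ := h5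
      · rw [h5] at he; cases he
      rw [h5, Val.colour.injEq] at he
      refine ⟨(rest, a :: b :: pre, Function.update cn a (cn b)), ⟨?_, ?_, ?_, ?_, ?_⟩, ?_⟩
      · simpa using hrest.keeps (hfr.keeps 4 rfl) (hfr.keeps 5 rfl) (hfr.keeps 9 rfl)
      · simpa using h2
      · intro b' hb'
        rcases List.mem_cons.1 hb' with rfl | hb'
        · simp [h6, he, h3 b (by simp)]
        · simp only [hupd _ b' hb']
          simpa [(hlt b' hb').2] using h3 b' hb'
      · have hb : ∀ b' ∈ b :: pre, C a = C b' → cn b = cn b' := fun b' hb' e =>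
          h4 b (by simp) b' hb' (he ▸ e)
        intro b₁ hb₁ b₂ hb₂ e
        rcases List.mem_cons.1 hb₁ with rfl | hc₁ <;> rcases List.mem_cons.1 hb₂ with rfl | hc₂
        · rfl
        · simpa [hupd _ b₂ hc₂] using hb b₂ hc₂ e
        · simpa [hupd _ b₁ hc₁] using (hb b₁ hc₁ e.symm).symm
        · simpa [hupd _ b₁ hc₁, hupd _ b₂ hc₂] using h4 b₁ hc₁ b₂ hc₂ e
      · exact Or.inr ⟨a, b :: pre, rfl, by simp [h5, he], by simp [h6]⟩
      · simp only [List.length_cons]; omega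
    -- If the colour had occurred before, sortedness would squeeze the last colour between two equal
    -- ones, and the test would have succeeded.
    · have hne : ∀ b ∈ pre, C a ≠ C b := by
        obtain ⟨rfl, h5⟩ | ⟨b, pre, rfl, h5, h6⟩ := h5
        · simp
        · intro b' hb' e
          refine he ?_
          rw [h5, Val.colour.injEq]
          exact le_antisymm (e ▸ hpre' b pre rfl b' hb') (hpre b (by simp))
      refine ⟨(rest, a :: pre, Function.update cn a τ.next), ⟨?_, ?_, ?_, ?_, ?_⟩, ?_⟩
      · simpa using hrest.keeps (hfr.keeps 4 rfl) (hfr.keeps 5 rfl) (hfr.keeps 9 rfl)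
      · simpa using h2
      · intro b' hb'
        rcases List.mem_cons.1 hb' with rfl | hb'
        · simp
        · have h7 := h3 b' hb'
          simp only [hupd _ b' hb']
          simpa [(hlt b' hb').2, (hlt b' hb').1.ne, h7.2.1.ne, h7.2.1.le]
            using And.intro h7.1 h7.2.2
      · intro b₁ hb₁ b₂ hb₂ e
        rcases List.mem_cons.1 hb₁ with rfl | hc₁ <;> rcases List.mem_cons.1 hb₂ with rfl | hc₂
        · rfl
        · exact absurd e (hne b₂ hc₂)
        · exact absurd e.symm (hne b₁ hc₁)
        · simpa [hupd _ b₁ hc₁, hupd _ b₂ hc₂] using h4 b₁ hc₁ b₂ hc₂ e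
      · exact Or.inr ⟨a, pre, rfl, by simp, by simp⟩
      · simp only [List.length_cons]; omega
  · rintro ⟨rest, pre, cn⟩ τ u' hf ⟨h1, h2, h3, h4, h5⟩ hr hu' hff
    rw [hr] at h1
    simp only at h1 h2 h3 h4 hu'
    have hrest : rest = [] := by
      cases rest with
      | nil => rfl
      | cons b lb => obtain ⟨c, -, h, -⟩ := h1.1; cases h
    subst hrest
    have hm : ∀ a ∈ l, a ∈ pre := fun a ha => by
      have := hp.mem_iff.2 ha
      rw [← h2] at this
      simpa using this
    refine hQ _ _ l₁ cn hff ?_ hp (fun a ha => by simpa using h3 a (hm a ha))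
      (fun a ha b hb => h4 a (hm a ha) b (hm b hb)) ?_
    · have h10 := h₁.1.keeps ((Keeps.set 4 _ _ _).trans ((Keeps.set 4 _ _ _).trans
        ((Keeps.set 4 _ _ _).trans (hf.keeps 4 rfl)))) ((Keeps.set 5 _ _ _).trans
        ((Keeps.set 5 _ _ _).trans ((Keeps.set 5 _ _ _).trans (hf.keeps 5 rfl))))
      simpa [hf.reg 10 rfl] using h10
    · rw [hp.length_eq] at hu'
      omega

/-! ### Ranks -/

/-- Sort the points in the list in register `10` by `y`, and number them in field `11`. -/
def rankCmd : Cmd :=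
  sortCmd 8 ;; .move 11 10 ;; .const 17 0 ;; .const 4 1 ;; whileSome 14 11
    (.load 15 11 4 ;; .load 11 11 5 ;; .store 15 11 17 ;; .add 17 17 4)

/-- Ranks are positions in a sorted list. They are distinct even if `y`-coordinates coincide, and
this is how ties are broken everywhere below. -/
theorem wp_rankCmd {Y : ℕ → ℝ} {Q : ℕ → State → Prop} {t : ℕ} {σ : State} {l : List ℕ}
    (hl : l ≠ []) (hd : l.Nodup) (hW : l.length ≤ W)
    (h : KeyLst 8 (fun a => .real (Y a)) σ (σ.reg 10) l)
    (hQ : ∀ u σ' (l' : List ℕ), Frame rankCmd σ σ' → Lst σ' (σ'.reg 10) (l'.map .ptr) →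
      l'.Perm l → l'.Pairwise (fun a b => Y a ≤ Y b) →
      (∀ a ∈ l, σ'.heap a 11 = .int (l'.idxOf a)) →
      u ≤ t + 100 * l.length * Nat.clog 2 l.length + 26 * l.length + 28 → Q u σ') :
    Wp W rankCmd Q t σ := by
  refine Wp.frame ?_
  rw [rankCmd, wp_seq]
  refine wp_sortCmd (key := fun a => .real (Y a)) (fun a b => le_total (Y a) (Y b)) hl h
    fun u σ₁ l₁ hf₁ h₁ hp hs hu => ?_
  have hd₁ : l₁.Nodup := hp.nodup_iff.2 hd
  have hl0 : 0 < l.length := List.length_pos_iff.2 hl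
  simp only [wp_seq, wp_move, wp_const]
  refine ⟨Nat.zero_le _, by omega, ?_⟩
  refine Wp.whileSome (ι := List ℕ × List ℕ)
    (fun i τ => KeyLst 8 (fun a => .real (Y a)) τ (τ.reg 11) i.1 ∧
      i.2.reverse ++ i.1 = l₁ ∧ τ.reg 17 = .int i.2.length ∧ τ.reg 4 = .int 1 ∧
      (∀ a ∈ i.2, τ.heap a 11 = .int (l₁.idxOf a)))
    (fun i => 6 * i.1.length) rfl (i := (l₁, [])) ?_ ?_ ?_
  · simpa using h₁
  · rintro ⟨rest, pre⟩ τ hf ⟨h1, h2, h3, h4, h5⟩ hr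
    obtain ⟨c, a, rest, hc, rfl, hv, hx, ha, hk, hrest⟩ := h1.exists_cons hr
    simp only at h2 h3 h4 h5
    have hapre : a ∉ pre := by
      intro hm
      rw [← h2, List.nodup_append] at hd₁
      exact hd₁.2.2 a (by simpa using hm) a (by simp) rfl
    have hidx : l₁.idxOf a = pre.length := by
      rw [← h2, List.idxOf_append_of_notMem (by simpa using hapre)]
      simp
    have hlen : pre.length + 1 ≤ l.length := by
      rw [← hp.length_eq, ← h2]; simp
    refine Wp.abstract fun G hG => ?_
    simp [hv, hx, h3, h4]
    refine ⟨by omega, hG _ _ fun hfr => ⟨(rest, a :: pre), ⟨?_, ?_, ?_, ?_, ?_⟩, ?_⟩⟩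
    · simpa using hrest.keeps (hfr.keeps 4 rfl) (hfr.keeps 5 rfl) (hfr.keeps 8 rfl)
    · simpa using h2
    · simp
    · simp [h4]
    · intro b hb
      rcases List.mem_cons.1 hb with rfl | hb
      · simp [hidx]
      · have : b ≠ a := fun e => hapre (e ▸ hb)
        simpa [this] using h5 b hb
    · simp only [List.length_cons]; omega
  · rintro ⟨rest, pre⟩ τ u' hf ⟨h1, h2, h3, h4, h5⟩ hr hu' hff
    rw [hr] at h1
    simp only at h1 h2 h3 h4 hu'
    have hrest : rest = [] := by
      cases rest with
      | nil => rfl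
      | cons b lb => obtain ⟨c, -, h, -⟩ := h1.1; cases h
    subst hrest
    refine hQ _ _ l₁ hff ?_ hp hs (fun a ha => by
      have := hp.mem_iff.2 ha
      rw [← h2] at this
      simpa using h5 a (by simpa using this)) ?_
    · have h10 := h₁.1.keeps ((Keeps.set 4 _ _ _).trans ((Keeps.set 4 _ _ _).trans
        ((Keeps.set 4 _ _ _).trans (hf.keeps 4 rfl)))) ((Keeps.set 5 _ _ _).trans
        ((Keeps.set 5 _ _ _).trans ((Keeps.set 5 _ _ _).trans (hf.keeps 5 rfl))))
      simpa [hf.reg 10 rfl] using h10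
    · rw [hp.length_eq] at hu'
      omega

/-! ### Elements -/

/-- `e` is an element for the point `p`, whose links to other elements are still empty. -/
structure NewElem (σ : State) (e p : ℕ) : Prop where
  lt : e < σ.next
  point : σ.heap e 12 = .ptr p
  links : ∀ f ∈ [13, 14, 15, 16, 17], σ.heap e f = .nil

/-- Sort the points in the list in register `10` by `x`, and replace them by new elements. -/
def elemCmd : Cmd :=
  sortCmd 7 ;; .clear 18 ;; whileSome 14 10
    (.load 15 10 4 ;; .load 10 10 5 ;; .load 16 15 7 ;; .new 19 ;; .store 19 12 15 ;;
      .store 19 19 16 ;; push 20 19 18) ;;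
  .move 40 18 ;; .clear 41 ;; rev ;; .move 10 41

/-- `R` pairs elements with points in descending `x`-order, while the machine holds the reverse.
With this convention, also used below, a prefix in `x`-order is a suffix `t <:+ R`, and the head of
`t` is the last element of the prefix. -/
theorem wp_elemCmd {X : ℕ → ℝ} {Q : ℕ → State → Prop} {t : ℕ} {σ : State} {l : List ℕ}
    (hl : l ≠ []) (h : KeyLst 7 (fun a => .real (X a)) σ (σ.reg 10) l)
    (hQ : ∀ u σ' (R : List (ℕ × ℕ)), Frame elemCmd σ σ' →
      Lst σ' (σ'.reg 10) (R.reverse.map fun e => .ptr e.1) → (R.map Prod.snd).Perm l →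
      R.Pairwise (fun a b => X b.2 ≤ X a.2) → (R.map Prod.fst).Nodup →
      (∀ e ∈ R, σ.next ≤ e.1 ∧ NewElem σ' e.1 e.2 ∧ σ'.heap e.1 19 = .real (X e.2) ∧
        σ'.heap e.1 20 = .nil) →
      u ≤ t + 100 * l.length * Nat.clog 2 l.length + 41 * l.length + 40 → Q u σ') :
    Wp W elemCmd Q t σ := by
  refine Wp.frame ?_
  rw [elemCmd, wp_seq]
  refine wp_sortCmd (key := fun a => .real (X a)) (fun a b => le_total (X a) (X b)) hl h
    fun u σ₁ l₁ hf₁ h₁ hp hs hu => ?_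
  simp only [wp_seq, wp_clear]
  refine Wp.whileSome (ι := List ℕ × List (ℕ × ℕ))
    (fun i τ => KeyLst 7 (fun a => .real (X a)) τ (τ.reg 10) i.1 ∧
      (i.2.map Prod.snd).reverse ++ i.1 = l₁ ∧ Lst τ (τ.reg 18) (i.2.map fun e => .ptr e.1) ∧
      (i.2.map Prod.fst).Nodup ∧
      (∀ e ∈ i.2, σ.next ≤ e.1 ∧ NewElem τ e.1 e.2 ∧ τ.heap e.1 19 = .real (X e.2) ∧
        τ.heap e.1 20 = .nil))
    (fun i => 12 * i.1.length) rfl (i := (l₁, [])) ?_ ?_ ?_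
  · simpa [Lst] using h₁
  · rintro ⟨rest, R⟩ τ hf ⟨h1, h2, h3, h4, h5⟩ hr
    obtain ⟨c, a, rest, hc, rfl, hv, hx, ha, hk, hrest⟩ := h1.exists_cons hr
    simp only at h2 h3 h4 h5
    have hlt : ∀ e ∈ R, e.1 < τ.next := fun e he => (h5 e he).2.1.lt
    have hnext : σ.next ≤ τ.next := hf₁.next.trans hf.next
    refine Wp.abstract fun G hG => ?_
    simp [hv, hx, hk, ha.ne]
    refine hG _ _ fun hfr => ⟨(rest, (τ.next, a) :: R), ⟨?_, ?_, ?_, ?_, ?_⟩, ?_⟩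
    · simpa using hrest.keeps (hfr.keeps 4 rfl) (hfr.keeps 5 rfl) (hfr.keeps 7 rfl)
    · simpa using h2
    · have h3' := h3.keeps (hfr.keeps 4 rfl) (hfr.keeps 5 rfl)
      exact ⟨τ.next + 1, by simp, by simp, by simp [State.push_heap], by
        simpa [State.push_heap] using h3'⟩
    · simp only [List.map_cons, List.nodup_cons]
      refine ⟨fun hm => ?_, h4⟩
      obtain ⟨e, he, h6⟩ := List.mem_map.1 hm
      exact (hlt e he).ne h6
    · intro e he
      rcases List.mem_cons.1 he with rfl | he
      · exact ⟨hnext, ⟨by simp, by simp [State.push_heap], by simp [State.push_heap]⟩,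
          by simp [State.push_heap], by simp [State.push_heap]⟩
      · obtain ⟨h6, ⟨h7, h8, h9⟩, h10, h11⟩ := h5 e he
        refine ⟨h6, ⟨h7.trans_le hfr.next, ?_, fun f hf => ?_⟩, ?_, ?_⟩
        · rw [hfr.heap 12 rfl _ h7, h8]
        · rw [← h9 f hf]
          refine hfr.heap f ?_ _ h7
          simp only [List.mem_cons, List.not_mem_nil, or_false] at hf
          rcases hf with rfl | rfl | rfl | rfl | rfl <;> rfl
        · rw [hfr.heap 19 rfl _ h7, h10]
        · rw [hfr.heap 20 rfl _ h7, h11]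
    · simp only [List.length_cons]; omega
  · rintro ⟨rest, R⟩ τ u' hf ⟨h1, h2, h3, h4, h5⟩ hr hu'
    rw [hr] at h1
    simp only at h1 h2 h3 h4 h5 hu'
    have hrest : rest = [] := by
      cases rest with
      | nil => rfl
      | cons b lb => obtain ⟨c, -, h, -⟩ := h1.1; cases h
    subst hrest
    simp only [wp_seq, wp_move, wp_clear]
    have hR : R.length = l.length := by rw [← hp.length_eq, ← h2]; simp
    refine wp_rev (l₁ := R.map fun e => Val.ptr e.1) (l₂ := []) (by simpa using h3) (by simp [Lst])
      fun u2 τ2 hf2 hl2 hu2 => ?_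
    rw [wp_move]
    refine fun hff => hQ _ _ R hff ?_ ?_ ?_ h4 ?_ ?_
    · simpa using hl2
    · refine List.Perm.trans ?_ hp
      rw [← h2, List.append_nil]
      exact (List.reverse_perm _).symm
    · rw [← h2, List.append_nil, ← List.map_reverse, List.pairwise_map] at hs
      exact List.pairwise_reverse.1 hs
    · intro e he
      obtain ⟨h6, ⟨h7, h8, h9⟩, h10, h11⟩ := h5 e he
      have hk : ∀ f, (τ2.set 10 (τ2.reg 41)).heap e.1 f = τ.heap e.1 f := fun f =>
        hf2.heap f (by simp [rev, whileSome, Cmd.keepsFld]) _ h7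
      exact ⟨h6, ⟨h7.trans_le hf2.next, by rw [hk, h8], fun f hf => by rw [hk, h9 f hf]⟩,
        by rw [hk, h10], by rw [hk, h11]⟩
    · simp only [List.length_map] at hu2
      rw [hp.length_eq] at hu'
      omega

/-! ### Search trees -/

/-- `v` is the root of a search tree of depth at most `d` with leaves `l`. Field `19` of a node
contains the least key in its subtree; the key of a leaf `e` is `X e`. -/
def TreeAt (X : ℕ → ℝ) : ℕ → State → Val → List ℕ → Prop
  | 0, σ, v, l => ∃ e < σ.next, v = .ptr e ∧ l = [e] ∧ σ.heap e 20 = .nil ∧ σ.heap e 19 = .real (X e)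
  | d + 1, σ, v, l => TreeAt X d σ v l ∨ ∃ u < σ.next, ∃ l₁ l₂, v = .ptr u ∧ l = l₁ ++ l₂ ∧
      TreeAt X d σ (σ.heap u 20) l₁ ∧ TreeAt X d σ (σ.heap u 21) l₂ ∧
      ∃ e l', l = e :: l' ∧ σ.heap u 19 = .real (X e)

theorem TreeAt.keeps {X : ℕ → ℝ} {d : ℕ} {σ σ' : State} {v : Val} {l : List ℕ}
    (h : TreeAt X d σ v l) (h19 : Keeps 19 σ σ') (h20 : Keeps 20 σ σ') (h21 : Keeps 21 σ σ') :
    TreeAt X d σ' v l := by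
  induction d generalizing v l with
  | zero =>
    obtain ⟨e, he, h1, h2, h3, h4⟩ := h
    exact ⟨e, he.trans_le h19.1, h1, h2, by rw [h20.2 e he, h3], by rw [h19.2 e he, h4]⟩
  | succ d ih =>
    rcases h with h | ⟨u, hu, l₁, l₂, h1, h2, h3, h4, e, l', h5, h6⟩
    · exact Or.inl (ih h)
    · refine Or.inr ⟨u, hu.trans_le h19.1, l₁, l₂, h1, h2, ?_, ?_, e, l', h5, ?_⟩
      · rw [h20.2 u hu]; exact ih h3
      · rw [h21.2 u hu]; exact ih h4
      · rw [h19.2 u hu, h6]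

/-- A tree also counts as a tree of any greater depth; this strips such liftings until an actual
leaf or inner node appears. The strict decrease `d' < d` bounds the descent of a search. -/
theorem TreeAt.root {X : ℕ → ℝ} {d : ℕ} {σ : State} {v : Val} {l : List ℕ}
    (h : TreeAt X d σ v l) : ∃ u < σ.next, v = .ptr u ∧ ∃ e l', l = e :: l' ∧
      σ.heap u 19 = .real (X e) ∧ ((σ.heap u 20 = .nil ∧ u = e ∧ l' = []) ∨ ∃ d' < d, ∃ l₁ l₂,
        l = l₁ ++ l₂ ∧ TreeAt X d' σ (σ.heap u 20) l₁ ∧ TreeAt X d' σ (σ.heap u 21) l₂) := by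
  induction d generalizing v l with
  | zero =>
    obtain ⟨e, he, h1, h2, h3, h4⟩ := h
    exact ⟨e, he, h1, e, [], h2, h4, Or.inl ⟨h3, rfl, rfl⟩⟩
  | succ d ih =>
    rcases h with h | ⟨u, hu, l₁, l₂, h1, h2, h3, h4, e, l', h5, h6⟩
    · obtain ⟨u, hu, h1, e, l', h2, h3, h4⟩ := ih h
      refine ⟨u, hu, h1, e, l', h2, h3, h4.imp id ?_⟩
      rintro ⟨d', hd, h⟩
      exact ⟨d', by omega, h⟩
    · exact ⟨u, hu, h1, e, l', h5, h6, Or.inr ⟨d, by omega, l₁, l₂, h2, h3, h4⟩⟩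

/-- Join the trees in registers `45` and `46`. -/
def joinTree : Cmd :=
  .load 44 45 19 ;; .new 41 ;; .store 41 19 44 ;; .store 41 20 45 ;; .store 41 21 46

theorem joins_joinTree (X : ℕ → ℝ) :
    Joins W joinTree (TreeAt X) (fun a b => a ++ b) [4, 5, 19, 20, 21] 5 where
  fld f _ := by simp [joinTree, Cmd.keepsFld, Cmd.newReg]
  reg := by simp [joinTree, Cmd.keepsReg]
  four := by simp
  five := by simp
  keeps d σ σ' v l h hf := h.keeps (hf 19 (by simp)) (hf 20 (by simp)) (hf 21 (by simp))
  succ _ _ _ _ h := Or.inl h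
  length a b := List.length_append
  wp d σ t Q l₁ l₂ h1 h2 hQ := by
    obtain ⟨u, hu, e1, e, l', e2, e3, -⟩ := h1.root
    obtain ⟨u', hu', e1', -⟩ := h2.root
    have hfld : ∀ f, joinTree.keepsFld f none = true := fun f => by
      simp [joinTree, Cmd.keepsFld, Cmd.newReg]
    refine Wp.frame ?_
    refine Wp.abstract fun G hG => ?_
    simp [joinTree, e1, e3]
    refine hG _ _ fun hf => hQ _ _ hf (Or.inr ⟨σ.next, by simp, l₁, l₂, by simp, rfl, ?_, ?_,
      e, l' ++ l₂, by simp [e2], by simp⟩) (by omega)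
    · simpa [e1] using h1.keeps (hf.keeps 19 (hfld _)) (hf.keeps 20 (hfld _)) (hf.keeps 21 (hfld _))
    · simpa [e1'] using
        h2.keeps (hf.keeps 19 (hfld _)) (hf.keeps 20 (hfld _)) (hf.keeps 21 (hfld _))

/-- Build a search tree for the list in register `10` and put it into register `2`. -/
def treeCmd : Cmd := .move 55 10 ;; pairLoop joinTree ;; .move 2 41

theorem wp_treeCmd {X : ℕ → ℝ} {Q : ℕ → State → Prop} {t : ℕ} {σ : State} {l : List ℕ}
    (hl : l ≠ []) (h : Lst σ (σ.reg 10) (l.map .ptr))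
    (he : ∀ e ∈ l, e < σ.next ∧ σ.heap e 20 = .nil ∧ σ.heap e 19 = .real (X e))
    (hQ : ∀ u σ', Frame treeCmd σ σ' → TreeAt X (Nat.clog 2 l.length) σ' (σ'.reg 2) l →
      u ≤ t + 50 * l.length * Nat.clog 2 l.length + 12 → Q u σ') :
    Wp W treeCmd Q t σ := by
  refine Wp.frame ?_
  simp only [treeCmd, wp_seq, wp_move]
  have hflat : ∀ l : List ℕ, (l.map fun e => [e]).flatten = l := fun l => by
    induction l with
    | nil => rfl
    | cons a l ih => simpa using ih
  refine (joins_joinTree X).wp_pairLoop (d := 0) (N := l.length) (ls := l.map fun e => [e])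
    ⟨l.map .ptr, by simpa using h, ?_⟩ (by simpa using hl) (by simp) ?_
    (fun ls => ls.flatten = l) ?_ (hflat l) fun u σ' l' hf h1 h2 hu => ?_
  · clear hQ
    rw [List.forall₂_map_left_iff, List.forall₂_map_right_iff, List.forall₂_same]
    intro e h'
    obtain ⟨h1, h2, h3⟩ := he e h'
    exact ⟨e, h1, rfl, rfl, h2, h3⟩
  · rw [List.map_map]
    simp [Function.comp_def]
  · rintro ls rfl
    clear hQ h he hl
    induction ls using pairUp.induct with
    | case1 a b ls ih =>
      simp only [pairUp, List.flatten_cons, List.append_assoc]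
      rw [ih]
    | case2 ls h' =>
      match ls, h' with
      | [], _ => rfl
      | [a], _ => rfl
      | a :: b :: ls, h' => exact absurd rfl (h' a b ls)
  · rw [wp_move]
    refine fun hff => hQ _ _ hff ?_ ?_
    · have := h1.keeps (Keeps.set 19 _ 2 (σ'.reg 41)) (Keeps.set 20 _ _ _) (Keeps.set 21 _ _ _)
      simp only [List.flatten_cons, List.flatten_nil, List.append_nil] at h2
      simpa [h2] using this
    · norm_num at hu ⊢
      omega

/-- Search the tree in register `2` for the last leaf whose key is at most the number in register
`0`, and put it into register `60`. -/
def searchCmd : Cmd :=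
  .move 60 2 ;; .load 62 60 20 ;; whileSome 63 62
    (.load 64 60 21 ;; .load 65 64 19 ;; .ite (.le 65 0) (.move 60 64) (.move 60 62) ;;
      .load 62 60 20) ;;
  .load 65 60 19 ;; .ite (.le 65 0) .skip (.clear 60)

/-- The least key of the right subtree tells which side contains the last leaf with key at most `x`.
Leaves to the right of the current subtree have greater keys, and its first key is at most `x`
unless no leaf has been passed on the left. -/
theorem wp_searchCmd {X : ℕ → ℝ} {Q : ℕ → State → Prop} {t d : ℕ} {σ : State} {l : List ℕ} {x : ℝ}
    (hs : l.Pairwise fun a b => X a ≤ X b) (hx : σ.reg 0 = .real x)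
    (h : TreeAt X d σ (σ.reg 2) l)
    (hQ : ∀ u σ', Frame searchCmd σ σ' →
      ((σ'.reg 60 = .nil ∧ ∀ e ∈ l, x < X e) ∨ ∃ l₁ e l₂, l = l₁ ++ e :: l₂ ∧ σ'.reg 60 = .ptr e ∧
        (∀ e' ∈ l₁, X e' ≤ x) ∧ X e ≤ x ∧ ∀ e' ∈ l₂, x < X e') →
      u ≤ t + 7 * d + 12 → Q u σ') :
    Wp W searchCmd Q t σ := by
  refine Wp.frame ?_
  obtain ⟨r, hr, e1, e, l', e2, e3, e4⟩ := h.root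
  simp only [searchCmd, wp_seq, wp_move, wp_load]
  refine ⟨r, by simp [e1], ?_⟩
  refine Wp.whileSome (ι := ℕ × List ℕ × List ℕ × List ℕ)
    (fun i τ => TreeAt X i.1 τ (τ.reg 60) i.2.2.1 ∧ l = i.2.1 ++ i.2.2.1 ++ i.2.2.2 ∧
      (∀ e ∈ i.2.2.2, x < X e) ∧ (i.2.1 = [] ∨ ∃ e l', i.2.2.1 = e :: l' ∧ X e ≤ x) ∧
      ∃ r, τ.reg 60 = .ptr r ∧ τ.reg 62 = τ.heap r 20)
    (fun i => 7 * i.1) rfl (i := (d, [], l, [])) ?_ ?_ ?_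
  · refine ⟨?_, by simp, by simp, by simp, r, by simp [e1], by simp⟩
    simpa [e1] using h.keeps (σ' := ((σ.set 60 (σ.reg 2)).set 62 (σ.heap r 20)).set 63 .nil)
      ⟨le_rfl, fun _ _ => rfl⟩ ⟨le_rfl, fun _ _ => rfl⟩ ⟨le_rfl, fun _ _ => rfl⟩
  · rintro ⟨d, pre, cur, post⟩ τ hf ⟨h1, h2, h3, h4, r, h5, h6⟩ hr
    simp only at h1 h2 h3 h4
    obtain ⟨r', hr', f1, e, l', f2, f3, f4⟩ := h1.root
    rw [h5, Val.ptr.injEq] at f1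
    subst f1
    rw [h6] at hr
    obtain ⟨h, -⟩ | ⟨d', hd', l₁, l₂, rfl, t1, t2⟩ := f4
    · exact absurd h hr
    have h0 : τ.reg 0 = .real x := by rw [hf.reg 0 rfl]; simpa using hx
    obtain ⟨c₁, hc₁, g1, a₁, l₁', rfl, g2, -⟩ := t1.root
    obtain ⟨c₂, hc₂, g1', a₂, l₂', rfl, g2', -⟩ := t2.root
    refine Wp.abstract fun G hG => ?_
    simp [h5, h6, g1, g1', g2', h0, Test.Holds, Val.Le]
    refine ⟨fun hle => hG _ _ fun hfr => ⟨(d', pre ++ a₁ :: l₁', a₂ :: l₂', post), ⟨?_, ?_, h3, ?_,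
      c₂, by simp, by simp⟩, ?_⟩, fun hle => hG _ _ fun hfr => ⟨(d', pre, a₁ :: l₁',
        a₂ :: l₂' ++ post), ⟨?_, ?_, ?_, ?_, c₁, by simp, by simp⟩, ?_⟩⟩
    · simpa [g1'] using t2.keeps (hfr.keeps 19 rfl) (hfr.keeps 20 rfl) (hfr.keeps 21 rfl)
    · simp [h2]
    · exact Or.inr ⟨a₂, l₂', rfl, hle⟩
    · simp only; omega
    · simpa [g1] using t1.keeps (hfr.keeps 19 rfl) (hfr.keeps 20 rfl) (hfr.keeps 21 rfl)
    · simp [h2]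
    · intro e' he'
      rcases List.mem_append.1 he' with he' | he'
      · rw [h2] at hs
        have h7 := (List.pairwise_append.1 (List.pairwise_append.1
          (List.pairwise_append.1 hs).1).2.1).2.1
        rcases List.mem_cons.1 he' with rfl | he'
        · exact hle
        · exact hle.trans_le ((List.pairwise_cons.1 h7).1 e' he')
      · exact h3 e' he'
    · refine h4.imp id ?_
      rintro ⟨b, l'', hb, hb'⟩
      rw [List.cons_append, List.cons.injEq] at hb
      exact ⟨a₁, l₁', rfl, hb.1 ▸ hb'⟩
    · simp only; omega
  · rintro ⟨d, pre, cur, post⟩ τ u hf ⟨h1, h2, h3, h4, r, h5, h6⟩ hr hu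
    simp only at h1 h2 h3 h4 hu
    obtain ⟨r', hr', f1, e, l', f2, f3, f4⟩ := h1.root
    rw [h5, Val.ptr.injEq] at f1
    subst f1
    rw [h6] at hr
    have h0 : τ.reg 0 = .real x := by rw [hf.reg 0 rfl]; simpa using hx
    have hcur : r = e ∧ l' = [] := by
      obtain ⟨-, h⟩ | ⟨d', hd', l₁, l₂, -, t1, -⟩ := f4
      · exact h
      · obtain ⟨c, -, h, -⟩ := t1.root
        rw [hr] at h; cases h
    obtain ⟨rfl, rfl⟩ := hcur
    subst f2
    refine Wp.abstract fun G hG => ?_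
    simp [h5, f3, h0, Test.Holds, Val.Le]
    refine ⟨fun hle => hG _ _ fun hff => hQ _ _ hff (Or.inr ⟨pre, r, post, by simp [h2],
      by simp [h5], ?_, hle, h3⟩) (by omega), fun hle => hG _ _ fun hff => hQ _ _ hff (Or.inl
      ⟨by simp, ?_⟩) (by omega)⟩
    · intro e' he'
      rw [h2, List.append_assoc] at hs
      exact ((List.pairwise_append.1 hs).2.2 e' he' r (by simp)).trans hle
    -- A final leaf with key above `x` is possible only if nothing was skipped on the left, so no
    -- leaf qualifies.
    · obtain rfl | ⟨b, l'', hb, hb'⟩ := h4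
      · rw [h2]
        intro e' he'
        simp only [List.nil_append, List.cons_append, List.mem_cons] at he'
        rcases he' with rfl | he'
        · exact hle
        · exact h3 e' he'
      · rw [List.cons.injEq] at hb
        exact absurd hb' (by rw [← hb.1]; exact not_le.2 hle)

/-! ### The list of the widths of the levels -/

/-- `v` is the head of a list that contains, for each `j < i` in decreasing order, `2 ^ j` and a
flag that says whether `h` divides `j`. -/
def Widths (h : ℕ) (σ : State) : ℕ → Val → Prop
  | 0, v => v = .nil
  | i + 1, v => ∃ c < σ.next, v = .ptr c ∧ σ.heap c 4 = .int (2 ^ i) ∧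
      (σ.heap c 6 = .nil ↔ i % h ≠ 0) ∧ Widths h σ i (σ.heap c 5)

theorem Widths.keeps {h : ℕ} {σ σ' : State} {i : ℕ} {v : Val} (hw : Widths h σ i v)
    (h4 : Keeps 4 σ σ') (h5 : Keeps 5 σ σ') (h6 : Keeps 6 σ σ') : Widths h σ' i v := by
  induction i generalizing v with
  | zero => exact hw
  | succ i ih =>
    obtain ⟨c, hc, h1, h2, h3, h7⟩ := hw
    refine ⟨c, hc.trans_le h4.1, h1, by rw [h4.2 c hc, h2], by rw [h6.2 c hc, h3], ?_⟩
    rw [h5.2 c hc]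
    exact ih h7

/-- Build the list of widths up to the number of points in register `3`, for the parameter in
register `1`. -/
def widthCmd : Cmd :=
  .clear 21 ;; .const 22 1 ;; .const 23 1 ;; .const 4 1 ;; .while (.le 22 3)
    (.new 24 ;; .store 24 4 22 ;; .store 24 5 21 ;; .ite (.eq 23 4) (.store 24 6 4) .skip ;;
      .move 21 24 ;; .add 22 22 22 ;; .add 23 23 23 ;; .add 24 23 23 ;;
      .ite (.le 24 1) .skip (.const 23 1))

/-- The machine can neither multiply nor divide, and `h` is never computed. One register doubles to
`2 ^ i`; another holds `2 ^ (i % h)`, which is `1` exactly on the levels divisible by `h`. -/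
theorem wp_widthCmd {n s : ℕ} {Q : ℕ → State → Prop} {t : ℕ} {σ : State} (hs : 2 ≤ s) (hsn : s ≤ n)
    (hW : 2 * n ≤ W) (h1 : σ.reg 1 = .int s) (h3 : σ.reg 3 = .int n)
    (hQ : ∀ u σ', Frame widthCmd σ σ' →
      Widths (Nat.log 2 s) σ' (Nat.log 2 n + 1) (σ'.reg 21) →
      u ≤ t + 13 * Nat.log 2 n + 20 → Q u σ') :
    Wp W widthCmd Q t σ := by
  refine Wp.frame ?_
  simp only [widthCmd, wp_seq, wp_clear, wp_const]
  have hh : 0 < Nat.log 2 s := Nat.log_pos one_lt_two hs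
  have h2s : 2 ^ Nat.log 2 s ≤ s := Nat.pow_log_le_self 2 (by omega)
  have h2s' : s < 2 ^ (Nat.log 2 s + 1) := Nat.lt_pow_succ_log_self one_lt_two s
  set h := Nat.log 2 s
  refine ⟨by omega, by omega, by omega, ?_⟩
  refine Wp.while (ι := ℕ)
    (fun i τ => i ≤ Nat.log 2 n + 1 ∧ Widths h τ i (τ.reg 21) ∧ τ.reg 22 = .int (2 ^ i) ∧
      τ.reg 23 = .int (2 ^ (i % h)))
    (fun i => 13 * (Nat.log 2 n + 1 - i)) (i := 0) ?_ ?_ ?_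
  · rintro i τ hf ⟨h5, h6, h7, h8⟩ hb
    have e3 : τ.reg 3 = .int n := by rw [hf.reg 3 rfl]; simpa using h3
    have e1 : τ.reg 1 = .int s := by rw [hf.reg 1 rfl]; simpa using h1
    have e4 : τ.reg 4 = .int 1 := by rw [hf.reg 4 rfl]; simp
    simp only [Test.Holds, h7, e3, Val.Le] at hb
    have hi : i ≤ Nat.log 2 n := Nat.le_log_of_pow_le one_lt_two hb
    have hih : i % h < h := Nat.mod_lt _ hh
    have hg : 2 ^ (i % h) * 2 ≤ s := by
      rw [← pow_succ]
      exact (Nat.pow_le_pow_right (by norm_num) hih).trans h2s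
    have hw : ∀ τ' : State, Keeps 4 τ τ' → Keeps 5 τ τ' → Keeps 6 τ τ' →
        τ'.reg 21 = .ptr τ.next → τ.next < τ'.next →
        τ'.heap τ.next 4 = .int (2 ^ i) → τ'.heap τ.next 5 = τ.reg 21 →
        (τ'.heap τ.next 6 = .nil ↔ i % h ≠ 0) → Widths h τ' (i + 1) (τ'.reg 21) :=
      fun τ' k4 k5 k6 a1 a2 a3 a4 a5 => ⟨τ.next, a2, a1, a3, a5, by
        rw [a4]; exact h6.keeps k4 k5 k6⟩
    have hmod : (i + 1) % h = if i % h + 1 = h then 0 else i % h + 1 := by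
      rw [← Nat.mod_add_mod]
      split_ifs with hc
      · simp [hc]
      · exact Nat.mod_eq_of_lt (by omega)
    -- Since `h` is the logarithm of `s` rounded down, two doublings exceed `s` exactly when the
    -- next exponent reaches `h` and has to be reset to `0`.
    have hcmp : 2 ^ (i % h) + 2 ^ (i % h) + (2 ^ (i % h) + 2 ^ (i % h)) ≤ s ↔ i % h + 1 ≠ h := by
      have e : 2 ^ (i % h) + 2 ^ (i % h) + (2 ^ (i % h) + 2 ^ (i % h)) = 2 ^ (i % h + 2) := by ring
      rw [e]
      constructor
      · intro hc hc'
        have : i % h + 2 = h + 1 := by omega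
        rw [this] at hc
        omega
      · intro hc
        exact (Nat.pow_le_pow_right (by norm_num) (by omega : i % h + 2 ≤ h)).trans h2s
    refine Wp.abstract fun G hG => ?_
    simp [h7, h8, e1, e4, Test.Holds, Val.Le]
    have w1 : 2 ^ i + 2 ^ i ≤ W := by omega
    have w2 : 2 ^ (i % h) + 2 ^ (i % h) + (2 ^ (i % h) + 2 ^ (i % h)) ≤ W := by omega
    have fin : ∀ (u : ℕ) (τ' : State), u ≤ 12 → Widths h τ' (i + 1) (τ'.reg 21) →
        τ'.reg 22 = .int (2 ^ i + 2 ^ i) → τ'.reg 23 = .int (2 ^ ((i + 1) % h)) → G u τ' :=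
      fun u τ' h1 h2 h3 h4 => hG _ _ fun _ => ⟨i + 1, ⟨by omega, h2, by rw [h3, ← two_mul, ← pow_succ'],
        h4⟩, by omega⟩
    have hg1 : i % h + 1 ≠ h → Val.int (2 ^ (i % h) + 2 ^ (i % h)) = .int (2 ^ ((i + 1) % h)) := by
      intro hc
      rw [hmod, if_neg hc, ← two_mul, ← pow_succ']
    have hg2 : i % h + 1 = h → Val.int 1 = .int (2 ^ ((i + 1) % h)) := by
      intro hc
      rw [hmod, if_pos hc, pow_zero]
    have hk : ∀ f, ∀ x y z : Val, Keeps f τ ((((τ.alloc 24).write τ.next 4 x).write τ.next 5 y).write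
        τ.next 6 z) ∧ Keeps f τ (((τ.alloc 24).write τ.next 4 x).write τ.next 5 y) :=
      fun f x y z => ⟨⟨Nat.le_succ _, fun a ha => by simp [ha.ne]⟩,
        ⟨Nat.le_succ _, fun a ha => by simp [ha.ne]⟩⟩
    refine ⟨fun hf => ⟨w1, by omega, w2, fun hc => fin _ _ (by omega) (hw _ (hk _ _ _ _).1
      (hk _ _ _ _).1 (hk _ _ _ _).1 ?_ ?_ ?_ ?_ ?_) ?_ ?_, fun hc => ⟨by omega, fin _ _ (by omega)
      (hw _ (hk _ _ _ _).1 (hk _ _ _ _).1 (hk _ _ _ _).1 ?_ ?_ ?_ ?_ ?_) ?_ ?_⟩⟩, fun hf =>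
      ⟨w1, by omega, w2, fun hc => fin _ _ (by omega) (hw _ (hk _ _ _ .nil).2
      (hk _ _ _ .nil).2 (hk _ _ _ .nil).2 ?_ ?_ ?_ ?_ ?_) ?_ ?_, fun hc => ⟨by omega, fin _ _ (by omega)
      (hw _ (hk _ _ _ .nil).2 (hk _ _ _ .nil).2 (hk _ _ _ .nil).2 ?_ ?_ ?_ ?_ ?_) ?_ ?_⟩⟩⟩
    all_goals first
      | simp [hf]; done
      | simpa using hg1 (hcmp.1 hc)
      | simpa using hg2 (not_not.1 fun h' => absurd (hcmp.2 h') (by omega))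
  · simp [Widths, Nat.mod_eq_of_lt hh]
  · rintro i τ u hf ⟨h5, h6, h7, h8⟩ hb hu hff
    have e3 : τ.reg 3 = .int n := by rw [hf.reg 3 rfl]; simpa using h3
    simp only [Test.Holds, h7, e3, Val.Le, not_le] at hb
    have hi : i = Nat.log 2 n + 1 :=
      le_antisymm h5 ((Nat.log_lt_iff_lt_pow one_lt_two (by omega)).2 hb)
    subst hi
    exact hQ _ _ hff h6 (by omega)

/-! ### Weighted lists of colour nodes -/

/-- `v` is the head of a linked list of colour nodes with weights. -/
def Chain (σ : State) : Val → List (ℕ × ℕ) → Prop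
  | v, [] => v = .nil
  | v, e :: l => ∃ c < σ.next, v = .ptr c ∧ σ.heap c 4 = .ptr e.1 ∧ σ.heap c 6 = .int e.2 ∧
      Chain σ (σ.heap c 5) l

theorem Chain.keeps {σ σ' : State} {v : Val} {l : List (ℕ × ℕ)} (h : Chain σ v l)
    (h4 : Keeps 4 σ σ') (h5 : Keeps 5 σ σ') (h6 : Keeps 6 σ σ') : Chain σ' v l := by
  induction l generalizing v with
  | nil => exact h
  | cons e l ih =>
    obtain ⟨c, hc, h1, h2, h3, h7⟩ := h
    refine ⟨c, hc.trans_le h4.1, h1, by rw [h4.2 c hc, h2], by rw [h6.2 c hc, h3], ?_⟩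
    rw [h5.2 c hc]
    exact ih h7

@[simp] theorem chain_set {σ : State} {r : ℕ} {w v : Val} {l : List (ℕ × ℕ)} :
    Chain (σ.set r w) v l ↔ Chain σ v l :=
  ⟨fun h => h.keeps ⟨le_rfl, fun _ _ => rfl⟩ ⟨le_rfl, fun _ _ => rfl⟩ ⟨le_rfl, fun _ _ => rfl⟩,
    fun h => h.keeps ⟨le_rfl, fun _ _ => rfl⟩ ⟨le_rfl, fun _ _ => rfl⟩ ⟨le_rfl, fun _ _ => rfl⟩⟩

theorem Chain.exists_cons {σ : State} {v : Val} {l : List (ℕ × ℕ)} (h : Chain σ v l)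
    (hv : v ≠ .nil) : ∃ c a w l', c < σ.next ∧ l = (a, w) :: l' ∧ v = .ptr c ∧
      σ.heap c 4 = .ptr a ∧ σ.heap c 6 = .int w ∧ Chain σ (σ.heap c 5) l' := by
  cases l with
  | nil => exact absurd h hv
  | cons e l => obtain ⟨c, h⟩ := h; exact ⟨c, e.1, e.2, l, h.1, rfl, h.2⟩

theorem Chain.eq_nil {σ : State} {l : List (ℕ × ℕ)} (h : Chain σ .nil l) : l = [] := by
  cases l with
  | nil => rfl
  | cons x l => obtain ⟨c, -, h, -⟩ := h; cases h

/-- The total weight of `a` in a list. -/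
def total : List (ℕ × ℕ) → ℕ → ℕ
  | [], _ => 0
  | e :: l, a => (if e.1 = a then e.2 else 0) + total l a

theorem total_append (l₁ l₂ : List (ℕ × ℕ)) (a : ℕ) :
    total (l₁ ++ l₂) a = total l₁ a + total l₂ a := by
  induction l₁ with
  | nil => simp [total]
  | cons e l ih => simp [total, ih, add_assoc]

theorem total_eq_zero {l : List (ℕ × ℕ)} {a : ℕ} (h : a ∉ l.map Prod.fst) : total l a = 0 := by
  induction l with
  | nil => rfl
  | cons e l ih =>
    simp only [List.map_cons, List.mem_cons, not_or] at h
    simp [total, ih h.2, Ne.symm h.1]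

/-- `v` is the head of a list of colour nodes, linked by field `2`. -/
def OutLst (σ : State) : Val → List ℕ → Prop
  | v, [] => v = .nil
  | v, a :: l => v = .ptr a ∧ OutLst σ (σ.heap a 2) l

theorem OutLst.congr {σ σ' : State} {v : Val} {l : List ℕ} (h : OutLst σ v l)
    (h2 : ∀ a ∈ l, σ'.heap a 2 = σ.heap a 2) : OutLst σ' v l := by
  induction l generalizing v with
  | nil => exact h
  | cons a l ih =>
    refine ⟨h.1, ?_⟩
    rw [h2 a (by simp)]
    exact ih h.2 fun b hb => h2 b (by simp [hb])

@[simp] theorem outLst_set {σ : State} {r : ℕ} {w v : Val} {l : List ℕ} :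
    OutLst (σ.set r w) v l ↔ OutLst σ v l :=
  ⟨fun h => h.congr fun _ _ => rfl, fun h => h.congr fun _ _ => rfl⟩

/-- The colour nodes `S` contain the total weights of the list `pre`: register `71` is the head of
the list of the nodes that occur in `pre`, field `1` contains the weight, and field `18` is `nil`
iff the node does not occur. -/
structure Acc (S : ℕ → Prop) (σ : State) (pre : List (ℕ × ℕ)) (ks : List ℕ) : Prop where
  nodup : ks.Nodup
  mem : ∀ a, a ∈ ks ↔ a ∈ pre.map Prod.fst
  out : OutLst σ (σ.reg 71) ks
  count : ∀ a ∈ ks, σ.heap a 1 = .int (total pre a)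
  flag : ∀ a, S a → (σ.heap a 18 = .nil ↔ a ∉ ks)
  sub : ∀ a ∈ ks, S a

/-- Add the list in register `70` to the weights in the colour nodes. -/
def accCmd : Cmd :=
  whileSome 75 70 (.load 72 70 4 ;; .load 73 70 6 ;; .load 70 70 5 ;; .load 74 72 18 ;;
    .ite (.isNil 74) (.store 72 18 72 ;; .store 72 1 73 ;; .store 72 2 71 ;; .move 71 72)
      (.load 74 72 1 ;; .add 74 74 73 ;; .store 72 1 74))

/-- `pre` is a ghost: the concatenation of all lists added so far. A colour node is marked by a
pointer to itself, and on its first visit it joins the list of touched nodes. -/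
theorem wp_accCmd {S : ℕ → Prop} {Q : ℕ → State → Prop} {t : ℕ} {σ : State}
    {pre ch : List (ℕ × ℕ)} {ks : List ℕ} (h : Acc S σ pre ks) (hc : Chain σ (σ.reg 70) ch)
    (hS : ∀ e ∈ ch, S e.1) (hW : ∀ a, total (pre ++ ch) a ≤ W)
    (hQ : ∀ u σ' ks', Frame accCmd σ σ' → Acc S σ' (pre ++ ch) ks' →
      u ≤ t + 11 * ch.length + 5 → Q u σ') : Wp W accCmd Q t σ := by
  refine Wp.frame (Wp.whileSome (ι := List (ℕ × ℕ) × List (ℕ × ℕ) × List ℕ)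
    (fun i τ => Acc S τ i.1 i.2.2 ∧ Chain τ (τ.reg 70) i.2.1 ∧ i.1 ++ i.2.1 = pre ++ ch ∧
      ∀ e ∈ i.2.1, S e.1)
    (fun i => 11 * i.2.1.length) rfl (i := (pre, ch, ks)) ?_ ?_ ?_)
  · refine ⟨⟨h.nodup, h.mem, ?_, h.count, h.flag, h.sub⟩, by simpa using hc, rfl, hS⟩
    simpa using h.out
  · rintro ⟨pre', ch', ks⟩ τ hf ⟨h1, h2, h3, h4⟩ hr
    obtain ⟨c, a, w, l, hc, rfl, hv, hx, hw, hl⟩ := h2.exists_cons hr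
    simp only at h1 h3 h4
    have hSa : S a := h4 (a, w) (by simp)
    have htot : ∀ b, total (pre' ++ [(a, w)]) b = total pre' b + if a = b then w else 0 := by
      intro b; simp [total_append, total]
    have hle : total pre' a + w ≤ W := by
      have := hW a
      rw [← h3, total_append] at this
      simp [total] at this
      omega
    refine Wp.abstract fun G hG => ?_
    simp [hv, hx, hw, Test.Holds]
    refine ⟨fun hn => hG _ _ fun hfr => ?_, fun hn => ?_⟩
    · have ha : a ∉ ks := (h1.flag a hSa).1 hn
      have hne : ∀ b ∈ ks, b ≠ a := fun b hb e => ha (e ▸ hb)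
      refine ⟨(pre' ++ [(a, w)], l, a :: ks), ⟨⟨?_, ?_, ?_, ?_, ?_, ?_⟩, ?_, ?_, ?_⟩, ?_⟩
      · exact List.nodup_cons.2 ⟨ha, h1.nodup⟩
      · intro b
        simp only [List.mem_cons, h1.mem, List.map_append, List.map_cons, List.map_nil,
          List.mem_append, List.not_mem_nil, or_false]
        tauto
      · refine ⟨by simp, ?_⟩
        simpa using OutLst.congr h1.out fun b hb => by simp [hne b hb]
      · intro b hb
        rw [htot]
        rcases List.mem_cons.1 hb with rfl | hb
        · rw [h1.mem] at ha
          simp [total_eq_zero ha]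
        · simpa [hne b hb, Ne.symm (hne b hb)] using h1.count b hb
      · intro b hb
        by_cases hba : b = a
        · subst hba; simp
        · simpa [hba] using h1.flag b hb
      · intro b hb
        rcases List.mem_cons.1 hb with rfl | hb
        · exact hSa
        · exact h1.sub b hb
      · simpa using hl.keeps (hfr.keeps 4 rfl) (hfr.keeps 5 rfl) (hfr.keeps 6 rfl)
      · simp [h3]
      · exact fun e he => h4 e (by simp [he])
      · simp only [List.length_cons]; omega
    · have ha : a ∈ ks := by
        by_contra ha
        exact hn ((h1.flag a hSa).2 ha)
      refine ⟨total pre' a, h1.count a ha, hle, hG _ _ fun hfr => ⟨(pre' ++ [(a, w)], l, ks),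
        ⟨⟨h1.nodup, ?_, ?_, ?_, ?_, h1.sub⟩, ?_, ?_, ?_⟩, ?_⟩⟩
      · intro b
        simp only [h1.mem, List.map_append, List.map_cons, List.map_nil,
          List.mem_append, List.mem_cons, List.not_mem_nil, or_false]
        refine ⟨Or.inl, ?_⟩
        rintro (h | rfl)
        · exact h
        · exact (h1.mem b).1 ha
      · simpa using h1.out.congr fun _ _ => by simp
      · intro b hb
        rw [htot]
        by_cases hba : b = a
        · subst hba; simp
        · simpa [hba, Ne.symm hba] using h1.count b hb
      · intro b hb
        simpa using h1.flag b hb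
      · simpa using hl.keeps (hfr.keeps 4 rfl) (hfr.keeps 5 rfl) (hfr.keeps 6 rfl)
      · simp [h3]
      · exact fun e he => h4 e (by simp [he])
      · simp only [List.length_cons]; omega
  · rintro ⟨pre', ch', ks⟩ τ u hf ⟨h1, h2, h3, h4⟩ hr hu hff
    rw [hr] at h2
    obtain rfl := h2.eq_nil
    simp only [List.append_nil] at h1 h3 hu
    rw [h3] at h1
    exact hQ _ _ ks hff ⟨h1.nodup, h1.mem, by simpa using h1.out, h1.count,
      h1.flag, h1.sub⟩ hu

/-- Clear the flags of the colour nodes in the list in register `71`. -/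
def resetCmd : Cmd :=
  .move 76 71 ;; .clear 77 ;; whileSome 78 76 (.store 76 18 77 ;; .load 76 76 2)

/-- Only touched nodes carry a mark, so following their list clears all marks in time independent of
the total number of colours. -/
theorem wp_resetCmd {S : ℕ → Prop} {Q : ℕ → State → Prop} {t : ℕ} {σ : State}
    {pre : List (ℕ × ℕ)} {ks : List ℕ} (h : Acc S σ pre ks)
    (hQ : ∀ u σ', Frame resetCmd σ σ' → (∀ a, S a → σ'.heap a 18 = .nil) →
      u ≤ t + 4 * ks.length + 7 → Q u σ') : Wp W resetCmd Q t σ := by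
  refine Wp.frame ?_
  simp only [resetCmd, wp_seq, wp_move, wp_clear]
  refine Wp.whileSome (ι := List ℕ)
    (fun i τ => OutLst τ (τ.reg 76) i ∧ ∀ a, S a → τ.heap a 18 ≠ .nil → a ∈ i)
    (fun i => 4 * i.length) rfl (i := ks) ?_ ?_ ?_
  · refine ⟨by simpa using h.out, fun a ha hn => ?_⟩
    by_contra hc
    exact hn ((h.flag a ha).2 hc)
  · rintro i τ hf ⟨h1, h2⟩ hr
    cases i with
    | nil => exact absurd h1 hr
    | cons a i =>
      have h77 : τ.reg 77 = .nil := by rw [hf.reg 77 rfl]; simp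
      refine Wp.abstract fun G hG => ?_
      simp [h1.1, h77]
      refine hG _ _ fun hfr => ⟨i, ⟨?_, ?_⟩, ?_⟩
      · simpa using OutLst.congr h1.2 fun _ _ => by simp
      · intro b hb hn
        have hne : b ≠ a := by rintro rfl; simp at hn
        simp only [State.set_heap, State.write_heap, hne, false_and, if_false] at hn
        exact (List.mem_cons.1 (h2 b hb hn)).resolve_left hne
      · simp only [List.length_cons]; omega
  · rintro i τ u hf ⟨h1, h2⟩ hr hu hff
    cases i with
    | cons a i => rw [hr] at h1; cases h1.1
    | nil =>
      refine hQ _ _ hff (fun a ha => ?_) (by omega)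
      by_contra hn
      exact absurd (h2 a ha hn) (by simp)

/-- Copy the list in register `71` of colour nodes with their weights to register `70`. -/
def copyCmd : Cmd :=
  .move 76 71 ;; .clear 70 ;; whileSome 78 76 (.load 74 76 1 ;; .new 79 ;; .store 79 4 76 ;;
    .store 79 6 74 ;; .store 79 5 70 ;; .move 70 79 ;; .load 76 76 2)

theorem wp_copyCmd {Q : ℕ → State → Prop} {t : ℕ} {σ : State} {ks : List ℕ} {w : ℕ → ℕ}
    (h : OutLst σ (σ.reg 71) ks) (hks : ∀ a ∈ ks, a < σ.next ∧ σ.heap a 1 = .int (w a))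
    (hQ : ∀ u σ', Frame copyCmd σ σ' →
      Chain σ' (σ'.reg 70) (ks.map fun a => (a, w a)).reverse →
      u ≤ t + 9 * ks.length + 7 → Q u σ') : Wp W copyCmd Q t σ := by
  refine Wp.frame ?_
  simp only [copyCmd, wp_seq, wp_move, wp_clear]
  refine Wp.whileSome (ι := List ℕ × List (ℕ × ℕ))
    (fun i τ => OutLst τ (τ.reg 76) i.1 ∧ Chain τ (τ.reg 70) i.2 ∧
      (∀ a ∈ i.1, a < τ.next ∧ τ.heap a 1 = .int (w a)) ∧
      (i.1.map fun a => (a, w a)).reverse ++ i.2 = (ks.map fun a => (a, w a)).reverse)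
    (fun i => 9 * i.1.length) rfl (i := (ks, [])) ?_ ?_ ?_
  · refine ⟨by simpa using h, by simp [Chain], by simpa using hks, by simp⟩
  · rintro ⟨l, ch⟩ τ hf ⟨h1, h2, h3, h4⟩ hr
    cases l with
    | nil => exact absurd h1 hr
    | cons a l =>
      simp only at h2 h3 h4
      obtain ⟨ha, hw⟩ := h3 a (by simp)
      have hne : ∀ b ∈ l, b ≠ τ.next := fun b hb => (h3 b (by simp [hb])).1.ne
      refine Wp.abstract fun G hG => ?_
      simp [h1.1, hw, ha.ne]
      refine hG _ _ fun hfr => ⟨(l, (a, w a) :: ch), ⟨?_, ?_, ?_, ?_⟩, ?_⟩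
      · simpa using OutLst.congr h1.2 fun b hb => by simp [hne b hb]
      · refine ⟨τ.next, by simp, by simp, by simp, by simp, ?_⟩
        simpa using h2.keeps (hfr.keeps 4 rfl) (hfr.keeps 5 rfl) (hfr.keeps 6 rfl)
      · intro b hb
        have := h3 b (by simp [hb])
        simpa [hne b hb, this.1.le] using this.2
      · simpa using h4
      · simp only [List.length_cons]; omega
  · rintro ⟨l, ch⟩ τ u hf ⟨h1, h2, h3, h4⟩ hr hu hff
    cases l with
    | cons a i => rw [hr] at h1; cases h1.1
    | nil =>
      refine hQ _ _ hff ?_ (by simp only at hu; omega)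
      simp only [List.map_nil, List.reverse_nil, List.nil_append] at h4
      rw [← h4]
      simpa using h2

/-- Replace the list in register `70` by one that contains each colour node at most once. -/
def compactCmd : Cmd := .clear 71 ;; accCmd ;; resetCmd ;; copyCmd

/-- Equal colours are collected in the colour nodes, and the result is copied to fresh cells. The
cells of the old list are untouched, so chains already stored in elements stay valid. -/
theorem wp_compactCmd {S : ℕ → Prop} {Q : ℕ → State → Prop} {t : ℕ} {σ : State}
    {ch : List (ℕ × ℕ)} (hc : Chain σ (σ.reg 70) ch) (hS : ∀ e ∈ ch, S e.1)
    (hS' : ∀ a, S a → a < σ.next ∧ σ.heap a 18 = .nil) (hW : ∀ a, total ch a ≤ W)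
    (hQ : ∀ u σ' ch', Frame compactCmd σ σ' → Chain σ' (σ'.reg 70) ch' →
      (∀ a, total ch' a = total ch a) → (∀ a, a ∈ ch'.map Prod.fst ↔ a ∈ ch.map Prod.fst) →
      (ch'.map Prod.fst).Nodup → (∀ a, S a → σ'.heap a 18 = .nil) →
      u ≤ t + 24 * ch.length + 20 → Q u σ') : Wp W compactCmd Q t σ := by
  refine Wp.frame ?_
  simp only [compactCmd, wp_seq, wp_clear]
  refine wp_accCmd (S := S) (pre := []) (ks := []) (ch := ch)
    ⟨.nil, by simp, by simp [OutLst], by simp, fun a ha => by simp [(hS' a ha).2], by simp⟩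
    (by simpa using hc) hS (by simpa using hW) fun u₁ σ₁ ks hf₁ hacc hu₁ => ?_
  rw [List.nil_append] at hacc
  rw [wp_seq]
  refine wp_resetCmd hacc fun u₂ σ₂ hf₂ h18 hu₂ => ?_
  have hlt : ∀ a ∈ ks, a < σ₁.next := fun a ha =>
    (hS' a (hacc.sub a ha)).1.trans_le hf₁.next
  refine wp_copyCmd (ks := ks) (w := total ch) ?_ ?_ fun u₃ σ₃ hf₃ h70 hu₃ hff => ?_
  · rw [hf₂.reg 71 rfl]
    exact hacc.out.congr fun a ha => hf₂.heap 2 rfl a (hlt a ha)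
  · exact fun a ha => ⟨(hlt a ha).trans_le hf₂.next, by
      rw [hf₂.heap 1 rfl a (hlt a ha), hacc.count a ha]⟩
  · have hmap : ((ks.map fun a => (a, total ch a)).reverse.map Prod.fst) = ks.reverse := by
      rw [List.map_reverse, List.map_map]; simp [Function.comp_def]
    -- The touched nodes are distinct and all occur in the chain. This bounds resetting and copying
    -- by the length of the input.
    have hlen : ks.length ≤ ch.length := by
      have : ks ⊆ ch.map Prod.fst := fun a ha => (hacc.mem a).1 ha
      simpa using (List.subperm_of_subset hacc.nodup this).length_le
    refine hQ _ _ _ hff h70 (fun a => ?_) (fun a => ?_) ?_ (fun a ha => ?_) (by omega)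
    · have key : ∀ l : List ℕ, l.Nodup → total (l.map fun a => (a, total ch a)) a =
          if a ∈ l then total ch a else 0 := by
        intro l hl
        induction l with
        | nil => rfl
        | cons b l ih =>
          rw [List.nodup_cons] at hl
          simp only [List.map_cons, total, ih hl.2, List.mem_cons]
          by_cases hab : b = a
          · subst hab; simp [hl.1]
          · simp [hab, Ne.symm hab]
      rw [← List.map_reverse, key _ (by simpa using hacc.nodup)]
      split_ifs with ha
      · rfl
      · rw [List.mem_reverse, hacc.mem] at ha
        exact (total_eq_zero ha).symm
    · rw [hmap, List.mem_reverse, hacc.mem]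
    · rw [hmap]; simpa using hacc.nodup
    · have := (hS' a ha).1.trans_le (hf₁.next.trans hf₂.next)
      rw [hf₃.heap 18 rfl a this, h18 a ha]

/-! ### Chains: persistent colour lists for the prefixes of a list of points -/

/-- The weights in `ch` are the colour frequencies of the list `X` of points, and `ch` is not much
longer than the number of colours. -/
structure ChainOf (cn : ℕ → ℕ) (ch : List (ℕ × ℕ)) (X : List ℕ) : Prop where
  total : ∀ a, total ch a = X.countP fun p => cn p = a
  keys : ∀ a ∈ ch.map Prod.fst, a ∈ X.map cn
  length : ch.length ≤ 2 * (X.map cn).toFinset.card + 1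

/-- Register `80` contains the chain `ch` for `X`; register `81` contains a list whose length is
the number of additions until the next compaction. -/
structure Chaining (cn : ℕ → ℕ) (σ : State) (X : List ℕ) (ch ck : List (ℕ × ℕ)) : Prop where
  chain : Chain σ (σ.reg 80) ch
  clock : Chain σ (σ.reg 81) ck
  total : ∀ a, total ch a = X.countP fun p => cn p = a
  keys : ∀ a ∈ ch.map Prod.fst, a ∈ X.map cn
  length : ch.length + ck.length ≤ 2 * (X.map cn).toFinset.card + 1
  le : ck.length ≤ ch.length

theorem Chaining.chainOf {cn : ℕ → ℕ} {σ : State} {X : List ℕ} {ch ck : List (ℕ × ℕ)}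
    (h : Chaining cn σ X ch ck) : ChainOf cn ch X :=
  ⟨h.total, h.keys, (Nat.le_add_right _ _).trans h.length⟩

theorem Chaining.keeps {cn : ℕ → ℕ} {σ σ' : State} {X : List ℕ} {ch ck : List (ℕ × ℕ)}
    (h : Chaining cn σ X ch ck) (h4 : Keeps 4 σ σ') (h5 : Keeps 5 σ σ') (h6 : Keeps 6 σ σ')
    (h80 : σ'.reg 80 = σ.reg 80) (h81 : σ'.reg 81 = σ.reg 81) : Chaining cn σ' X ch ck :=
  ⟨by rw [h80]; exact h.chain.keeps h4 h5 h6, by rw [h81]; exact h.clock.keeps h4 h5 h6,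
    h.total, h.keys, h.length, h.le⟩

/-- Add the colour node in register `82` to the chain. -/
def chainCmd : Cmd :=
  .ite (.isNil 81) (.move 70 80 ;; compactCmd ;; .move 80 70 ;; .move 81 70) (.load 81 81 5) ;;
    .const 83 1 ;; .new 84 ;; .store 84 4 82 ;; .store 84 6 83 ;; .store 84 5 80 ;; .move 80 84

/-- Entries are prepended, so chains of earlier prefixes survive as tails. Without compaction the
chain grows by one while the clock shrinks by one, which leaves the sum of the lengths fixed. The
potential `40 * (ch.length - ck.length)` then grows by at most `80`; when the clock is empty, it
pays for a compaction, which is linear in the chain. -/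
theorem wp_chainCmd {cn : ℕ → ℕ} {n : ℕ} {Q : ℕ → State → Prop} {t : ℕ} {σ : State} {X : List ℕ}
    {ch ck : List (ℕ × ℕ)} {p : ℕ} (h : Chaining cn σ X ch ck) (hp : σ.reg 82 = .ptr (cn p))
    (hX : ∀ q ∈ X, q < n) (hXW : X.length ≤ W) (hW : 1 ≤ W)
    (hcn : ∀ q < n, cn q < σ.next ∧ σ.heap (cn q) 18 = .nil)
    (hQ : ∀ u σ' ch' ck', Frame chainCmd σ σ' → Chaining cn σ' (p :: X) ch' ck' →
      (∀ q < n, σ'.heap (cn q) 18 = .nil) →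
      u + 40 * (ch'.length - ck'.length) ≤ t + 130 + 40 * (ch.length - ck.length) → Q u σ') :
    Wp W chainCmd Q t σ := by
  refine Wp.frame ?_
  have htot : ∀ a (l : List (ℕ × ℕ)), ColourFrequency.total l a = X.countP (fun q => cn q = a) →
      ColourFrequency.total ((cn p, 1) :: l) a = (p :: X).countP fun q => cn q = a := by
    intro a l hl
    rw [List.countP_cons, ColourFrequency.total, hl, add_comm]
    simp
  have hcard : (X.map cn).toFinset.card ≤ ((p :: X).map cn).toFinset.card :=
    Finset.card_le_card (by simp)
  -- the end of the program
  have fin : ∀ (u : ℕ) (τ : State) (ch' ck' : List (ℕ × ℕ)), τ.reg 82 = .ptr (cn p) →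
      Chain τ (τ.reg 80) ch' → Chain τ (τ.reg 81) ck' →
      (∀ a, ColourFrequency.total ch' a = X.countP fun p => cn p = a) →
      (∀ a ∈ ch'.map Prod.fst, a ∈ X.map cn) →
      ch'.length + 1 + ck'.length ≤ 2 * (X.map cn).toFinset.card + 1 → ck'.length ≤ ch'.length →
      (∀ q < n, cn q < τ.next ∧ τ.heap (cn q) 18 = .nil) →
      u + 6 + 40 * (ch'.length + 1 - ck'.length) ≤ t + 130 + 40 * (ch.length - ck.length) →
      Wp W (.const 83 1 ;; .new 84 ;; .store 84 4 82 ;; .store 84 6 83 ;; .store 84 5 80 ;;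
        .move 80 84) (fun u σ' => Frame chainCmd σ σ' → Q u σ') u τ := by
    intro u τ ch' ck' a1 a2 a3 a4 a5 a6 a7 a8 a9
    refine Wp.frame ?_
    refine Wp.abstract fun G hG => ?_
    simp [a1]
    refine ⟨hW, hG _ _ fun hfr hff => hQ _ _ ((cn p, 1) :: ch') ck' hff
      ⟨?_, ?_, fun a => htot a ch' (a4 a), ?_, ?_, ?_⟩ ?_ ?_⟩
    · refine ⟨τ.next, by simp, by simp, by simp [a1], by simp, ?_⟩
      simpa using a2.keeps (hfr.keeps 4 rfl) (hfr.keeps 5 rfl) (hfr.keeps 6 rfl)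
    · simpa using a3.keeps (hfr.keeps 4 rfl) (hfr.keeps 5 rfl) (hfr.keeps 6 rfl)
    · intro a ha
      simp only [List.map_cons, List.mem_cons] at ha ⊢
      exact ha.imp id (a5 a)
    · simp only [List.length_cons]; omega
    · simp only [List.length_cons]; omega
    · intro q hq
      simpa [(a8 q hq).1.ne] using (a8 q hq).2
    · simp only [List.length_cons]; omega
  rw [chainCmd, wp_seq, wp_ite]
  have hlen := h.length
  have hle := h.le
  refine ⟨fun hn => ?_, fun hn => ?_⟩
  · simp only [Test.Holds] at hn
    have hck : ck = [] := (hn ▸ h.clock).eq_nil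
    subst hck
    simp only [wp_seq, wp_move]
    refine wp_compactCmd (S := fun a => ∃ q < n, cn q = a) (ch := ch) (by simpa using h.chain) ?_ ?_
      ?_ fun u σ₁ ch' hf₁ b1 b2 b3 b4 b5 b6 => ?_
    · intro e he
      obtain ⟨q, hq, hq'⟩ := List.mem_map.1 (h.keys e.1 (List.mem_map_of_mem he))
      exact ⟨q, hX q hq, hq'⟩
    · rintro a ⟨q, hq, rfl⟩
      exact hcn q hq
    · intro a
      rw [h.total]
      exact List.countP_le_length.trans hXW
    -- Without repeated nodes, the compacted chain has at most one entry per colour of the prefix.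
    · have hcl : ch'.length ≤ (X.map cn).toFinset.card := by
        rw [← List.length_map (f := Prod.fst), ← List.toFinset_card_of_nodup b4]
        refine Finset.card_le_card fun a ha => ?_
        rw [List.mem_toFinset] at ha ⊢
        exact h.keys a ((b3 a).1 ha)
      have hcl' : ch'.length ≤ ch.length := by
        have : ch'.map Prod.fst ⊆ ch.map Prod.fst := fun a ha => (b3 a).1 ha
        simpa using (List.subperm_of_subset b4 this).length_le
      rw [wp_seq, wp_move, wp_move]
      -- The compacted chain also becomes the clock, so the next compaction is due after as many
      -- additions as it has entries. The entry added now accounts for the `+ 1` in the length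
      -- bound.
      refine fin _ _ ch' ch' ?_ (by simpa using b1) (by simpa using b1)
        (fun a => (b2 a).trans (h.total a)) (fun a ha => h.keys a ((b3 a).1 ha)) (by omega) le_rfl
        (fun q hq => ⟨(hcn q hq).1.trans_le hf₁.next, b5 _ ⟨q, hq, rfl⟩⟩) ?_
      · simpa [hf₁.reg 82 rfl] using hp
      · simp only [List.length_nil] at *
        omega
  · simp only [Test.Holds] at hn
    obtain ⟨c, a, w, ck', hc, rfl, hv, hx, hw, hl⟩ := h.clock.exists_cons hn
    rw [wp_load]
    refine ⟨c, hv, fin _ _ ch ck' (by simpa using hp) (by simpa using h.chain) (by simpa using hl)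
      h.total h.keys ?_ ?_ hcn ?_⟩
    · simp only [List.length_cons] at hlen; omega
    · simp only [List.length_cons] at hle; omega
    · simp only [List.length_cons] at hle ⊢; omega

/-! ### Descending one level -/

/-- The value that leads to the first element of a list. -/
def headVal : List (ℕ × ℕ) → Val
  | [] => .nil
  | e :: _ => .ptr e.1

/-- The fields of the points are set up: `y` contains the `y`-coordinates, `rk` the ranks, and `cn`
the colour nodes. -/
structure Points (n : ℕ) (y : ℕ → ℝ) (rk cn : ℕ → ℕ) (σ : State) : Prop where
  lt : ∀ p < n, p < σ.next
  y : ∀ p < n, σ.heap p 8 = .real (y p)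
  colour : ∀ p < n, σ.heap p 10 = .ptr (cn p)
  rank : ∀ p < n, σ.heap p 11 = .int (rk p)
  node : ∀ p < n, cn p < σ.next

theorem Points.keeps {n : ℕ} {y : ℕ → ℝ} {rk cn : ℕ → ℕ} {σ σ' : State} (h : Points n y rk cn σ)
    (h8 : Keeps 8 σ σ') (h10 : Keeps 10 σ σ') (h11 : Keeps 11 σ σ') : Points n y rk cn σ' :=
  ⟨fun p hp => (h.lt p hp).trans_le h8.1, fun p hp => by rw [h8.2 p (h.lt p hp), h.y p hp],
    fun p hp => by rw [h10.2 p (h.lt p hp), h.colour p hp],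
    fun p hp => by rw [h11.2 p (h.lt p hp), h.rank p hp],
    fun p hp => (h.node p hp).trans_le h8.1⟩

/-- Given a list of elements in register `95`, with points in ascending `x`-order, make a list of
new elements for the points with ranks from the number in register `91` to below the number in
register `92`, in register `41`. Let field `fE` of each old element contain a pointer to the last
new element up to it, field `fC` a chain for the points up to it with lower ranks, and field `17`
the value of register `93`. -/
def descendCmd (fE fC : ℕ) : Cmd :=
  .move 85 95 ;; .clear 86 ;; .clear 87 ;; .clear 80 ;; .clear 81 ;; whileSome 94 85
    (.load 88 85 4 ;; .load 85 85 5 ;; .load 89 88 12 ;; .load 90 89 11 ;;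
      .ite (.le 92 90) .skip (.ite (.le 91 90) (.new 87 ;; .store 87 12 89 ;; push 96 87 86)
        (.load 82 89 10 ;; chainCmd)) ;;
      .store 88 fE 87 ;; .store 88 fC 80 ;; .store 88 17 93) ;;
  .move 40 86 ;; .clear 41 ;; rev

/-- What `descendCmd` stores in the element `e`, whose prefix of points is `X`, when `R'` is the
list of the new elements. -/
def Linked (cn rk : ℕ → ℕ) (fE fC b c : ℕ) (σ : State) (R' : List (ℕ × ℕ)) (e : ℕ) (X : List ℕ) :
    Prop :=
  (∃ t', t' <:+ R' ∧ σ.heap e fE = headVal t' ∧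
    t'.map Prod.snd = X.filter fun p => b ≤ rk p ∧ rk p < c) ∧
  ∃ ch, Chain σ (σ.heap e fC) ch ∧ ChainOf cn ch (X.filter fun p => rk p < b)

theorem NewElem.keeps {σ σ' : State} {e p : ℕ} (h : NewElem σ e p)
    (hk : ∀ f ∈ [12, 13, 14, 15, 16, 17], Keeps f σ σ') : NewElem σ' e p :=
  ⟨h.lt.trans_le (hk 12 (by simp)).1, by rw [(hk 12 (by simp)).2 e h.lt, h.point],
    fun f hf => by rw [(hk f (by simp at hf ⊢; tauto)).2 e h.lt, h.links f hf]⟩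

theorem Linked.keeps {cn rk : ℕ → ℕ} {fE fC b c : ℕ} {σ σ' : State} {R R' : List (ℕ × ℕ)} {e : ℕ}
    {X : List ℕ} (h : Linked cn rk fE fC b c σ R e X) (hE : σ'.heap e fE = σ.heap e fE)
    (hC : σ'.heap e fC = σ.heap e fC) (h4 : Keeps 4 σ σ') (h5 : Keeps 5 σ σ') (h6 : Keeps 6 σ σ')
    (hR : R <:+ R') : Linked cn rk fE fC b c σ' R' e X := by
  obtain ⟨⟨t', h1, h2, h3⟩, ch, h7, h8⟩ := h
  refine ⟨⟨t', h1.trans hR, by rw [hE, h2], h3⟩, ch, ?_, h8⟩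
  rw [hC]
  exact h7.keeps h4 h5 h6

/-- The loop invariant of `descendCmd`: the elements `l` are still to be processed, the elements
`done` have been processed, and the results have been stored in the elements `lk`. -/
structure DescendInv (n : ℕ) (cn rk : ℕ → ℕ) (fE fC b c : ℕ) (R : List (ℕ × ℕ)) (σ τ : State)
    (l done lk R' : List (ℕ × ℕ)) (ch ck : List (ℕ × ℕ)) : Prop where
  rest : Lst τ (τ.reg 85) (l.map fun e => .ptr e.1)
  eq : l.reverse ++ done = R
  acc : Lst τ (τ.reg 86) (R'.map fun e => .ptr e.1)
  last : τ.reg 87 = headVal R'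
  points : R'.map Prod.snd = (done.map Prod.snd).filter fun p => b ≤ rk p ∧ rk p < c
  elems : ∀ e ∈ R', σ.next ≤ e.1 ∧ NewElem τ e.1 e.2
  nodup : (R'.map Prod.fst).Nodup
  chain : Chaining cn τ ((done.map Prod.snd).filter fun p => rk p < b) ch ck
  linked : ∀ e t, e :: t <:+ lk →
    Linked cn rk fE fC b c τ R' e.1 ((e :: t).map Prod.snd) ∧ τ.heap e.1 17 = σ.reg 93
  frame : ∀ a < σ.next, a ∉ R.map Prod.fst → ∀ f ∈ [13, 14, 15, 16, 17], τ.heap a f = σ.heap a f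
  flags : ∀ p < n, τ.heap (cn p) 18 = .nil

/-- One scan in ascending `x`-order maintains a list of new elements and a chain, both growing at
the head. Storing the current heads in an old element takes a snapshot of the state for its prefix,
and later additions do not disturb it. -/
theorem wp_descendCmd {n : ℕ} {y : ℕ → ℝ} {cn rk : ℕ → ℕ} {fE fC b c : ℕ} {R : List (ℕ × ℕ)}
    {Q : ℕ → State → Prop} {t : ℕ} {σ : State}
    (hfld : (fE = 13 ∧ fC = 15) ∨ (fE = 14 ∧ fC = 16))
    (hl : Lst σ (σ.reg 95) (R.reverse.map fun e => .ptr e.1))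
    (hR : ∀ e ∈ R, e.1 < σ.next ∧ σ.heap e.1 12 = .ptr e.2 ∧ e.2 < n)
    (hnd : (R.map Prod.fst).Nodup) (hp : Points n y rk cn σ)
    (hfl : ∀ p < n, σ.heap (cn p) 18 = .nil)
    (hb : σ.reg 91 = .int b) (hc : σ.reg 92 = .int c) (hbc : b ≤ c) (hW : R.length ≤ W) (hW1 : 1 ≤ W)
    (hQ : ∀ u σ' R', Frame (descendCmd fE fC) σ σ' →
      Lst σ' (σ'.reg 41) (R'.reverse.map fun e => .ptr e.1) →
      R'.map Prod.snd = (R.map Prod.snd).filter (fun p => b ≤ rk p ∧ rk p < c) →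
      (∀ e ∈ R', σ.next ≤ e.1 ∧ NewElem σ' e.1 e.2) → (R'.map Prod.fst).Nodup →
      (∀ e t, e :: t <:+ R → Linked cn rk fE fC b c σ' R' e.1 ((e :: t).map Prod.snd) ∧
        σ'.heap e.1 17 = σ.reg 93) →
      (∀ a < σ.next, a ∉ R.map Prod.fst → ∀ f ∈ [13, 14, 15, 16, 17],
        σ'.heap a f = σ.heap a f) →
      (∀ p < n, σ'.heap (cn p) 18 = .nil) → u ≤ t + 170 * R.length + 40 → Q u σ') :
    Wp W (descendCmd fE fC) Q t σ := by
  refine Wp.frame ?_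
  simp only [descendCmd, wp_seq, wp_move, wp_clear]
  refine Wp.whileSome
    (ι := List (ℕ × ℕ) × List (ℕ × ℕ) × List (ℕ × ℕ) × List (ℕ × ℕ) × List (ℕ × ℕ))
    (fun i τ => DescendInv n cn rk fE fC b c R σ τ i.1 i.2.1 i.2.1 i.2.2.1 i.2.2.2.1 i.2.2.2.2)
    -- The second summand is the potential of the chain from `wp_chainCmd`.
    (fun i => 160 * i.1.length + 40 * (i.2.2.2.1.length - i.2.2.2.2.length)) rfl
    (i := (R.reverse, [], [], [], [])) ?_ ?_ ?_
  · refine ⟨by simpa using hl, by simp, by simp [Lst], by simp [headVal], by simp, by simp,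
      by simp, ⟨by simp [Chain], by simp [Chain], by simp [total], by simp, by simp, by simp⟩,
      by simp, by simp, by simpa using hfl⟩
  · rintro ⟨l, done, R', ch, ck⟩ τ hf hI hr
    simp only at hI
    have hdn : ∀ e ∈ done, e ∈ R := fun e he => by rw [← hI.eq]; simp [he]
    obtain ⟨⟨e, p⟩, l, rfl⟩ : ∃ e l', l = e :: l' := by
      cases l with
      | nil => exact absurd hI.rest hr
      | cons e l => exact ⟨e, l, rfl⟩
    obtain ⟨a, v, l', ha, hcons, hv, hx, hl'⟩ := Lst.exists_cons hI.rest hr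
    simp only [List.map_cons, List.cons.injEq] at hcons
    obtain ⟨rfl, rfl⟩ := hcons
    have hmem : (e, p) ∈ R := by rw [← hI.eq]; simp
    obtain ⟨heσ, he12, hpn⟩ := hR (e, p) hmem
    simp only at heσ he12 hpn
    have hnR : ∀ e' ∈ R, e'.1 = e → e' = (e, p) := fun e' he' h =>
      List.inj_on_of_nodup_map hnd he' hmem h
    have hnd' : (e, p) ∉ done := by
      have h1 : R.Nodup := hnd.of_map
      rw [← hI.eq] at h1
      exact fun h2 => List.disjoint_of_nodup_append h1 (by simp) h2
    -- Elements do not repeat, so the stores into `e` leave the snapshots in processed elements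
    -- intact.
    have hedone : ∀ e' ∈ done, e'.1 ≠ e := fun e' he' h => hnd' (hnR e' (hdn e' he') h ▸ he')
    have hlen : done.length + l.length + 1 = R.length := by
      rw [← hI.eq]; simp; omega
    have hpτ : Points n y rk cn τ := hp.keeps (hf.keeps 8 (by
      rcases hfld with ⟨rfl, rfl⟩ | ⟨rfl, rfl⟩ <;> rfl)) (hf.keeps 10 (by
      rcases hfld with ⟨rfl, rfl⟩ | ⟨rfl, rfl⟩ <;> rfl)) (hf.keeps 11 (by
      rcases hfld with ⟨rfl, rfl⟩ | ⟨rfl, rfl⟩ <;> rfl))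
    have he12' : τ.heap e 12 = .ptr p := by
      rw [(hf.keeps 12 (by rcases hfld with ⟨rfl, rfl⟩ | ⟨rfl, rfl⟩ <;> rfl)).2 e (by simpa), ← he12]
      simp
    have hτn : σ.next ≤ τ.next := by simpa using hf.next
    have hreg : ∀ r ∈ [91, 92, 93], τ.reg r = σ.reg r := by
      intro r hr
      rw [hf.reg r (by simp at hr; rcases hr with rfl | rfl | rfl <;> rfl)]
      simp at hr ⊢
      rcases hr with rfl | rfl | rfl <;> rfl
    -- The three stores are common to the three cases: a rank too high (the point is dropped), a
    -- rank in the range (a new element), a rank too low (an entry of the chain).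
    have mid : ∀ (u : ℕ) (τ' : State) (R'' ch' ck' : List (ℕ × ℕ)),
        (∀ f ∈ [4, 5, 6, 12, 13, 14, 15, 16, 17], Keeps f τ τ') → τ'.reg 88 = .ptr e →
        τ'.reg 85 = τ.heap a 5 → τ'.reg 93 = σ.reg 93 → R' <:+ R'' →
        Lst τ' (τ'.reg 86) (R''.map fun e => .ptr e.1) → τ'.reg 87 = headVal R'' →
        R''.map Prod.snd =
          (((e, p) :: done).map Prod.snd).filter (fun p => b ≤ rk p ∧ rk p < c) →
        (∀ e ∈ R'', σ.next ≤ e.1 ∧ NewElem τ' e.1 e.2) → (R''.map Prod.fst).Nodup →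
        Chaining cn τ' ((((e, p) :: done).map Prod.snd).filter fun p => rk p < b) ch' ck' →
        (∀ p < n, τ'.heap (cn p) 18 = .nil) →
        u + 5 + 40 * (ch'.length - ck'.length) ≤ 160 + 40 * (ch.length - ck.length) →
        Wp W (.store 88 fE 87 ;; .store 88 fC 80 ;; .store 88 17 93) (fun u τ' => ∃ j :
          List (ℕ × ℕ) × List (ℕ × ℕ) × List (ℕ × ℕ) × List (ℕ × ℕ) × List (ℕ × ℕ),
          DescendInv n cn rk fE fC b c R σ τ' j.1 j.2.1 j.2.1 j.2.2.1 j.2.2.2.1 j.2.2.2.2 ∧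
          u + 2 + (160 * j.1.length + 40 * (j.2.2.2.1.length - j.2.2.2.2.length)) ≤
            160 * ((e, p) :: l).length + 40 * (ch.length - ck.length)) u τ' := by
      intro u τ' R'' ch' ck' b1 b2 b3 b4 b5 b6 b7 b8 b9 b10 b11 b12 b13
      refine Wp.frame ?_
      refine Wp.abstract fun G hG => ?_
      simp [b2]
      refine hG _ _ fun hfr => ⟨(l, (e, p) :: done, R'', ch', ck'), ⟨?_, ?_, ?_, ?_, b8, ?_, b10,
        ?_, ?_, ?_, ?_⟩, ?_⟩
      -- The stores affect only fields from `13` to `17` of `e`; all invariants about other nodes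
      -- and fields transfer by the facts `s1` to `s7`.
      all_goals
        try simp only
        generalize hτ₂ : ((τ'.write e fE (τ'.reg 87)).write e fC (τ'.reg 80)).write e 17
          (τ'.reg 93) = τ₂ at hfr ⊢
        have s1 : τ₂.next = τ'.next := by rw [← hτ₂]; rfl
        have s2 : τ₂.reg = τ'.reg := by rw [← hτ₂]; rfl
        have s3 : ∀ x f, x ≠ e ∨ f < 13 ∨ 17 < f → τ₂.heap x f = τ'.heap x f := by
          intro x f hx
          simp only [← hτ₂, State.write_heap]
          rw [if_neg, if_neg, if_neg] <;> omega
        have s4 : ∀ f, f < 13 → Keeps f τ' τ₂ := fun f hf => ⟨s1.ge, fun x _ => s3 x f (by omega)⟩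
        have s5 : ∀ f ∈ [4, 5, 6], Keeps f τ τ₂ := fun f hf =>
          (b1 f (by simp at hf ⊢; omega)).trans (s4 f (by simp at hf; omega))
        have s6 : ∀ x < τ.next, ∀ f ∈ [13, 14, 15, 16, 17], x ≠ e → τ₂.heap x f = τ.heap x f :=
          fun x hx f hf hxe => by rw [s3 x f (.inl hxe), (b1 f (by simp at hf ⊢; omega)).2 x hx]
        have s7 : ∀ x f, σ.next ≤ x → τ₂.heap x f = τ'.heap x f := fun x f hx => s3 x f (by omega)
      · rw [s2, b3]
        exact hl'.keeps (s5 4 (by simp)) (s5 5 (by simp))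
      · rw [← hI.eq]; simp
      · rw [s2]
        exact b6.keeps (s4 4 (by simp)) (s4 5 (by simp))
      · rw [s2, b7]
      · intro e' he'
        obtain ⟨h1, h2⟩ := b9 e' he'
        exact ⟨h1, by rw [s1]; exact h2.lt, by rw [s7 _ _ h1]; exact h2.point,
          fun f hf => by rw [s7 _ _ h1]; exact h2.links f hf⟩
      · exact b11.keeps (s4 4 (by simp)) (s4 5 (by simp)) (s4 6 (by simp)) (by rw [s2]) (by rw [s2])
      · intro e' t' ht'
        rcases List.suffix_cons_iff.1 ht' with h | h
        · obtain ⟨rfl, rfl⟩ := List.cons.inj h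
          have s8 : τ₂.heap e fE = τ'.reg 87 ∧ τ₂.heap e fC = τ'.reg 80 ∧
              τ₂.heap e 17 = τ'.reg 93 := by
            rcases hfld with ⟨rfl, rfl⟩ | ⟨rfl, rfl⟩ <;> simp [← hτ₂]
          refine ⟨⟨⟨R'', List.suffix_rfl, by rw [s8.1, b7], b8⟩, ch', ?_, b11.chainOf⟩,
            by rw [s8.2.2, b4]⟩
          rw [s8.2.1]
          exact b11.chain.keeps (s4 4 (by simp)) (s4 5 (by simp)) (s4 6 (by simp))
        · obtain ⟨h1, h2⟩ := hI.linked e' t' h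
          have h3 : e' ∈ done := h.subset (by simp)
          have h4 := hedone e' h3
          have h5 : e'.1 < τ.next := (hR e' (hdn e' h3)).1.trans_le hτn
          refine ⟨h1.keeps (s6 _ h5 _ ?_ h4) (s6 _ h5 _ ?_ h4) (s5 4 (by simp)) (s5 5 (by simp))
            (s5 6 (by simp)) b5, by rw [s6 _ h5 _ (by simp) h4, h2]⟩
          · simp; omega
          · simp; omega
      · intro x hx hxR f hf
        have hxe : x ≠ e := fun h => hxR (List.mem_map.2 ⟨_, hmem, h.symm⟩)
        rw [s6 x (hx.trans_le hτn) f hf hxe, hI.frame x hx hxR f hf]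
      · intro q hq
        rw [s3 _ _ (by simp), b12 q hq]
      · simp only [List.length_cons]; omega
    refine Wp.abstract fun G hG => ?_
    simp only [wp_seq, wp_load, hv, Val.ptr.injEq, exists_eq_left', State.set_reg, hx,
      State.set_heap, he12', hpτ.rank p hpn, reduceIte, Nat.reduceEqDiff]
    have hG' : ∀ u τ', (∃ j :
          List (ℕ × ℕ) × List (ℕ × ℕ) × List (ℕ × ℕ) × List (ℕ × ℕ) × List (ℕ × ℕ),
          DescendInv n cn rk fE fC b c R σ τ' j.1 j.2.1 j.2.1 j.2.2.1 j.2.2.2.1 j.2.2.2.2 ∧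
          u + 2 + (160 * j.1.length + 40 * (j.2.2.2.1.length - j.2.2.2.2.length)) ≤
            160 * ((e, p) :: l).length + 40 * (ch.length - ck.length)) → G u τ' :=
      fun u τ' h => hG u τ' fun _ => h
    have hk : ∀ f ∈ [4, 5, 6, 12, 13, 14, 15, 16, 17], Keeps f τ ((((τ.set 88 (Val.ptr e)).set 85
        (τ.heap a 5)).set 89 (Val.ptr p)).set 90 (Val.int (rk p))) :=
      fun f _ => ⟨le_rfl, fun _ _ => rfl⟩
    generalize hτ₁ : (((τ.set 88 (Val.ptr e)).set 85 (τ.heap a 5)).set 89 (Val.ptr p)).set 90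
      (Val.int (rk p)) = τ₁ at hk ⊢
    have hheap : τ₁.heap = τ.heap := by rw [← hτ₁]; rfl
    have hnext : τ₁.next = τ.next := by rw [← hτ₁]; rfl
    have r85 : τ₁.reg 85 = τ.heap a 5 := by simp [← hτ₁]
    have r88 : τ₁.reg 88 = .ptr e := by simp [← hτ₁]
    have r89 : τ₁.reg 89 = .ptr p := by simp [← hτ₁]
    have r90 : τ₁.reg 90 = .int (rk p) := by simp [← hτ₁]
    have hro : ∀ r, r < 85 ∨ r = 86 ∨ r = 87 ∨ r > 90 → τ₁.reg r = τ.reg r := by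
      intro r hr
      simp only [← hτ₁, State.set_reg]
      rw [if_neg, if_neg, if_neg, if_neg] <;> omega
    have hch : Chaining cn τ₁ ((done.map Prod.snd).filter fun p => rk p < b) ch ck :=
      hI.chain.keeps (hk 4 (by simp)) (hk 5 (by simp)) (hk 6 (by simp)) (hro _ (by simp))
        (hro _ (by simp))
    have hpts := hI.points
    have hle1 : (Test.le 92 90).Holds τ₁ ↔ c ≤ rk p := by
      simp [Test.Holds, r90, hro 92, hreg 92, hc, Val.Le]
    have hle2 : (Test.le 91 90).Holds τ₁ ↔ b ≤ rk p := by
      simp [Test.Holds, r90, hro 91, hreg 91, hb, Val.Le]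
    rw [wp_ite, hle1]
    have trans : ∀ {cmd : Cmd} {τ'}, Frame cmd τ₁ τ' →
        (∀ f ∈ [4, 5, 6, 12, 13, 14, 15, 16, 17], cmd.keepsFld f none = true) →
        ∀ f ∈ [4, 5, 6, 12, 13, 14, 15, 16, 17], Keeps f τ τ' :=
      fun hfr hc f hf => (hk f hf).trans (hfr.keeps f (hc f hf))
    refine ⟨fun hcr => ?_, fun hcr => ?_⟩
    · rw [wp_skip]
      refine (mid _ _ R' ch ck hk r88 r85 (by rw [hro _ (by simp), hreg 93 (by simp)])
        List.suffix_rfl ?_ ?_ ?_ ?_ hI.nodup ?_ ?_ ?_).mono fun u τ' _ h => hG' u τ' h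
      · rw [hro 86 (by simp)]
        exact hI.acc.keeps (hk 4 (by simp)) (hk 5 (by simp))
      · rw [hro 87 (by simp), hI.last]
      · rw [hpts, List.map_cons, List.filter_cons_of_neg (by simp; omega)]
      · exact fun e he => ⟨(hI.elems e he).1, (hI.elems e he).2.keeps fun f hf => hk f (by
          simp at hf ⊢; omega)⟩
      · rwa [List.map_cons, List.filter_cons_of_neg (by simp; omega)]
      · rw [hheap]; exact hI.flags
      · omega
    · rw [wp_ite, hle2]
      refine ⟨fun hbr => ?_, fun hbr => ?_⟩
      · refine Wp.frame ?_
        refine Wp.abstract fun G₂ hG₂ => ?_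
        simp [r89, hτn.trans]
        refine hG₂ _ _ fun hfr => ?_
        have hk2 := trans hfr (by simp [Cmd.keepsFld, Cmd.newReg, forget])
        refine (mid _ _ ((τ.next, p) :: R') ch ck hk2 (by simpa using r88) (by simpa using r85)
          (by simp [hro, hreg 93]) (List.suffix_cons _ _) ?_ ?_ ?_ ?_ ?_ ?_ ?_ ?_).mono
            fun u τ' _ h => hG' u τ' h
        · have h := hI.acc.keeps (hk 4 (by simp)) (hk 5 (by simp))
          have h' := Lst.push (σ := (τ₁.alloc 87).write τ₁.next 12 (.ptr p)) (t := 96) (x := 87)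
            (l := 86) (vs := R'.map fun e => .ptr e.1)
            (by
              have hk' : ∀ f, f ≠ 12 → Keeps f τ₁ ((τ₁.alloc 87).write τ₁.next 12 (.ptr p)) :=
                fun f hf => ⟨by simp, fun x hx => by simp [hf, hx.ne]⟩
              simpa [hro 86] using h.keeps (hk' 4 (by simp)) (hk' 5 (by simp)))
          simpa [hnext] using h'
        · simp [headVal, hnext]
        · rw [List.map_cons, hpts, List.map_cons, List.filter_cons_of_pos (by simp; omega)]
        · intro e' he'
          rcases List.mem_cons.1 he' with rfl | he'
          · exact ⟨hτn, by simp [hnext], by simp [State.push_heap, hnext, r89],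
              fun f hf => by
                simp at hf
                simp [State.push_heap, hnext, show f ≠ 12 by omega]⟩
          · exact ⟨(hI.elems e' he').1, (hI.elems e' he').2.keeps fun f hf => hk2 f (by
              simp at hf ⊢; omega)⟩
        · refine List.nodup_cons.2 ⟨fun h => ?_, hI.nodup⟩
          obtain ⟨e', he', h⟩ := List.mem_map.1 h
          exact absurd (hI.elems e' he').2.lt (by simp only [h]; omega)
        · rw [List.map_cons, List.filter_cons_of_neg (by simp; omega)]
          exact hch.keeps (hfr.keeps 4 (by simp [Cmd.keepsFld, Cmd.newReg]))
            (hfr.keeps 5 (by simp [Cmd.keepsFld, Cmd.newReg]))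
            (hfr.keeps 6 (by simp [Cmd.keepsFld, Cmd.newReg])) (by simp) (by simp)
        · intro q hq
          rw [hfr.heap 18 (by simp [Cmd.keepsFld, Cmd.newReg]) _
            (hnext ▸ hpτ.node q hq), hheap, hI.flags q hq]
        · omega
      · rw [wp_seq, wp_load]
        refine ⟨p, r89, wp_chainCmd (cn := cn) (n := n) (p := p)
          (X := (done.map Prod.snd).filter fun p => rk p < b) (ch := ch) (ck := ck) ?_ ?_ ?_ ?_
          hW1 ?_ fun u τ' ch' ck' hfr b1 b2 b3 => ?_⟩
        · exact hch.keeps (.set ..) (.set ..) (.set ..) (by simp) (by simp)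
        · simp [hheap, hpτ.colour p hpn]
        · intro q hq
          obtain ⟨e', he', rfl⟩ := List.mem_map.1 (List.mem_of_mem_filter hq)
          exact (hR e' (hdn e' he')).2.2
        · refine (List.length_filter_le _ _).trans ?_
          rw [List.length_map]; omega
        · intro q hq
          simp only [State.set_next, State.set_heap, hnext, hheap]
          exact ⟨hpτ.node q hq, hI.flags q hq⟩
        · have hkeep : ∀ f ∈ [4, 5, 6, 12, 13, 14, 15, 16, 17], chainCmd.keepsFld f none = true := by
            simp; decide
          have hk2 : ∀ f ∈ [4, 5, 6, 12, 13, 14, 15, 16, 17], Keeps f τ τ' := fun f hf =>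
            ((hk f hf).trans (.set f τ₁ _ _)).trans (hfr.keeps f (hkeep f hf))
          have hr2 : ∀ r, chainCmd.keepsReg r = true → r ≠ 82 → τ'.reg r = τ₁.reg r := by
            intro r h1 h2
            rw [hfr.reg r h1]
            simp [h2]
          refine (mid _ _ R' ch' ck' hk2 (by rw [hr2 _ rfl (by simp), r88])
            (by rw [hr2 _ rfl (by simp), r85])
            (by rw [hr2 _ rfl (by simp), hro _ (by simp), hreg 93 (by simp)])
            List.suffix_rfl ?_ ?_ ?_ ?_ hI.nodup ?_ b2 ?_).mono fun u τ' _ h => hG' u τ' h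
          · rw [hr2 _ rfl (by simp), hro _ (by simp)]
            exact hI.acc.keeps (hk2 4 (by simp)) (hk2 5 (by simp))
          · rw [hr2 _ rfl (by simp), hro _ (by simp), hI.last]
          · rw [hpts, List.map_cons, List.filter_cons_of_neg (by simp; omega)]
          · exact fun e he => ⟨(hI.elems e he).1, (hI.elems e he).2.keeps fun f hf => hk2 f (by
              simp at hf ⊢; omega)⟩
          · rwa [List.map_cons, List.filter_cons_of_pos (by simp; omega)]
          · omega
  · rintro ⟨l, done, R', ch, ck⟩ τ u hf hI hr hu
    simp only at hI hu
    have hl0 : l = [] := by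
      have := hI.rest
      rw [hr] at this
      simpa using this.eq_nil
    subst hl0
    have hdone : done = R := by simpa using hI.eq
    subst hdone
    have hfl' : ∀ f ∈ [4, 5, 6, 12, 13, 14, 15, 16, 17, 18], rev.keepsFld f none = true := by
      simp; decide
    simp only [wp_seq, wp_move, wp_clear]
    refine wp_rev (l₁ := R'.map fun e => .ptr e.1) (l₂ := []) (by simpa using hI.acc)
      (by simp [Lst]) fun v σ' hf' h1 h2 hff => ?_
    have hk : ∀ f ∈ [4, 5, 6, 12, 13, 14, 15, 16, 17, 18], Keeps f τ σ' := fun f hf =>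
      hf'.keeps f (hfl' f hf)
    have hτn : σ.next ≤ τ.next := by simpa using hf.next
    refine hQ _ _ R' hff (by simpa using h1) hI.points
      (fun e he => ⟨(hI.elems e he).1, (hI.elems e he).2.keeps fun f hf => hk f (by
        simp at hf ⊢; omega)⟩) hI.nodup (fun e t' ht => ?_) (fun a ha haR f hf => ?_)
      (fun p hpn => ?_) ?_
    · have he := (hR e (ht.subset (by simp))).1.trans_le hτn
      obtain ⟨g1, g2⟩ := hI.linked e t' ht
      refine ⟨g1.keeps ((hk _ ?_).2 _ he) ((hk _ ?_).2 _ he) (hk 4 (by simp)) (hk 5 (by simp))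
        (hk 6 (by simp)) List.suffix_rfl, by rw [(hk 17 (by simp)).2 _ he, g2]⟩
      · simp; omega
      · simp; omega
    · rw [(hk f (by simp at hf ⊢; omega)).2 a (ha.trans_le hτn), hI.frame a ha haR f hf]
    · rw [(hk 18 (by simp)).2 _ ((hp.node p hpn).trans_le hτn), hI.flags p hpn]
    · have hlen : R'.length ≤ done.length := by
        have := congrArg List.length hI.points
        rw [List.length_map] at this
        rw [this, ← List.length_map (as := done) (f := Prod.snd)]
        exact List.length_filter_le _ _
      simp only [List.length_reverse, List.length_map, List.length_nil] at hu h2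
      omega

/-! ### The data structure for one range of ranks -/

/-- The value `v` separates the points with ranks below `m` from the others, except that it is
unspecified on which side the point with rank `m` is. -/
def KeyOK (n : ℕ) (y : ℕ → ℝ) (rk : ℕ → ℕ) (v : Val) (m : ℕ) : Prop :=
  (v = .nil ∧ ∀ p < n, rk p < m) ∨
    ∃ z, v = .real z ∧ ∀ p < n, (rk p ≤ m → y p ≤ z) ∧ (m ≤ rk p → z ≤ y p)

/-- Ranks up to this one are stored in the chains at level `i`, where ranks start from `lo`. -/
def chainRank (h i lo : ℕ) : ℕ := if i % h = 0 then lo else 0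

theorem chainRank_le (h i lo : ℕ) : chainRank h i lo ≤ lo := by
  unfold chainRank; split_ifs <;> omega

/-- The value `v` leads to the structure for the ranks from `lo` to below `lo + 2 ^ i` and the list
`X` of points, which is stored in the elements `F`. -/
def Rep (n : ℕ) (y : ℕ → ℝ) (rk cn : ℕ → ℕ) (h : ℕ) (F : ℕ → Prop) (σ : State) :
    ℕ → ℕ → Val → List ℕ → Prop
  | 0, lo, v, X => (∀ p ∈ X, lo ≤ rk p) ∧ (v = .nil ∨ ∃ e < σ.next, v = .ptr e ∧ F e ∧
      ∀ f ∈ [13, 14, 15, 16, 17], σ.heap e f = .nil)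
  | i + 1, lo, v, X => (v = .nil ∧ X = []) ∨ ∃ e < σ.next, v = .ptr e ∧ F e ∧
      KeyOK n y rk (σ.heap e 17) (lo + 2 ^ i - 1) ∧
      ((∃ ch, Chain σ (σ.heap e 15) ch ∧
        ChainOf cn ch (X.filter fun p => rk p < chainRank h i lo)) ∧
      Rep n y rk cn h F σ i lo (σ.heap e 13)
        (X.filter fun p => chainRank h i lo ≤ rk p ∧ rk p < lo + 2 ^ i)) ∧
      ((∃ ch, Chain σ (σ.heap e 16) ch ∧
        ChainOf cn ch (X.filter fun p => rk p < chainRank h i (lo + 2 ^ i))) ∧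
      Rep n y rk cn h F σ i (lo + 2 ^ i) (σ.heap e 14)
        (X.filter fun p => chainRank h i (lo + 2 ^ i) ≤ rk p ∧ rk p < lo + 2 ^ i + 2 ^ i))

/-- Links are stored into elements that already exist, so the field-wise frame is too coarse for
them. `F` records which elements the structure may use; only their links have to be unchanged. -/
theorem Rep.keeps {n : ℕ} {y : ℕ → ℝ} {rk cn : ℕ → ℕ} {h : ℕ} {F F' : ℕ → Prop} {σ σ' : State}
    {i lo : ℕ} {v : Val} {X : List ℕ} (hr : Rep n y rk cn h F σ i lo v X)
    (h4 : Keeps 4 σ σ') (h5 : Keeps 5 σ σ') (h6 : Keeps 6 σ σ')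
    (hF : ∀ a < σ.next, F a → F' a ∧ ∀ f ∈ [13, 14, 15, 16, 17], σ'.heap a f = σ.heap a f) :
    Rep n y rk cn h F' σ' i lo v X := by
  induction i generalizing lo v X with
  | zero =>
    refine ⟨hr.1, hr.2.imp id ?_⟩
    rintro ⟨e, he, hv, hFe, hl⟩
    refine ⟨e, he.trans_le h4.1, hv, (hF e he hFe).1, fun f hf => ?_⟩
    rw [(hF e he hFe).2 f hf, hl f hf]
  | succ i ih =>
    refine hr.imp id ?_
    rintro ⟨e, he, hv, hFe, hk, ⟨⟨c1, k1, k2⟩, k3⟩, ⟨c2, k4, k5⟩, k6⟩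
    obtain ⟨hF', heq⟩ := hF e he hFe
    refine ⟨e, he.trans_le h4.1, hv, hF', ?_, ⟨⟨c1, ?_, k2⟩, ?_⟩, ⟨c2, ?_, k5⟩, ?_⟩
    · rwa [heq 17 (by simp)]
    · rw [heq 15 (by simp)]; exact k1.keeps h4 h5 h6
    · rw [heq 13 (by simp)]; exact ih k3
    · rw [heq 16 (by simp)]; exact k4.keeps h4 h5 h6
    · rw [heq 14 (by simp)]; exact ih k6

theorem Rep.nil {n : ℕ} {y : ℕ → ℝ} {rk cn : ℕ → ℕ} {h : ℕ} {F : ℕ → Prop} {σ : State}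
    {i lo : ℕ} : Rep n y rk cn h F σ i lo .nil [] := by
  cases i <;> simp [Rep]

/-- The new elements `R` are to be linked to a structure for the ranks from `lo` to below
`lo + 2 ^ i`. -/
structure Item (n : ℕ) (rk : ℕ → ℕ) (h : ℕ) (σ : State) (i lo : ℕ) (R : List (ℕ × ℕ)) : Prop where
  elems : ∀ e ∈ R, NewElem σ e.1 e.2 ∧ e.2 < n
  nodup : (R.map Prod.fst).Nodup
  lt : ∀ e ∈ R, rk e.2 < lo + 2 ^ i
  mem : ∀ p < n, lo ≤ rk p → rk p < lo + 2 ^ i → p ∈ R.map Prod.snd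
  le : i % h = 0 → ∀ e ∈ R, lo ≤ rk e.2

/-- The node `c` of a work list describes the task of linking the elements `R`. -/
structure Work (h : ℕ) (σ : State) (c i lo : ℕ) (R : List (ℕ × ℕ)) (tail : Val) : Prop where
  lt : c < σ.next
  list : Lst σ (σ.heap c 23) (R.reverse.map fun e => .ptr e.1)
  lo : σ.heap c 24 = .int lo
  widths : Widths h σ i (σ.heap c 25)
  tail : σ.heap c 5 = tail

theorem Work.keeps {h : ℕ} {σ σ' : State} {c i lo : ℕ} {R : List (ℕ × ℕ)} {tail : Val}
    (hw : Work h σ c i lo R tail) (hk : ∀ f ∈ [4, 5, 6, 23, 24, 25], Keeps f σ σ') :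
    Work h σ' c i lo R tail := by
  have h4 := hk 4 (by simp)
  have h5 := hk 5 (by simp)
  refine ⟨hw.lt.trans_le h4.1, ?_, ?_, ?_, ?_⟩
  · rw [(hk 23 (by simp)).2 c hw.lt]; exact hw.list.keeps h4 h5
  · rw [(hk 24 (by simp)).2 c hw.lt]; exact hw.lo
  · rw [(hk 25 (by simp)).2 c hw.lt]; exact hw.widths.keeps h4 h5 (hk 6 (by simp))
  · rw [h5.2 c hw.lt]; exact hw.tail

theorem Item.keeps {n : ℕ} {rk : ℕ → ℕ} {h : ℕ} {σ σ' : State} {i lo : ℕ} {R : List (ℕ × ℕ)}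
    (hi : Item n rk h σ i lo R) (h12 : Keeps 12 σ σ')
    (hR : ∀ e ∈ R, ∀ f ∈ [13, 14, 15, 16, 17], σ'.heap e.1 f = σ.heap e.1 f) :
    Item n rk h σ' i lo R :=
  ⟨fun e he => ⟨⟨(hi.elems e he).1.lt.trans_le h12.1, by
    rw [h12.2 _ (hi.elems e he).1.lt, (hi.elems e he).1.point], fun f hf => by
    rw [hR e he f hf, (hi.elems e he).1.links f hf]⟩, (hi.elems e he).2⟩, hi.nodup, hi.lt, hi.mem,
    hi.le⟩

/-- Find the point with the rank in register `107` in the list of elements in register `95`, and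
put its `y`-coordinate in register `93`. -/
def keyCmd : Cmd :=
  .clear 93 ;; .move 111 95 ;; whileSome 112 111 (.load 113 111 4 ;; .load 111 111 5 ;;
    .load 113 113 12 ;; .load 114 113 11 ;; .ite (.eq 114 107) (.load 93 113 8) .skip)

/-- A linear scan is affordable: splitting the list takes linear time anyway. -/
theorem wp_keyCmd {n : ℕ} {y : ℕ → ℝ} {rk cn : ℕ → ℕ} {m : ℕ} {R : List (ℕ × ℕ)}
    {Q : ℕ → State → Prop} {t : ℕ} {σ : State}
    (hl : Lst σ (σ.reg 95) (R.map fun e => .ptr e.1))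
    (hR : ∀ e ∈ R, σ.heap e.1 12 = .ptr e.2 ∧ e.1 < σ.next ∧ e.2 < n) (hp : Points n y rk cn σ)
    (hm : σ.reg 107 = .int m)
    (hQ : ∀ u σ', Frame keyCmd σ σ' →
      ((∃ e ∈ R, rk e.2 = m ∧ σ'.reg 93 = .real (y e.2)) ∨
        (σ'.reg 93 = .nil ∧ ∀ e ∈ R, rk e.2 ≠ m)) →
      u ≤ t + 8 * R.length + 7 → Q u σ') : Wp W keyCmd Q t σ := by
  refine Wp.frame ?_
  simp only [keyCmd, wp_seq, wp_move, wp_clear]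
  refine Wp.whileSome (ι := List (ℕ × ℕ))
    (fun l τ => Lst τ (τ.reg 111) (l.map fun e => .ptr e.1) ∧ l <:+ R ∧
      ((∃ e ∈ R, rk e.2 = m ∧ τ.reg 93 = .real (y e.2)) ∨
        (τ.reg 93 = .nil ∧ ∀ e ∈ R, e ∉ l → rk e.2 ≠ m)))
    (fun l => 8 * l.length) rfl (i := R) ?_ ?_ ?_
  · refine ⟨by simpa using hl, List.suffix_rfl, .inr ⟨by simp, fun e h1 h2 => absurd h1 h2⟩⟩
  · rintro l τ hf ⟨h1, h2, h3⟩ hr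
    obtain ⟨⟨e, p⟩, l, rfl⟩ : ∃ e l', l = e :: l' := by
      cases l with
      | nil => exact absurd h1 hr
      | cons e l => exact ⟨e, l, rfl⟩
    obtain ⟨a, v, l', ha, hcons, hv, hx, hl'⟩ := Lst.exists_cons h1 hr
    simp only [List.map_cons, List.cons.injEq] at hcons
    obtain ⟨rfl, rfl⟩ := hcons
    obtain ⟨he12, he, hpn⟩ := hR (e, p) (h2.subset (by simp))
    simp only at he12 he hpn
    have e12 : τ.heap e 12 = .ptr p := by rw [hf.heap 12 rfl e (by simpa), ← he12]; simp
    have e11 : τ.heap p 11 = .int (rk p) := by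
      rw [hf.heap 11 rfl p (by simpa using hp.lt p hpn), ← hp.rank p hpn]; simp
    have e8 : τ.heap p 8 = .real (y p) := by
      rw [hf.heap 8 rfl p (by simpa using hp.lt p hpn), ← hp.y p hpn]; simp
    have e107 : τ.reg 107 = .int m := by rw [hf.reg 107 rfl, ← hm]; simp
    have hs : l <:+ R := (List.suffix_cons _ _).trans h2
    refine Wp.abstract fun G hG => ?_
    simp [hv, hx, e12, e11, e8, e107, Test.Holds]
    refine ⟨fun hm' => hG _ _ fun hfr => ⟨l, ⟨by simpa using hl', hs, .inl ⟨(e, p),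
      h2.subset (by simp), hm', by simp⟩⟩, ?_⟩, fun hm' => hG _ _ fun hfr => ⟨l,
        ⟨by simpa using hl', hs, ?_⟩, ?_⟩⟩
    · simp only [List.length_cons]; omega
    · refine h3.imp (fun h => by simpa using h) fun h => ⟨by simpa using h.1, fun e' he' hne => ?_⟩
      by_cases hc : e' = (e, p)
      · rw [hc]; exact hm'
      · exact h.2 e' he' (by simp [hc, hne])
    · simp only [List.length_cons]; omega
  · rintro l τ u hf ⟨h1, h2, h3⟩ hr hu hff
    rw [hr] at h1
    have hl0 : l = [] := by simpa using h1.eq_nil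
    subst hl0
    refine hQ _ _ hff (h3.imp (fun h => by simpa using h) fun h => ⟨by simpa using h.1,
      fun e he => h.2 e he (by simp)⟩) (by omega)

/-- Make the new elements for one of two children, and put the task of linking them on the work
list in register `97`. -/
def sideCmd (fE fC : ℕ) : Cmd :=
  .ite (.isNil 102) (.const 91 0) (.move 91 110) ;; descendCmd fE fC ;; .new 108 ;;
    .store 108 23 41 ;; .store 108 24 110 ;; .store 108 25 103 ;; .store 108 5 97 ;; .move 97 108

/-- The flag of the level chooses the lower end of the kept ranks. The end `lo` sends lower ranks to
the chain, and the end `0` carries them along with an empty chain. Every point with a rank in the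
range stays in the list, so the key search on the next level can find it. -/
theorem wp_sideCmd {n : ℕ} {y : ℕ → ℝ} {cn rk : ℕ → ℕ} {fE fC h i lo : ℕ} {R : List (ℕ × ℕ)}
    {Q : ℕ → State → Prop} {t : ℕ} {σ : State}
    (hfld : (fE = 13 ∧ fC = 15) ∨ (fE = 14 ∧ fC = 16))
    (hl : Lst σ (σ.reg 95) (R.reverse.map fun e => .ptr e.1))
    (hR : ∀ e ∈ R, e.1 < σ.next ∧ σ.heap e.1 12 = .ptr e.2 ∧ e.2 < n)
    (hnd : (R.map Prod.fst).Nodup) (hp : Points n y rk cn σ)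
    (hfl : ∀ p < n, σ.heap (cn p) 18 = .nil)
    (h110 : σ.reg 110 = .int lo) (h92 : σ.reg 92 = .int (lo + 2 ^ i))
    (h102 : σ.reg 102 = .nil ↔ i % h ≠ 0) (h103 : Widths h σ i (σ.reg 103))
    (hmem : ∀ p < n, lo ≤ rk p → rk p < lo + 2 ^ i → p ∈ R.map Prod.snd)
    (hW : R.length ≤ W) (hW1 : 1 ≤ W)
    (hQ : ∀ u σ' R' c, Frame (sideCmd fE fC) σ σ' → σ'.reg 97 = .ptr c → σ.next ≤ c →
      Work h σ' c i lo R' (σ.reg 97) → Item n rk h σ' i lo R' →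
      R'.map Prod.snd =
        (R.map Prod.snd).filter (fun p => chainRank h i lo ≤ rk p ∧ rk p < lo + 2 ^ i) →
      (∀ e ∈ R', σ.next ≤ e.1) →
      (∀ e t, e :: t <:+ R →
        Linked cn rk fE fC (chainRank h i lo) (lo + 2 ^ i) σ' R' e.1 ((e :: t).map Prod.snd) ∧
          σ'.heap e.1 17 = σ.reg 93) →
      (∀ a < σ.next, a ∉ R.map Prod.fst → ∀ f ∈ [13, 14, 15, 16, 17],
        σ'.heap a f = σ.heap a f) →
      (∀ p < n, σ'.heap (cn p) 18 = .nil) → u ≤ t + 170 * R.length + 50 → Q u σ') :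
    Wp W (sideCmd fE fC) Q t σ := by
  refine Wp.frame ?_
  have hkf : ∀ f ∈ [4, 5, 6, 12], (descendCmd fE fC).keepsFld f none = true := by
    rcases hfld with ⟨rfl, rfl⟩ | ⟨rfl, rfl⟩ <;> (simp; decide)
  rw [sideCmd, wp_seq]
  have main : ∀ u τ, τ.heap = σ.heap → τ.next = σ.next →
      (∀ r, r ≠ 91 → τ.reg r = σ.reg r) → τ.reg 91 = .int (chainRank h i lo) → u ≤ t + 2 →
      Wp W (descendCmd fE fC ;; .new 108 ;; .store 108 23 41 ;; .store 108 24 110 ;;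
        .store 108 25 103 ;; .store 108 5 97 ;; .move 97 108)
        (fun u σ' => Frame (sideCmd fE fC) σ σ' → Q u σ') u τ := by
    intro u τ a1 a2 a3 a4 a5
    have hk0 : ∀ f, Keeps f σ τ := fun f => ⟨a2.ge, fun _ _ => by rw [a1]⟩
    rw [wp_seq]
    refine wp_descendCmd (n := n) (y := y) (cn := cn) (rk := rk) (b := chainRank h i lo)
      (c := lo + 2 ^ i) (R := R) hfld ?_ ?_ hnd (hp.keeps (hk0 8) (hk0 10) (hk0 11)) ?_ a4 ?_ ?_ hW
      hW1 fun v σ₁ R' hfr b1 b2 b3 b4 b5 b6 b7 b8 => ?_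
    · rw [a3 95 (by simp)]; exact hl.keeps (hk0 4) (hk0 5)
    · simpa only [a1, a2] using hR
    · simpa only [a1] using hfl
    · rw [a3 92 (by simp), h92]
    · exact (chainRank_le h i lo).trans (Nat.le_add_right _ _)
    · refine Wp.frame ?_
      refine Wp.abstract fun G hG => ?_
      have r97 : σ₁.reg 97 = σ.reg 97 := by
        rw [hfr.reg 97 (by rcases hfld with ⟨rfl, rfl⟩ | ⟨rfl, rfl⟩ <;> rfl), a3 97 (by simp)]
      have r110 : σ₁.reg 110 = .int lo := by
        rw [hfr.reg 110 (by rcases hfld with ⟨rfl, rfl⟩ | ⟨rfl, rfl⟩ <;> rfl), a3 110 (by simp),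
          h110]
      have r103 : σ₁.reg 103 = σ.reg 103 := by
        rw [hfr.reg 103 (by rcases hfld with ⟨rfl, rfl⟩ | ⟨rfl, rfl⟩ <;> rfl), a3 103 (by simp)]
      have hn1 : σ.next ≤ σ₁.next := a2 ▸ hfr.next
      simp [r97, r110, r103]
      refine hG _ _ fun hfr2 hff => ?_
      generalize hτ : State.set _ 97 _ = τ₂ at hfr2 hff ⊢
      have hk2 : ∀ f, Keeps f σ₁ τ₂ := fun f => ⟨by simp [← hτ], fun x hx => by
        simp [← hτ, hx.ne]⟩
      have hh : ∀ f, τ₂.heap σ₁.next f = if f = 5 then σ.reg 97 else if f = 25 then σ.reg 103 else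
          if f = 24 then .int lo else if f = 23 then σ₁.reg 41 else .nil := by
        intro f; simp [← hτ]
      have hk1 : ∀ f ∈ [4, 5, 6, 12], Keeps f σ σ₁ := fun f hf =>
        (hk0 f).trans (hfr.keeps f (hkf f hf))
      refine hQ _ _ R' σ₁.next hff (by simp [← hτ]) hn1 ⟨?_, ?_, ?_, ?_, ?_⟩
        ⟨fun e he => ⟨?_, ?_⟩, b4, fun e he => ?_, fun p hpn h1 h2 => ?_, fun hi e he => ?_⟩ b2
        (fun e he => a2 ▸ (b3 e he).1) (fun e t' ht => ?_) (fun a ha haR f hf => ?_)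
        (fun p hpn => ?_) ?_
      · simp [← hτ]
      · rw [hh]; simpa using b1.keeps (hk2 4) (hk2 5)
      · rw [hh]; simp
      · rw [hh]
        simpa using h103.keeps ((hk1 4 (by simp)).trans (hk2 4)) ((hk1 5 (by simp)).trans (hk2 5))
          ((hk1 6 (by simp)).trans (hk2 6))
      · rw [hh]; simp
      · exact (b3 e he).2.keeps fun f _ => hk2 f
      · have : e.2 ∈ R'.map Prod.snd := List.mem_map_of_mem he
        rw [b2] at this
        obtain ⟨e', he', h'⟩ := List.mem_map.1 (List.mem_of_mem_filter this)
        rw [← h']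
        exact (hR e' he').2.2
      · have : e.2 ∈ R'.map Prod.snd := List.mem_map_of_mem he
        rw [b2, List.mem_filter] at this
        simpa using (of_decide_eq_true this.2).2
      · rw [b2, List.mem_filter]
        exact ⟨hmem p hpn h1 h2, by simpa using ⟨(chainRank_le h i lo).trans h1, h2⟩⟩
      · have : e.2 ∈ R'.map Prod.snd := List.mem_map_of_mem he
        rw [b2, List.mem_filter] at this
        simpa [chainRank, hi] using (of_decide_eq_true this.2).1
      · obtain ⟨h1, h2⟩ := b5 e t' ht
        have he : e.1 < σ₁.next := (hR e (ht.subset (by simp))).1.trans_le hn1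
        exact ⟨h1.keeps ((hk2 _).2 _ he) ((hk2 _).2 _ he) (hk2 4) (hk2 5) (hk2 6) List.suffix_rfl,
          by rw [(hk2 17).2 _ he, h2, a3 93 (by simp)]⟩
      · rw [(hk2 f).2 a (ha.trans_le hn1), b6 a (a2 ▸ ha) haR f hf, a1]
      · rw [(hk2 18).2 _ ((hp.node p hpn).trans_le hn1), b7 p hpn]
      · omega
  rw [wp_ite]
  refine ⟨fun hn => ?_, fun hn => ?_⟩
  · simp only [Test.Holds, h102] at hn
    rw [wp_const]
    exact ⟨Nat.zero_le _, main _ _ rfl rfl (by simp +contextual) (by simp [chainRank, hn]) (by omega)⟩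
  · simp only [Test.Holds, h102, not_not] at hn
    rw [wp_move]
    exact main _ _ rfl rfl (by simp +contextual) (by simp [chainRank, hn, h110]) (by omega)

/-- The ranks `rk` of the points agree with the order of the `y`-coordinates. -/
structure Ranking (n : ℕ) (y : ℕ → ℝ) (rk : ℕ → ℕ) : Prop where
  lt : ∀ p < n, rk p < n
  surj : ∀ m < n, ∃ p < n, rk p = m
  mono : ∀ p < n, ∀ q < n, rk p ≤ rk q → y p ≤ y q

/-- Link the elements in the list in register `95` to new elements for the two halves of the range
of ranks that starts at the number in register `99`. -/
def splitCmd : Cmd :=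
  .load 101 100 4 ;; .load 102 100 6 ;; .load 103 100 5 ;; .add 104 99 101 ;; .add 105 104 101 ;;
    .const 106 1 ;; .sub 107 104 106 ;; keyCmd ;; .move 110 99 ;; .move 92 104 ;; sideCmd 13 15 ;;
    .move 110 104 ;; .move 92 105 ;; sideCmd 14 16

/-- The elements `R` have been linked to the elements `RL` and `RR` for the two halves of their
range of ranks, and the two tasks are in the nodes `cL` and `cR`. -/
structure Split (n : ℕ) (y : ℕ → ℝ) (rk cn : ℕ → ℕ) (h : ℕ) (σ σ' : State) (i lo : ℕ)
    (R : List (ℕ × ℕ)) (cL cR : ℕ) (RL RR : List (ℕ × ℕ)) : Prop where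
  workR : Work h σ' cR i (lo + 2 ^ i) RR (.ptr cL)
  workL : Work h σ' cL i lo RL (σ.reg 97)
  itemR : Item n rk h σ' i (lo + 2 ^ i) RR
  itemL : Item n rk h σ' i lo RL
  pointsR : RR.map Prod.snd = (R.map Prod.snd).filter
    (fun p => chainRank h i (lo + 2 ^ i) ≤ rk p ∧ rk p < lo + 2 ^ i + 2 ^ i)
  pointsL : RL.map Prod.snd = (R.map Prod.snd).filter
    (fun p => chainRank h i lo ≤ rk p ∧ rk p < lo + 2 ^ i)
  leL : ∀ e ∈ RL, σ.next ≤ e.1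
  ltR : ∀ e ∈ RR, σ.next ≤ e.1 ∧ ∀ e' ∈ RL, e'.1 < e.1
  linked : ∀ e t, e :: t <:+ R →
    Linked cn rk 13 15 (chainRank h i lo) (lo + 2 ^ i) σ' RL e.1 ((e :: t).map Prod.snd) ∧
    Linked cn rk 14 16 (chainRank h i (lo + 2 ^ i)) (lo + 2 ^ i + 2 ^ i) σ' RR e.1
      ((e :: t).map Prod.snd) ∧
    KeyOK n y rk (σ'.heap e.1 17) (lo + 2 ^ i - 1)
  frame : ∀ a < σ.next, a ∉ R.map Prod.fst → ∀ f ∈ [13, 14, 15, 16, 17], σ'.heap a f = σ.heap a f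
  flags : ∀ p < n, σ'.heap (cn p) 18 = .nil

/-- Both children are built by scans of the same list, with separate fields for their links. The
elements of the right child are newer than those of the left child, which makes the two sets
disjoint. -/
theorem wp_splitCmd {n : ℕ} {y : ℕ → ℝ} {cn rk : ℕ → ℕ} {h i lo : ℕ} {R : List (ℕ × ℕ)}
    {Q : ℕ → State → Prop} {t : ℕ} {σ : State}
    (hl : Lst σ (σ.reg 95) (R.reverse.map fun e => .ptr e.1)) (hlo : σ.reg 99 = .int lo)
    (hw : Widths h σ (i + 1) (σ.reg 100)) (hI : Item n rk h σ (i + 1) lo R)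
    (hrk : Ranking n y rk) (hp : Points n y rk cn σ)
    (hfl : ∀ p < n, σ.heap (cn p) 18 = .nil) (hW : lo + 2 ^ (i + 1) ≤ W) (hRW : R.length ≤ W)
    (hQ : ∀ u σ' cL cR RL RR, Frame splitCmd σ σ' → σ'.reg 97 = .ptr cR →
      Split n y rk cn h σ σ' i lo R cL cR RL RR → u ≤ t + 350 * R.length + 130 → Q u σ') :
    Wp W splitCmd Q t σ := by
  refine Wp.frame ?_
  obtain ⟨c, hc, hv, hw4, hw6, hw5⟩ := hw
  have h2i : 0 < 2 ^ i := by positivity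
  have hW' : lo + 2 ^ i + 2 ^ i ≤ W := by rw [pow_succ] at hW; omega
  refine Wp.abstract fun G hG => ?_
  simp [splitCmd, hv, hw4, hlo]
  refine ⟨by omega, by omega, by omega, ?_⟩
  have hR : ∀ e ∈ R, e.1 < σ.next ∧ σ.heap e.1 12 = .ptr e.2 ∧ e.2 < n := fun e he =>
    ⟨(hI.elems e he).1.lt, (hI.elems e he).1.point, (hI.elems e he).2⟩
  generalize hτ : State.set _ 107 _ = τ
  have hk0 : ∀ f, Keeps f σ τ := fun f => by rw [← hτ]; exact ⟨le_rfl, fun _ _ => rfl⟩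
  have e99 : τ.reg 99 = .int lo := by simp [← hτ, hlo]
  have e104 : τ.reg 104 = .int (lo + 2 ^ i) := by simp [← hτ]
  have e105 : τ.reg 105 = .int (lo + 2 ^ i + 2 ^ i) := by simp [← hτ]
  have e102 : τ.reg 102 = σ.heap c 6 := by simp [← hτ]
  have e103 : τ.reg 103 = σ.heap c 5 := by simp [← hτ]
  have e97 : τ.reg 97 = σ.reg 97 := by simp [← hτ]
  have e95 : τ.reg 95 = σ.reg 95 := by simp [← hτ]
  have hh : τ.heap = σ.heap := by rw [← hτ]; rfl
  have hn : τ.next = σ.next := by rw [← hτ]; rfl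
  have hpτ : Points n y rk cn τ := hp.keeps (hk0 8) (hk0 10) (hk0 11)
  refine wp_keyCmd (n := n) (y := y) (rk := rk) (cn := cn) (m := lo + 2 ^ i - 1) (R := R.reverse)
    ?_ ?_ hpτ (by simp [← hτ]) fun u₁ σ₁ hf₁ hkey hu₁ => ?_
  · rw [e95]; exact hl.keeps (hk0 4) (hk0 5)
  · intro e he
    obtain ⟨h1, h2, h3⟩ := hR e (by simpa using he)
    exact ⟨by rw [hh, h2], by rw [hn]; exact h1, h3⟩
  have hk1 : ∀ f, Keeps f σ σ₁ := fun f => by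
    refine (hk0 f).trans (hf₁.keeps f ?_)
    simp [keyCmd, whileSome, Cmd.keepsFld]
  have hkeyok : KeyOK n y rk (σ₁.reg 93) (lo + 2 ^ i - 1) := by
    rcases hkey with ⟨e, he, h1, h2⟩ | ⟨h1, h2⟩
    · refine .inr ⟨_, h2, fun p hpn => ?_⟩
      have he2 := (hR e (by simpa using he)).2.2
      rw [← h1]
      exact ⟨hrk.mono p hpn _ he2, hrk.mono _ he2 p hpn⟩
    -- Ranks exhaust an initial segment. If some rank were at least `m = lo + 2 ^ i - 1`, a point of
    -- rank `m` would exist, and it would be in the list because `m` lies in the range.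
    · refine .inl ⟨h1, fun p hpn => ?_⟩
      by_contra hlt
      obtain ⟨q, hq, hq'⟩ := hrk.surj (lo + 2 ^ i - 1) (by have := hrk.lt p hpn; omega)
      obtain ⟨e, he, rfl⟩ := List.mem_map.1 (hI.mem q hq (by omega) (by rw [pow_succ]; omega))
      exact h2 e (by simpa using he) hq'
  simp only [wp_seq, wp_move, State.set_reg, reduceIte, Nat.reduceEqDiff]
  generalize hτ₁ : State.set _ 92 _ = τ₁
  have hk2 : ∀ f, Keeps f σ τ₁ := fun f => by
    rw [← hτ₁]; exact ⟨(hk1 f).1, fun x hx => (hk1 f).2 x hx⟩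
  have k104 : τ₁.reg 104 = .int (lo + 2 ^ i) := by simp [← hτ₁, hf₁.reg 104 rfl, e104]
  have k105 : τ₁.reg 105 = .int (lo + 2 ^ i + 2 ^ i) := by simp [← hτ₁, hf₁.reg 105 rfl, e105]
  have k102 : τ₁.reg 102 = σ.heap c 6 := by simp [← hτ₁, hf₁.reg 102 rfl, e102]
  have k103 : τ₁.reg 103 = σ.heap c 5 := by simp [← hτ₁, hf₁.reg 103 rfl, e103]
  have k97 : τ₁.reg 97 = σ.reg 97 := by simp [← hτ₁, hf₁.reg 97 rfl, e97]
  have k95 : τ₁.reg 95 = σ.reg 95 := by simp [← hτ₁, hf₁.reg 95 rfl, e95]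
  have k93 : τ₁.reg 93 = σ₁.reg 93 := by simp [← hτ₁]
  have hR' : ∀ e ∈ R, e.1 < τ₁.next ∧ τ₁.heap e.1 12 = .ptr e.2 ∧ e.2 < n := fun e he =>
    ⟨(hR e he).1.trans_le (hk2 0).1, by rw [(hk2 12).2 _ (hR e he).1, (hR e he).2.1],
      (hR e he).2.2⟩
  have hfl' : ∀ p < n, τ₁.heap (cn p) 18 = .nil := fun p hpn => by
    rw [(hk2 18).2 _ (hp.node p hpn), hfl p hpn]
  refine wp_sideCmd (n := n) (y := y) (cn := cn) (rk := rk) (h := h) (i := i) (lo := lo) (R := R)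
    (.inl ⟨rfl, rfl⟩) (by rw [k95]; exact hl.keeps (hk2 4) (hk2 5)) hR' hI.nodup
    (hp.keeps (hk2 8) (hk2 10) (hk2 11)) hfl' (by simp [← hτ₁, hf₁.reg 99 rfl, e99])
    (by simp [← hτ₁, hf₁.reg 104 rfl, e104]) (by rw [k102]; exact hw6)
    (by rw [k103]; exact hw5.keeps (hk2 4) (hk2 5) (hk2 6))
    (fun p hpn h1 h2 => hI.mem p hpn h1 (by rw [pow_succ]; omega)) hRW (by omega)
    fun u₂ σ₂ RL cL hf₂ a1 a2 a3 a4 a5 a6 a7 a8 a9 a10 => ?_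
  simp only [wp_seq, wp_move, State.set_reg, reduceIte, Nat.reduceEqDiff]
  generalize hτ₂ : State.set _ 92 _ = τ₂
  have s1 : τ₂.next = σ₂.next := by rw [← hτ₂]; rfl
  have s2 : τ₂.heap = σ₂.heap := by rw [← hτ₂]; rfl
  have hk3' : ∀ f, Keeps f σ₂ τ₂ := fun f => ⟨s1.ge, fun _ _ => by rw [s2]⟩
  have hk3 : ∀ f ∈ [4, 5, 6, 8, 10, 11, 12], Keeps f σ τ₂ := fun f hf =>
    ((hk2 f).trans (hf₂.keeps f (by revert f; simp; decide))).trans (hk3' f)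
  have n12 : σ.next ≤ σ₂.next := (hk3 4 (by simp)).1.trans s1.le
  refine wp_sideCmd (n := n) (y := y) (cn := cn) (rk := rk) (h := h) (i := i) (lo := lo + 2 ^ i)
    (R := R) (.inr ⟨rfl, rfl⟩) ?_ ?_ hI.nodup ?_ ?_ ?_ ?_ ?_ ?_ ?_ hRW (by omega)
    fun u₃ σ₃ RR cR hf₃ b1 b2 b3 b4 b5 b6 b7 b8 b9 b10 => hG _ _ fun hff => ?_
  · have : τ₂.reg 95 = σ.reg 95 := by rw [← hτ₂]; simp [hf₂.reg 95 rfl, k95]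
    rw [this]; exact hl.keeps (hk3 4 (by simp)) (hk3 5 (by simp))
  · exact fun e he =>
      ⟨(hR e he).1.trans_le (hk3 12 (by simp)).1, by
        rw [(hk3 12 (by simp)).2 _ (hR e he).1, (hR e he).2.1], (hR e he).2.2⟩
  · exact hp.keeps (hk3 8 (by simp)) (hk3 10 (by simp)) (hk3 11 (by simp))
  · rw [s2]; exact a9
  · simp [← hτ₂, hf₂.reg 104 rfl, k104]
  · simp [← hτ₂, hf₂.reg 105 rfl, k105]
  · have : τ₂.reg 102 = σ.heap c 6 := by rw [← hτ₂]; simp [hf₂.reg 102 rfl, k102]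
    rw [this]; exact hw6
  · have : τ₂.reg 103 = σ.heap c 5 := by rw [← hτ₂]; simp [hf₂.reg 103 rfl, k103]
    rw [this]; exact hw5.keeps (hk3 4 (by simp)) (hk3 5 (by simp)) (hk3 6 (by simp))
  · exact fun p hpn h1 h2 => hI.mem p hpn (by omega) (by rw [pow_succ]; omega)
  have r97 : τ₂.reg 97 = .ptr cL := by rw [← hτ₂]; simp [a1]
  -- Both scans write field `17`; the key register is unchanged in between, so the second scan
  -- stores the same value again.
  have r93 : τ₂.reg 93 = σ₁.reg 93 := by rw [← hτ₂]; simp [hf₂.reg 93 rfl, k93]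
  rw [r97] at b3
  rw [k97] at a3
  have hk4 : ∀ f ∈ [4, 5, 6, 12, 13, 15, 23, 24, 25], Keeps f σ₂ σ₃ := fun f hf =>
    (hk3' f).trans (hf₃.keeps f (by revert f; simp; decide))
  -- The new left elements are not among those scanned for the right child, so their own links are
  -- still empty afterwards.
  have hRL : ∀ e ∈ RL, e.1 < τ₂.next ∧ e.1 ∉ R.map Prod.fst := fun e he => by
    refine ⟨s1 ▸ (a4.elems e he).1.lt, fun hm => ?_⟩
    obtain ⟨e', he', h'⟩ := List.mem_map.1 hm
    have := (hR' e' he').1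
    have := a6 e he
    omega
  have hle1 : σ.next ≤ τ₁.next := (hk2 0).1
  refine hQ _ _ cL cR RL RR hff b1 ⟨b3, a3.keeps fun f hf => hk4 f (by
    simp at hf ⊢; omega), b4, a4.keeps (hk4 12 (by simp)) fun e he f hf => ?_, b5, a5,
    fun e he => hle1.trans (a6 e he), fun e he => ⟨?_, fun e' he' => ?_⟩,
    fun e t' ht => ⟨(a7 e t' ht).1.keeps ?_ ?_ (hk4 4 (by simp)) (hk4 5 (by simp))
      (hk4 6 (by simp)) List.suffix_rfl, (b7 e t' ht).1, ?_⟩, fun a ha haR f hf => ?_, b9⟩ ?_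
  · rw [b8 _ (hRL e he).1 (hRL e he).2 f hf, s2]
  · exact (hk3 4 (by simp)).1.trans (b6 e he)
  · exact (hRL e' he').1.trans_le (b6 e he)
  · exact (hk4 13 (by simp)).2 _ ((hR e (ht.subset (by simp))).1.trans_le n12)
  · exact (hk4 15 (by simp)).2 _ ((hR e (ht.subset (by simp))).1.trans_le n12)
  · rw [(b7 e t' ht).2, r93]; exact hkeyok
  · have h1 := ha.trans_le hle1
    rw [b8 a (ha.trans_le (hk3 4 (by simp)).1) haR f hf, s2, a8 a h1 haR f hf, (hk2 f).2 a ha]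
  · simp only [List.length_reverse] at hu₁
    omega

/-! ### Building the data structure for all ranges of ranks -/

/-- Carry out the first task of the work list in register `97`. -/
def taskCmd : Cmd :=
  .load 95 97 23 ;; .load 99 97 24 ;; .load 100 97 25 ;; .load 97 97 5 ;;
    .ite (.isNil 95) .skip (.ite (.isNil 100) .skip splitCmd)

/-- The body of the work loop. -/
def stepCmd : Cmd := .ite (.isNil 97) (.const 98 0) taskCmd

/-- Carry out the tasks of the work list in register `97`. -/
def linkCmd : Cmd := whileSome 98 97 taskCmd

/-- The time at level `i` for an element. -/
def eltRate (h : ℕ) : ℕ → ℕ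
  | 0 => 0
  | i + 1 => 600 + if i % h = 0 then 0 else 2 * eltRate h i

/-- The additional time at level `i` for an element with a rank in the range of the node. -/
def ownRate (h : ℕ) : ℕ → ℕ
  | 0 => 0
  | i + 1 => ownRate h i + if i % h = 0 then eltRate h i else 0

theorem Frame.loop {c : Cmd} {σ σ' : State} (h : Frame c σ σ') :
    Frame (.while (.isNil 98) (.ite (.isNil 97) (.const 98 0) c)) σ σ' := by
  refine ⟨fun r hr => h.reg r ?_, fun f hf => h.heap f ?_, h.next⟩
  · simp only [Cmd.keepsReg, Bool.and_eq_true] at hr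
    exact hr.2
  · simpa [Cmd.keepsFld] using hf

/-- The elements `R` are linked to structures for the ranks from `lo` to below `lo + 2 ^ i`. -/
def Done (n : ℕ) (y : ℕ → ℝ) (rk cn : ℕ → ℕ) (h N : ℕ) (σ : State) (i lo : ℕ)
    (R : List (ℕ × ℕ)) : Prop :=
  ∀ t, t <:+ R → Rep n y rk cn h (fun a => a ∈ R.map Prod.fst ∨ N ≤ a) σ i lo (headVal t)
    (t.map Prod.snd)

theorem countP_add_countP_le {α : Type*} (l : List α) {p p₁ p₂ : α → Bool}
    (h₁ : ∀ x, p₁ x = true → p x = true) (h₂ : ∀ x, p₂ x = true → p x = true ∧ p₁ x = false) :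
    l.countP p₁ + l.countP p₂ ≤ l.countP p := by
  induction l with
  | nil => simp
  | cons x l ih =>
    simp only [List.countP_cons]
    have h1 := h₁ x
    have h2 := h₂ x
    cases e1 : p₁ x <;> cases e2 : p₂ x <;> cases e : p x <;> simp_all <;> omega

/-- If `h` does not divide `i`, each child list can be as long as the parent list `m`, which doubles
the rate per element. If `h` divides `i`, the child lists contain only ranks of the parent range and
are disjoint, so their cost is charged to the `o` points that have their rank there. -/
theorem eltRate_mul_add_le {h i m o mL mR oL oR : ℕ} (hL : mL ≤ m) (hR : mR ≤ m)
    (ho : oL + oR ≤ o) (hm : i % h = 0 → mL + mR ≤ o) :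
    (eltRate h i * mL + ownRate h i * oL) + (eltRate h i * mR + ownRate h i * oR) + 600 * m ≤
      eltRate h (i + 1) * m + ownRate h (i + 1) * o := by
  rw [eltRate, ownRate]
  have h1 := Nat.mul_le_mul_left (ownRate h i) ho
  split_ifs with hi
  · have h2 := Nat.mul_le_mul_left (eltRate h i) (hm hi)
    nlinarith
  · have h2 := Nat.mul_le_mul_left (eltRate h i) (Nat.add_le_add hL hR)
    nlinarith

/-- The machine has no recursion, only a stack of tasks. The statement is in continuation form: to
verify the loop with this task on top, it suffices to verify it once the task is done and popped. By
induction on the level, the task becomes two tasks, each handled by the induction hypothesis. -/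
theorem wp_task {n : ℕ} {y : ℕ → ℝ} {cn rk : ℕ → ℕ} {h : ℕ} (hrk : Ranking n y rk)
    {i c lo : ℕ} {R : List (ℕ × ℕ)} {v : Val}
    {Q : ℕ → State → Prop} {t : ℕ} {σ : State}
    (hw : Work h σ c i lo R v) (h97 : σ.reg 97 = .ptr c) (h98 : σ.reg 98 = .nil)
    (hI : Item n rk h σ i lo R) (hp : Points n y rk cn σ)
    (hfl : ∀ p < n, σ.heap (cn p) 18 = .nil) (hW : lo + 2 ^ i ≤ W) (hRW : R.length ≤ W)
    (hQ : ∀ u σ', Frame (.while (.isNil 98) stepCmd) σ σ' → σ'.reg 97 = v → σ'.reg 98 = .nil →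
      Done n y rk cn h σ.next σ' i lo R →
      (∀ a < σ.next, a ∉ R.map Prod.fst → ∀ f ∈ [13, 14, 15, 16, 17],
        σ'.heap a f = σ.heap a f) → (∀ p < n, σ'.heap (cn p) 18 = .nil) →
      u ≤ t + eltRate h i * R.length +
        ownRate h i * ((R.map Prod.snd).countP fun p => lo ≤ rk p) + 15 →
      Wp W (.while (.isNil 98) stepCmd) Q u σ') :
    Wp W (.while (.isNil 98) stepCmd) Q t σ := by
  induction i generalizing c lo R v Q t σ with
  | zero =>
    refine Wp.while_true h98 ?_
    have hskip : ∀ u : ℕ, u ≤ t + 14 → Wp W (.while (.isNil 98) stepCmd) Q u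
        ((((σ.set 95 (σ.heap c 23)).set 99 (.int lo)).set 100 .nil).set 97 v) := by
      intro u hu
      refine hQ u _ ⟨fun r hr => ?_, fun _ _ _ _ => rfl, le_rfl⟩ (by simp) (by simpa using h98)
        (fun t' ht => ?_) (fun _ _ _ _ _ => rfl) hfl (by omega)
      · simp only [stepCmd, taskCmd, Cmd.keepsReg, Bool.and_eq_true, bne_iff_ne, ne_eq] at hr
        simp only [State.set_reg]
        rw [if_neg, if_neg, if_neg, if_neg] <;> tauto
      -- Every `h` divides `0`, so the bottom level is a cut: its lists contain no lower ranks.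
      · refine ⟨fun p hp => ?_, ?_⟩
        · obtain ⟨e, he, rfl⟩ := List.mem_map.1 hp
          exact hI.le (Nat.zero_mod _) e (ht.subset he)
        · cases t' with
          | nil => exact .inl rfl
          | cons e t' =>
            have he : e ∈ R := ht.subset (by simp)
            exact .inr ⟨e.1, (hI.elems e he).1.lt, rfl, .inl (List.mem_map_of_mem he),
              (hI.elems e he).1.links⟩
    have hw25 : σ.heap c 25 = .nil := hw.widths
    simp [stepCmd, taskCmd, h97, hw.lo, hw25, hw.tail, Test.Holds]
    simp only [stepCmd, taskCmd] at hskip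
    exact ⟨fun _ => hskip _ (by omega), fun _ => hskip _ (by omega)⟩
  | succ i ih =>
    refine Wp.while_true h98 ?_
    obtain ⟨x, hx, hv, -⟩ := id hw.widths
    rw [stepCmd, wp_ite]
    refine ⟨fun h => by simp [Test.Holds, h97] at h, fun _ => ?_⟩
    refine Wp.frame ?_
    refine Wp.abstract fun G hG => ?_
    simp [taskCmd, h97, hw.lo, hv, hw.tail, Test.Holds]
    generalize hτ : State.set _ 97 v = τ
    have hk0 : ∀ f, Keeps f σ τ := fun f => by rw [← hτ]; exact ⟨le_rfl, fun _ _ => rfl⟩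
    have hh : τ.heap = σ.heap := by rw [← hτ]; rfl
    have hn : τ.next = σ.next := by rw [← hτ]; rfl
    have e97 : τ.reg 97 = v := by simp [← hτ]
    have e98 : τ.reg 98 = .nil := by simp [← hτ, h98]
    refine ⟨fun h23 => hG _ _ fun hfr => ?_, fun h23 => ?_⟩
    · have hR0 : R = [] := by
        have := hw.list
        rw [h23] at this
        simpa using this.eq_nil
      subst hR0
      refine hQ _ τ hfr.loop e97 e98 (fun t' ht => ?_) (fun _ _ _ _ _ => by rw [hh])
        (fun p hpn => by rw [hh, hfl p hpn]) (by omega)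
      obtain rfl := List.suffix_nil.1 ht
      exact Rep.nil
    · refine wp_splitCmd (n := n) (y := y) (cn := cn) (rk := rk) (h := h) (i := i) (lo := lo)
        (R := R) ?_ ?_ ?_ (hI.keeps (hk0 12) fun e _ f _ => by rw [hh]) hrk
        (hp.keeps (hk0 8) (hk0 10) (hk0 11)) (by simpa only [hh] using hfl) hW hRW
        fun u₁ σ₁ cL cR RL RR hf₁ a97 hS hu₁ => hG _ _ fun hfr => ?_
      · simpa [← hτ] using hw.list
      · simp [← hτ]
      · simpa [← hτ, hv] using hw.widths.keeps (hk0 4) (hk0 5) (hk0 6)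
      have hp1 : Points n y rk cn σ₁ :=
        hp.keeps (hfr.keeps 8 rfl) (hfr.keeps 10 rfl) (hfr.keeps 11 rfl)
      have hpow : 2 ^ (i + 1) = 2 ^ i + 2 ^ i := by rw [pow_succ]; omega
      have h2i : 0 < 2 ^ i := by positivity
      have hlenL : RL.length ≤ R.length := by
        rw [← List.length_map (f := Prod.snd), hS.pointsL, ← List.length_map (as := R)]
        exact List.length_filter_le _ _
      have hlenR : RR.length ≤ R.length := by
        rw [← List.length_map (f := Prod.snd), hS.pointsR, ← List.length_map (as := R)]
        exact List.length_filter_le _ _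
      -- For a nonempty list the term `600 * R.length` also absorbs the constants of this task and
      -- of its two subtasks.
      have hRpos : 0 < R.length := by
        by_contra h0
        have hR0 : R = [] := List.length_eq_zero_iff.1 (by omega)
        have := hw.list
        rw [hR0] at this
        exact h23 this
      have hcr := chainRank_le h i lo
      have hcr' := chainRank_le h i (lo + 2 ^ i)
      -- Here `o` counts the points of the list whose rank is at least `lo`, and likewise for the
      -- children; the upper ends of the ranges are guaranteed by the lists.
      have hcost := eltRate_mul_add_le (h := h) (i := i) (m := R.length)
        (o := (R.map Prod.snd).countP fun p => lo ≤ rk p)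
        (oL := (RL.map Prod.snd).countP fun p => lo ≤ rk p)
        (oR := (RR.map Prod.snd).countP fun p => lo + 2 ^ i ≤ rk p) hlenL hlenR (by
          rw [hS.pointsL, hS.pointsR, List.countP_filter, List.countP_filter]
          refine countP_add_countP_le _ (fun p => ?_) fun p => ?_ <;> simp <;> omega)
        (fun hi => by
          rw [← List.length_map (f := Prod.snd), ← List.length_map (as := RR) (f := Prod.snd),
            hS.pointsL, hS.pointsR, ← List.countP_eq_length_filter, ← List.countP_eq_length_filter]
          refine countP_add_countP_le _ (fun p => ?_) fun p => ?_ <;>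
            simp [chainRank, hi] <;> omega)
      -- The right task is on top of the stack and runs first; its continuation is the left task.
      refine ih hS.workR a97 (by rw [hf₁.reg 98 rfl, e98]) hS.itemR hp1 hS.flags (by omega)
        (hlenR.trans hRW) fun u₂ σ₂ hf₂ b97 b98 hD₂ hfm₂ hfl₂ hu₂ => ?_
      have hk2 : ∀ f ∈ [4, 5, 6, 8, 10, 11, 12, 18, 23, 24, 25],
          Cmd.keepsFld f none (.while (.isNil 98) stepCmd) = true ∨ f = 18 := by simp; decide
      have hk2' : ∀ f ∈ [4, 5, 6, 8, 10, 11, 12, 23, 24, 25],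
          Cmd.keepsFld f none (.while (.isNil 98) stepCmd) = true := fun f hf =>
        (hk2 f (by simp at hf ⊢; omega)).resolve_right (by simp at hf; omega)
      have hk : ∀ f ∈ [4, 5, 6, 8, 10, 11, 12, 23, 24, 25], Keeps f σ₁ σ₂ := fun f hf =>
        hf₂.keeps f (hk2' f hf)
      have hRLlt : ∀ e ∈ RL, e.1 < σ₁.next := fun e he => (hS.itemL.elems e he).1.lt
      have hRLR : ∀ a ∈ RL.map Prod.fst, a ∉ RR.map Prod.fst := fun a ha ha' => by
        obtain ⟨e, he, rfl⟩ := List.mem_map.1 ha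
        obtain ⟨e', he', h'⟩ := List.mem_map.1 ha'
        have := (hS.ltR e' he').2 e he
        omega
      refine ih (hS.workL.keeps fun f hf => hk f (by simp at hf ⊢; omega)) b97 b98
        (hS.itemL.keeps (hk 12 (by simp)) fun e he f hf =>
          hfm₂ e.1 (hRLlt e he) (hRLR _ (List.mem_map_of_mem he)) f hf)
        (hp1.keeps (hk 8 (by simp)) (hk 10 (by simp)) (hk 11 (by simp))) hfl₂ (by omega)
        (hlenL.trans hRW) fun u₃ σ₃ hf₃ c97 c98 hD₃ hfm₃ hfl₃ hu₃ => ?_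
      have hk' : ∀ f ∈ [4, 5, 6], Keeps f σ₂ σ₃ := fun f hf =>
        hf₃.keeps f (hk2' f (by simp at hf ⊢; omega))
      have h01 : σ.next ≤ σ₁.next := hfr.next
      have h12 : σ₁.next ≤ σ₂.next := hf₂.next
      -- Both subtasks write links only in elements created after the split began, so the links just
      -- stored in `R` persist.
      have hold : ∀ a < σ.next, ∀ f ∈ [13, 14, 15, 16, 17], σ₃.heap a f = σ₁.heap a f := by
        intro a ha f hf
        rw [hfm₃ a (by omega) (fun hm => ?_) f hf, hfm₂ a (by omega) (fun hm => ?_) f hf]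
        · obtain ⟨e, he, rfl⟩ := List.mem_map.1 hm
          have := (hS.ltR e he).1
          omega
        · obtain ⟨e, he, rfl⟩ := List.mem_map.1 hm
          have := hS.leL e he
          rw [hn] at this
          omega
      have hto : ∀ t', t' <:+ R → Rep n y rk cn h (fun a => a ∈ R.map Prod.fst ∨ σ.next ≤ a) σ₃
          (i + 1) lo (headVal t') (t'.map Prod.snd) := by
        intro t' ht
        cases t' with
        | nil => exact Rep.nil
        | cons e t' =>
          have heR : e ∈ R := ht.subset (by simp)
          have he : e.1 < σ.next := (hI.elems e heR).1.lt
          obtain ⟨⟨⟨tL, k1, k2, k3⟩, chL, k4, k5⟩, ⟨⟨tR, l1, l2, l3⟩, chR, l4, l5⟩, k6⟩ :=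
            hS.linked e t' ht
          have h4 := (hk 4 (by simp)).trans (hk' 4 (by simp))
          have h5 := (hk 5 (by simp)).trans (hk' 5 (by simp))
          have h6 := (hk 6 (by simp)).trans (hk' 6 (by simp))
          refine .inr ⟨e.1, by have := hf₃.next; omega, rfl, .inl (List.mem_map_of_mem heR), ?_,
            ⟨⟨chL, ?_, k5⟩, ?_⟩, ⟨chR, ?_, l5⟩, ?_⟩
          · rw [hold _ he 17 (by simp)]; exact k6
          · rw [hold _ he 15 (by simp)]; exact k4.keeps h4 h5 h6
          · rw [hold _ he 13 (by simp), k2, ← k3]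
            refine (hD₃ tL k1).keeps ⟨le_rfl, fun _ _ => rfl⟩ ⟨le_rfl, fun _ _ => rfl⟩
              ⟨le_rfl, fun _ _ => rfl⟩ fun a _ ha => ⟨.inr ?_, fun _ _ => rfl⟩
            rcases ha with ha | ha
            · obtain ⟨e', he', rfl⟩ := List.mem_map.1 ha
              exact hn ▸ hS.leL e' he'
            · omega
          · rw [hold _ he 16 (by simp)]; exact l4.keeps h4 h5 h6
          -- The right structure must survive the left task. Its elements are in `RR` or were
          -- allocated after the split, so none of them is in `RL`.
          · rw [hold _ he 14 (by simp), l2, ← l3]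
            refine (hD₂ tR l1).keeps (hk' 4 (by simp)) (hk' 5 (by simp)) (hk' 6 (by simp))
              fun a ha2 ha => ⟨.inr ?_, fun f hf => hfm₃ a ha2 (fun hm => ?_) f hf⟩
            · rcases ha with ha | ha
              · obtain ⟨e', he', rfl⟩ := List.mem_map.1 ha
                exact hn ▸ (hS.ltR e' he').1
              · omega
            · rcases ha with ha | ha
              · exact hRLR a hm ha
              · obtain ⟨e', he', rfl⟩ := List.mem_map.1 hm
                have := hRLlt e' he'
                omega
      refine hQ u₃ σ₃ ((hfr.loop.trans hf₂).trans hf₃) (c97.trans e97) c98 hto (fun a ha haR f hf => ?_) hfl₃ ?_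
      · rw [hold a ha f hf, hS.frame a (hn ▸ ha) haR f hf, hh]
      · omega

/-- The work list with a single task for the root range. All ranks are at least `0`, so both rates
apply to every element. -/
theorem wp_linkCmd {n : ℕ} {y : ℕ → ℝ} {cn rk : ℕ → ℕ} {h : ℕ} (hrk : Ranking n y rk)
    {i c : ℕ} {R : List (ℕ × ℕ)} {Q : ℕ → State → Prop} {t : ℕ} {σ : State}
    (hw : Work h σ c i 0 R .nil) (h97 : σ.reg 97 = .ptr c)
    (hI : Item n rk h σ i 0 R) (hp : Points n y rk cn σ)
    (hfl : ∀ p < n, σ.heap (cn p) 18 = .nil) (hW : 2 ^ i ≤ W) (hRW : R.length ≤ W)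
    (hQ : ∀ u σ', Frame linkCmd σ σ' → Done n y rk cn h σ.next σ' i 0 R →
      (∀ p < n, σ'.heap (cn p) 18 = .nil) →
      u ≤ t + (eltRate h i + ownRate h i) * R.length + 20 → Q u σ') :
    Wp W linkCmd Q t σ := by
  refine Wp.frame ?_
  rw [linkCmd, whileSome, wp_seq, wp_clear]
  have hk : ∀ f, Keeps f σ (σ.set 98 .nil) := fun f => .set ..
  refine wp_task (n := n) (y := y) (cn := cn) (rk := rk) hrk (hw.keeps fun f _ => hk f)
    (by simpa using h97) (by simp) (hI.keeps (hk 12) fun _ _ _ _ => rfl)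
    (hp.keeps (hk 8) (hk 10) (hk 11)) hfl (by omega) hRW
    fun u₁ σ₁ hf₁ a97 a98 hD _ hfl₁ hu₁ => ?_
  refine Wp.while_true a98 ?_
  rw [stepCmd, wp_ite]
  refine ⟨fun _ => ?_, fun h => absurd a97 h⟩
  rw [wp_const]
  refine ⟨Nat.zero_le _, Wp.while_false (by simp [Test.Holds]) fun hff => hQ _ _ hff
    (fun t' ht => (hD t' ht).keeps (.set ..) (.set ..) (.set ..) fun a _ ha => ⟨ha, fun _ _ => rfl⟩)
    hfl₁ ?_⟩
  have hc := Nat.mul_le_mul_left (ownRate h i)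
    (List.countP_le_length (l := R.map Prod.snd) (p := fun p => decide (0 ≤ rk p)))
  rw [List.length_map] at hc
  rw [add_mul]
  omega

/-! ### Answering a query -/

/-- The state of the search for the answer at level `i`. The points of `T` with `y ≤ z` are sought,
those outside `X` have been found. -/
structure Visit (n : ℕ) (y : ℕ → ℝ) (rk cn : ℕ → ℕ) (h : ℕ) (F S : ℕ → Prop) (T : List ℕ) (z : ℝ)
    (σ : State) (i lo : ℕ) (X : List ℕ) (pre : List (ℕ × ℕ)) (ks : List ℕ) : Prop where
  rep : Rep n y rk cn h F σ i lo (σ.reg 60) X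
  acc : Acc S σ pre ks
  count : ∀ a, total pre a + X.countP (fun p => cn p = a ∧ y p ≤ z) =
    T.countP fun p => cn p = a ∧ y p ≤ z
  keys : ∀ a ∈ pre.map Prod.fst, a ∈ (T.filter fun p => y p ≤ z).map cn
  sub : ∀ p ∈ X, p ∈ T
  low : ∀ p < n, rk p < lo → y p ≤ z
  high : ∀ p < n, lo + 2 ^ i ≤ rk p + 1 → z < y p

/-- Ranks below `b` qualify automatically and ranks from `c` on never do, so only the ranks in
between remain to be decided. -/
theorem countP_eq_filter_add_filter {y : ℕ → ℝ} {rk cn : ℕ → ℕ} {z : ℝ} {b c a : ℕ} {X : List ℕ}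
    (hlow : ∀ p ∈ X, rk p < b → y p ≤ z) (hhigh : ∀ p ∈ X, c ≤ rk p → z < y p) :
    X.countP (fun p => cn p = a ∧ y p ≤ z) =
      (X.filter fun p => rk p < b).countP (fun p => cn p = a) +
        (X.filter fun p => b ≤ rk p ∧ rk p < c).countP fun p => cn p = a ∧ y p ≤ z := by
  induction X with
  | nil => rfl
  | cons p X ih =>
    have ih := ih (fun q hq => hlow q (by simp [hq])) fun q hq => hhigh q (by simp [hq])
    have h1 := hlow p (by simp)
    have h2 := hhigh p (by simp)
    rcases lt_or_ge (rk p) b with hb | hb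
    · rw [List.filter_cons_of_pos (by simpa using hb), List.filter_cons_of_neg (by simp; omega),
        List.countP_cons, List.countP_cons, ih]
      simp [h1 hb]
      omega
    · rw [List.filter_cons_of_neg (by simpa using hb)]
      rcases lt_or_ge (rk p) c with hc | hc
      · rw [List.filter_cons_of_pos (by simpa using ⟨hb, hc⟩), List.countP_cons, List.countP_cons,
          ih]
        omega
      · rw [List.filter_cons_of_neg (by simp; omega), List.countP_cons, ih]
        simp [h2 hc]

/-- The number of colours in the answer. -/
noncomputable def answerCard (y : ℕ → ℝ) (cn : ℕ → ℕ) (T : List ℕ) (z : ℝ) : ℕ :=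
  ((T.filter fun p => y p ≤ z).map cn).toFinset.card

/-- The time for a query from level `i`. -/
def walkCost (h K : ℕ) : ℕ → ℕ
  | 0 => 20
  | i + 1 => walkCost h K i + 20 + if i % h = 0 then 11 * (2 * K + 1) else 0

/-- Go to a child and add the chain to the accumulators. -/
def turnCmd (fE fC : ℕ) : Cmd := .load 70 60 fC ;; .load 60 60 fE ;; accCmd

/-- Points in the chain have ranks below `lo`, so they lie in the query range. This makes the
weights correct, and it bounds the length of the chain by the number of colours in the answer. The
points dropped at the upper end lie outside the range. -/
theorem wp_turnCmd {n : ℕ} {y : ℕ → ℝ} {rk cn : ℕ → ℕ} {h : ℕ} {F S : ℕ → Prop} {T : List ℕ}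
    {z : ℝ} {σ : State} {i lo e : ℕ} {X : List ℕ} {pre : List (ℕ × ℕ)} {ks : List ℕ}
    {fE fC : ℕ} {ch : List (ℕ × ℕ)} {Q : ℕ → State → Prop} {t : ℕ}
    (hT : ∀ p ∈ T, p < n) (hTW : T.length ≤ W) (hS : ∀ p < n, S (cn p))
    (he : σ.reg 60 = .ptr e) (hch : Chain σ (σ.heap e fC) ch)
    (hcho : ChainOf cn ch (X.filter fun p => rk p < chainRank h i lo))
    (hrep : Rep n y rk cn h F σ i lo (σ.heap e fE)
      (X.filter fun p => chainRank h i lo ≤ rk p ∧ rk p < lo + 2 ^ i))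
    (hacc : Acc S σ pre ks)
    (hcount : ∀ a, total pre a + X.countP (fun p => cn p = a ∧ y p ≤ z) =
      T.countP fun p => cn p = a ∧ y p ≤ z)
    (hkeys : ∀ a ∈ pre.map Prod.fst, a ∈ (T.filter fun p => y p ≤ z).map cn)
    (hsub : ∀ p ∈ X, p ∈ T) (hlow : ∀ p < n, rk p < lo → y p ≤ z)
    (hhigh : ∀ p < n, lo + 2 ^ i ≤ rk p + 1 → z < y p)
    (hQ : ∀ u σ' X' pre' ks', Frame (turnCmd fE fC) σ σ' →
      Visit n y rk cn h F S T z σ' i lo X' pre' ks' →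
      u + walkCost h (answerCard y cn T z) i + 13 ≤
        t + walkCost h (answerCard y cn T z) (i + 1) → Q u σ') :
    Wp W (turnCmd fE fC) Q t σ := by
  refine Wp.frame ?_
  have hb := chainRank_le h i lo
  have h2i : 0 < 2 ^ i := by positivity
  have hin : ∀ p ∈ X.filter (fun p => rk p < chainRank h i lo),
      p ∈ T.filter fun p => y p ≤ z := by
    intro p hp
    obtain ⟨h1, h2⟩ := List.mem_filter.1 hp
    refine List.mem_filter.2 ⟨hsub p h1, ?_⟩
    simp only [decide_eq_true_eq] at h2 ⊢
    exact hlow p (hT p (hsub p h1)) (by omega)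
  have hcnt : ∀ a, total (pre ++ ch) a +
      (X.filter fun p => chainRank h i lo ≤ rk p ∧ rk p < lo + 2 ^ i).countP
        (fun p => cn p = a ∧ y p ≤ z) = T.countP fun p => cn p = a ∧ y p ≤ z := by
    intro a
    rw [← hcount a, countP_eq_filter_add_filter (rk := rk) (b := chainRank h i lo) (c := lo + 2 ^ i)
      (fun p hp h => hlow p (hT p (hsub p hp)) (by omega))
      (fun p hp h => hhigh p (hT p (hsub p hp)) (by omega)), total_append, hcho.total]
    omega
  have hkch : ∀ a ∈ ch.map Prod.fst, a ∈ (T.filter fun p => y p ≤ z).map cn := by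
    intro a ha
    obtain ⟨p, hp, rfl⟩ := List.mem_map.1 (hcho.keys a ha)
    exact List.mem_map_of_mem (hin p hp)
  -- Off the cut levels the chain belongs to the ranks below `0`, hence is empty.
  have hlen : ch.length ≤ if i % h = 0 then 2 * answerCard y cn T z + 1 else 0 := by
    split_ifs with hi
    · refine hcho.length.trans ?_
      have : ((X.filter fun p => rk p < chainRank h i lo).map cn).toFinset.card ≤
          answerCard y cn T z := Finset.card_le_card fun a ha => by
        rw [List.mem_toFinset] at ha ⊢
        obtain ⟨p, hp, rfl⟩ := List.mem_map.1 ha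
        exact List.mem_map_of_mem (hin p hp)
      omega
    · have h0 : X.filter (fun p => rk p < chainRank h i lo) = [] := by
        simp [chainRank, hi]
      rw [h0] at hcho
      have : ch.map Prod.fst = [] := List.eq_nil_iff_forall_not_mem.2 fun a ha => by
        simpa using hcho.keys a ha
      simpa using this
  simp only [turnCmd, wp_seq, wp_load]
  refine ⟨e, he, e, by simpa using he, ?_⟩
  refine wp_accCmd (S := S) (pre := pre) (ks := ks) (ch := ch)
    ⟨hacc.nodup, hacc.mem, by simpa using hacc.out, hacc.count, hacc.flag, hacc.sub⟩
    (by simpa using hch) (fun x hx => ?_) (fun a => ?_) fun u σ' ks' hf hacc' hu hff => ?_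
  · obtain ⟨p, hp, hp'⟩ := List.mem_map.1 (hkch x.1 (List.mem_map_of_mem hx))
    rw [← hp']
    exact hS p (hT p (List.mem_of_mem_filter hp))
  · have h1 := hcnt a
    have h2 := List.countP_le_length (l := T) (p := fun p => decide (cn p = a ∧ y p ≤ z))
    omega
  · have hk : ∀ f, f ≠ 1 → f ≠ 2 → f ≠ 18 → accCmd.keepsFld f none = true := by
      intro f h1 h2 h3
      simp [accCmd, whileSome, Cmd.keepsFld, Ne.symm h1, Ne.symm h2, Ne.symm h3]
    refine hQ _ _ _ (pre ++ ch) ks' hff ⟨?_, hacc', hcnt, fun a ha => ?_, fun p hp =>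
      hsub p (List.mem_of_mem_filter hp), hlow, hhigh⟩ ?_
    · rw [hf.reg 60 rfl]
      simp only [State.set_reg, reduceIte, State.set_heap]
      have hk0 : ∀ f, f ≠ 1 → f ≠ 2 → f ≠ 18 → Keeps f σ σ' := fun f h1 h2 h3 =>
        hf.keeps f (hk f h1 h2 h3)
      refine hrep.keeps (hk0 4 (by simp) (by simp) (by simp)) (hk0 5 (by simp) (by simp) (by simp))
        (hk0 6 (by simp) (by simp) (by simp)) fun a ha hF => ⟨hF, fun f hf => ?_⟩
      simp at hf
      exact (hk0 f (by omega) (by omega) (by omega)).2 a ha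
    · rw [List.map_append, List.mem_append] at ha
      exact ha.elim (hkeys a) (hkch a)
    · rw [walkCost]
      split_ifs at hlen ⊢ <;> omega

/-- Find the frequencies of the colours, starting from the element in register `60`. -/
def walkCmd : Cmd :=
  .clear 71 ;; whileSome 66 60 (.load 67 60 17 ;; .ite (.isNil 67) (turnCmd 13 15)
    (.ite (.le 67 1) (turnCmd 14 16) (turnCmd 13 15)))

/-- A binary search for the number of points with `y ≤ z`: at level `i` this number lies between
`lo` and `lo + 2 ^ i - 1`. The key, which belongs to rank `lo + 2 ^ i - 1` of a range of length `2 ^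
(i + 1)`, decides which half to enter. If the element becomes `nil` early, no points are left to be
decided. -/
theorem wp_walkCmd {n : ℕ} {y : ℕ → ℝ} {rk cn : ℕ → ℕ} {h : ℕ} {F S : ℕ → Prop} {T : List ℕ}
    {z : ℝ} {σ : State} {i : ℕ} {Q : ℕ → State → Prop} {t : ℕ}
    (hT : ∀ p ∈ T, p < n) (hTW : T.length ≤ W) (hS : ∀ p < n, S (cn p))
    (hS' : ∀ a, S a → σ.heap a 18 = .nil) (hz : σ.reg 1 = .real z)
    (hrk : ∀ p < n, rk p + 1 < 2 ^ i)
    (hrep : Rep n y rk cn h F σ i 0 (σ.reg 60) T)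
    (hQ : ∀ u σ' pre ks, Frame walkCmd σ σ' → Acc S σ' pre ks →
      (∀ a, total pre a = T.countP fun p => cn p = a ∧ y p ≤ z) →
      (∀ a ∈ pre.map Prod.fst, a ∈ (T.filter fun p => y p ≤ z).map cn) →
      u ≤ t + walkCost h (answerCard y cn T z) i + 10 → Q u σ') : Wp W walkCmd Q t σ := by
  refine Wp.frame ?_
  rw [walkCmd, wp_seq, wp_clear]
  refine Wp.whileSome (ι := ℕ × ℕ × List ℕ × List (ℕ × ℕ) × List ℕ)
    (fun j τ => (j.1 = 0 ∧ τ.reg 60 = .nil ∧ Acc S τ j.2.2.2.1 j.2.2.2.2 ∧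
        (∀ a, total j.2.2.2.1 a = T.countP fun p => cn p = a ∧ y p ≤ z) ∧
        ∀ a ∈ j.2.2.2.1.map Prod.fst, a ∈ (T.filter fun p => y p ≤ z).map cn) ∨
      ∃ i, j.1 = i + 1 ∧ Visit n y rk cn h F S T z τ i j.2.1 j.2.2.1 j.2.2.2.1 j.2.2.2.2)
    (fun j => match j.1 with | 0 => 0 | i + 1 => walkCost h (answerCard y cn T z) i) rfl
    (i := (i + 1, 0, T, [], [])) ?_ ?_ ?_
  · refine .inr ⟨i, rfl, ?_, ⟨.nil, by simp, by simp [OutLst], by simp, fun a ha => by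
      simp [hS' a ha], by simp⟩, by simp [total], by simp, by simp, by simp, fun p hp h => ?_⟩
    · have hks : ∀ f, Keeps f σ ((σ.set 71 .nil).set 66 .nil) := fun _ => ⟨le_rfl, fun _ _ => rfl⟩
      simpa using hrep.keeps (hks 4) (hks 5) (hks 6) fun a _ hF => ⟨hF, fun _ _ => rfl⟩
    -- At the root no rank reaches `2 ^ i - 1`, so the upper condition holds vacuously. This is why
    -- `rk p + 1`, and not `rk p`, is bounded.
    · have := hrk p hp
      simp only at h
      omega
  · rintro ⟨j, lo, X, pre, ks⟩ τ hf hP hr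
    simp only at hP
    obtain ⟨i, rfl, hV⟩ := hP.resolve_left fun h => hr h.2.1
    have hz' : τ.reg 1 = .real z := by rw [hf.reg 1 rfl, ← hz]; simp
    cases i with
    | zero =>
      -- At level `0` the remaining points have ranks at least `lo` and lie above `z`. The links are
      -- `nil`, so one further turn adds an empty chain and ends the loop.
      obtain ⟨hX, hv⟩ := hV.rep
      obtain ⟨e, he, hv, -, hl⟩ := hv.resolve_left hr
      have hX0 : ∀ a, X.countP (fun p => cn p = a ∧ y p ≤ z) = 0 := by
        intro a
        refine List.countP_eq_zero.2 fun p hp => ?_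
        have := hV.high p (hT p (hV.sub p hp)) (by have := hX p hp; omega)
        simp [this]
      refine Wp.abstract fun G hG => ?_
      simp [hv, hl, Test.Holds, turnCmd]
      refine wp_accCmd (S := S) (pre := pre) (ks := ks) (ch := [])
        ⟨hV.acc.nodup, hV.acc.mem, by simpa using hV.acc.out, hV.acc.count, hV.acc.flag,
          hV.acc.sub⟩ (by simp [Chain]) (by simp) (fun a => ?_)
        fun u σ' ks' hf' hacc' hu => hG _ _ fun hff => ⟨(0, 0, [], pre, ks'), .inl ⟨rfl, ?_, ?_,
          fun a => ?_, hV.keys⟩, ?_⟩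
      · have h1 := hV.count a
        have h2 := List.countP_le_length (l := T) (p := fun p => decide (cn p = a ∧ y p ≤ z))
        rw [List.append_nil]
        omega
      · rw [hf'.reg 60 rfl]; simp
      · simpa using hacc'
      · have := hV.count a
        rw [hX0] at this
        simpa using this
      · simp only [walkCost]
        simp at hu
        omega
    | succ i =>
      obtain ⟨e, he, hv, -, hk, ⟨⟨cL, c1, c2⟩, c3⟩, ⟨cR, d1, d2⟩, d3⟩ :=
        hV.rep.resolve_left fun h => hr h.1
      have h2i : 0 < 2 ^ i := by positivity
      have hpow : 2 ^ (i + 1) = 2 ^ i + 2 ^ i := by rw [pow_succ]; omega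
      have hpost : ∀ (u : ℕ) (G : ℕ → State → Prop) (fE fC lo' : ℕ) (ch : List (ℕ × ℕ)),
          u ≤ 3 →
          Chain τ (τ.heap e fC) ch → ChainOf cn ch (X.filter fun p => rk p < chainRank h i lo') →
          Rep n y rk cn h F τ i lo' (τ.heap e fE)
            (X.filter fun p => chainRank h i lo' ≤ rk p ∧ rk p < lo' + 2 ^ i) →
          (∀ p < n, rk p < lo' → y p ≤ z) → (∀ p < n, lo' + 2 ^ i ≤ rk p + 1 → z < y p) →
          (∀ v σ' (j : ℕ × ℕ × List ℕ × List (ℕ × ℕ) × List ℕ), ((j.1 = 0 ∧ σ'.reg 60 = .nil ∧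
            Acc S σ' j.2.2.2.1 j.2.2.2.2 ∧
            (∀ a, total j.2.2.2.1 a = T.countP fun p => cn p = a ∧ y p ≤ z) ∧
            ∀ a ∈ j.2.2.2.1.map Prod.fst, a ∈ (T.filter fun p => y p ≤ z).map cn) ∨
            ∃ i, j.1 = i + 1 ∧ Visit n y rk cn h F S T z σ' i j.2.1 j.2.2.1 j.2.2.2.1 j.2.2.2.2) →
            v + 2 + (match j.1 with
              | 0 => 0 | i + 1 => walkCost h (answerCard y cn T z) i) ≤
              walkCost h (answerCard y cn T z) (i + 1) → G v σ') →
          Wp W (turnCmd fE fC) G u (τ.set 67 (τ.heap e 17)) := by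
        intro u G fE fC lo' ch hu hch hcho hrep' hlo hhi hG
        have hks : ∀ f, Keeps f τ (τ.set 67 (τ.heap e 17)) := fun f => .set ..
        refine wp_turnCmd (W := W) hT hTW hS (by simpa using hv) (by simpa using hch) hcho
          (hrep'.keeps (hks 4) (hks 5) (hks 6) fun a _ hF => ⟨hF, fun _ _ => rfl⟩)
          ⟨hV.acc.nodup, hV.acc.mem, by simpa using hV.acc.out, hV.acc.count, hV.acc.flag,
            hV.acc.sub⟩ hV.count hV.keys hV.sub hlo hhi
          fun v σ' X' pre' ks' _ hV' hv' => hG v σ' (i + 1, lo', X', pre', ks')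
            (.inr ⟨i, rfl, hV'⟩) (by simp only; omega)
      refine Wp.abstract fun G hG => ?_
      simp [hv, Test.Holds, hz']
      refine ⟨fun hn => ?_, fun hn => ⟨fun hle => ?_, fun hle => ?_⟩⟩
      · refine hpost _ G 13 15 lo cL (by omega) c1 c2 c3 hV.low (fun p hp h => ?_)
          fun v σ' j h1 h2 => hG v σ' fun _ => ⟨j, h1, h2⟩
        -- A missing key means that no rank reaches the middle, so going left is right: the new
        -- upper condition is vacuous.
        rcases hk with ⟨-, hk⟩ | ⟨w, hk, -⟩
        · have := hk p hp; omega
        · rw [hk] at hn; cases hn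
      · obtain ⟨hk, -⟩ | ⟨w, hk, hw⟩ := hk
        · exact absurd hk hn
        · rw [hk] at hle
          refine hpost _ G 14 16 (lo + 2 ^ i) cR (by omega) d1 d2 d3
            (fun p hp h => ((hw p hp).1 (by omega)).trans hle)
            (fun p hp h => hV.high p hp (by omega))
            fun v σ' j h1 h2 => hG v σ' fun _ => ⟨j, h1, h2⟩
      · refine hpost _ G 13 15 lo cL (by omega) c1 c2 c3 hV.low (fun p hp h => ?_)
          fun v σ' j h1 h2 => hG v σ' fun _ => ⟨j, h1, h2⟩
        rcases hk with ⟨hk, -⟩ | ⟨w, hk, hw⟩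
        · exact absurd hk hn
        · rw [hk] at hle
          exact (not_le.1 hle).trans_le ((hw p hp).2 (by omega))
  · rintro ⟨j, lo, X, pre, ks⟩ τ u hf hP hr hu hff
    simp only at hP
    have hu' : u ≤ t + walkCost h (answerCard y cn T z) i + 10 := by simp only at hu; omega
    have hset : ∀ {pre ks}, Acc S τ pre ks → Acc S (τ.set 66 (.int 0)) pre ks := fun hacc =>
      ⟨hacc.nodup, hacc.mem, by simpa using hacc.out, hacc.count, hacc.flag, hacc.sub⟩
    rcases hP with ⟨-, -, h1, h2, h3⟩ | ⟨i, -, hV⟩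
    · exact hQ _ _ pre ks hff (hset h1) h2 h3 hu'
    · have hX0 : ∀ a, X.countP (fun p => cn p = a ∧ y p ≤ z) = 0 := by
        intro a
        have hrep' := hV.rep
        rw [hr] at hrep'
        cases i with
        | zero =>
          refine List.countP_eq_zero.2 fun p hp => ?_
          have := hV.high p (hT p (hV.sub p hp)) (by have := hrep'.1 p hp; omega)
          simp [this]
        | succ i =>
          rcases hrep' with ⟨-, rfl⟩ | ⟨e, -, h, -⟩
          · rfl
          · cases h
      refine hQ _ _ pre ks hff (hset hV.acc) (fun a => ?_) hV.keys hu'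
      have := hV.count a
      rwa [hX0, Nat.add_zero] at this

/-! ### From weights of colour nodes to the reported frequencies -/

theorem freq_eq_countP {n : ℕ} (p : Fin n → ℝ × ℝ) (col : Fin n → ℕ) (q : ℝ × ℝ) (c : ℕ) :
    freq p col q c = (List.range n).countP
      fun a => colOf col a = c ∧ xOf p a ≤ q.1 ∧ yOf p a ≤ q.2 := by
  classical
  rw [List.countP_eq_length_filter, ← List.toFinset_card_of_nodup (List.nodup_range.filter _),
    ← Set.ncard_coe_finset, freq, ← Set.ncard_image_of_injective _ Fin.val_injective]
  congr 1
  ext a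
  simp only [Set.mem_image, Set.mem_ofPred_eq, List.coe_toFinset, List.mem_filter, List.mem_range,
    decide_eq_true_eq]
  constructor
  · rintro ⟨i, h, rfl⟩
    exact ⟨i.2, by simpa [colOf, xOf, yOf] using h⟩
  · rintro ⟨ha, h⟩
    exact ⟨⟨a, ha⟩, by simpa [colOf, xOf, yOf, ha] using h, rfl⟩

theorem SpellsOut.of_outLst {σ : State} {v : Val} {ks : List ℕ} {γ w : ℕ → ℕ}
    (h : OutLst σ v ks) (hγ : ∀ a ∈ ks, σ.heap a 0 = .colour (γ a))
    (hw : ∀ a ∈ ks, σ.heap a 1 = .int (w a)) :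
    SpellsOut σ.heap v (ks.map fun a => (γ a, w a)) := by
  induction ks generalizing v with
  | nil => exact h
  | cons a ks ih =>
    exact ⟨a, h.1, hγ a (by simp), hw a (by simp), ih h.2 (fun b hb => hγ b (by simp [hb]))
      fun b hb => hw b (by simp [hb])⟩

/-- The state `σ` is ready to answer queries. -/
structure Ready {n : ℕ} (p : Fin n → ℝ × ℝ) (col : Fin n → ℕ) (h H d : ℕ) (cn rk : ℕ → ℕ)
    (Xe : ℕ → ℝ) (R : List (ℕ × ℕ)) (σ : State) : Prop where
  wf : σ.WF
  tree : TreeAt Xe d σ (σ.reg 2) (R.reverse.map Prod.fst)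
  xs : ∀ e ∈ R, Xe e.1 = xOf p e.2
  sorted : R.Pairwise fun a b => xOf p b.2 ≤ xOf p a.2
  perm : (R.map Prod.snd).Perm (List.range n)
  reps : ∀ t, t <:+ R → Rep n (yOf p) rk cn h (fun _ => True) σ H 0 (headVal t) (t.map Prod.snd)
  node : ∀ a < n, cn a < σ.next ∧ σ.heap (cn a) 0 = .colour (colOf col a) ∧
    σ.heap (cn a) 18 = .nil
  inj : ∀ a < n, ∀ b < n, colOf col a = colOf col b → cn a = cn b
  rank : ∀ a < n, rk a + 1 < 2 ^ H

/-- The structure does not depend on the fields `1`, `2` and `18`, except that the marks must be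
clear. These are the only fields that a query writes, so old answers may remain in the colour nodes.
-/
theorem Ready.keeps {n : ℕ} {p : Fin n → ℝ × ℝ} {col : Fin n → ℕ} {h H d : ℕ} {cn rk : ℕ → ℕ}
    {Xe : ℕ → ℝ} {R : List (ℕ × ℕ)} {σ σ' : State} (hr : Ready p col h H d cn rk Xe R σ)
    (hwf : σ'.WF) (h2 : σ'.reg 2 = σ.reg 2)
    (hk : ∀ f, f ≠ 1 → f ≠ 2 → f ≠ 18 → Keeps f σ σ')
    (h18 : ∀ a < n, σ'.heap (cn a) 18 = .nil) : Ready p col h H d cn rk Xe R σ' := by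
  have k : ∀ f ∈ [0, 4, 5, 6, 13, 14, 15, 16, 17, 19, 20, 21], Keeps f σ σ' := fun f hf => by
    simp at hf
    exact hk f (by omega) (by omega) (by omega)
  refine ⟨hwf, ?_, hr.xs, hr.sorted, hr.perm, fun t ht => ?_, fun a ha => ?_, hr.inj, hr.rank⟩
  · rw [h2]; exact hr.tree.keeps (k 19 (by simp)) (k 20 (by simp)) (k 21 (by simp))
  · exact (hr.reps t ht).keeps (k 4 (by simp)) (k 5 (by simp)) (k 6 (by simp))
      fun a ha _ => ⟨trivial, fun f hf => (k f (by simp at hf ⊢; omega)).2 a ha⟩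
  · obtain ⟨h1, h3, -⟩ := hr.node a ha
    exact ⟨h1.trans_le (k 0 (by simp)).1, by rw [(k 0 (by simp)).2 _ h1, h3], h18 a ha⟩

/-- The query program. -/
def queryCmd : Cmd := searchCmd ;; walkCmd ;; resetCmd ;; .move 0 71

/-- The tree search selects the points with `x ≤ q.1` as a suffix of `R`, the walk sums their
frequencies in the colour nodes, and the linked colour nodes themselves are returned. Clearing the
marks leaves the fields of the answer as they are. -/
theorem wp_queryCmd {n : ℕ} {p : Fin n → ℝ × ℝ} {col : Fin n → ℕ} {h H d : ℕ} {cn rk : ℕ → ℕ}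
    {Xe : ℕ → ℝ} {R : List (ℕ × ℕ)} {σ : State} {q : ℝ × ℝ} {Q : ℕ → State → Prop} {t : ℕ}
    (hr : Ready p col h H d cn rk Xe R σ) (hW : n ≤ W) (h0 : σ.reg 0 = .real q.1)
    (h1 : σ.reg 1 = .real q.2)
    (hQ : ∀ u σ', Frame queryCmd σ σ' → Reports p col q σ' →
      (∀ a < n, σ'.heap (cn a) 18 = .nil) →
      u ≤ t + 7 * d + walkCost h (numColours p col q) H + 4 * numColours p col q + 30 →
      Q u σ') : Wp W queryCmd Q t σ := by
  classical
  refine Wp.frame ?_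
  simp only [queryCmd, wp_seq]
  refine wp_searchCmd (X := Xe) (x := q.1) ?_ h0 hr.tree fun u₁ σ₁ hf₁ hs hu₁ => ?_
  · rw [List.pairwise_map, List.pairwise_reverse]
    refine hr.sorted.imp_of_mem fun ha hb hab => ?_
    rw [hr.xs _ ha, hr.xs _ hb]
    exact hab
  -- `T` is the prefix in `x`-order up to the query, possibly empty.
  obtain ⟨s, T, hR, h60, hT, hS⟩ : ∃ s T, R = s ++ T ∧ σ₁.reg 60 = headVal T ∧
      (∀ e ∈ T, xOf p e.2 ≤ q.1) ∧ ∀ e ∈ s, q.1 < xOf p e.2 := by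
    rcases hs with ⟨h60, hs⟩ | ⟨l₁, e, l₂, hl, h60, hl₁, he, hl₂⟩
    · refine ⟨R, [], by simp, h60, by simp, fun e he => ?_⟩
      rw [← hr.xs e he]
      exact hs e.1 (List.mem_map_of_mem (by simpa using he))
    · have hl' : R.map Prod.fst = l₂.reverse ++ (e :: l₁.reverse) := by
        rw [List.map_reverse] at hl
        rw [← List.reverse_reverse (R.map Prod.fst), hl]
        simp
      obtain ⟨s, T, rfl, hs1, hs2⟩ := List.map_eq_append_iff.1 hl'
      refine ⟨s, T, rfl, ?_, fun x hx => ?_, fun x hx => ?_⟩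
      · cases T with
        | nil => simp at hs2
        | cons x T =>
          simp only [List.map_cons, List.cons.injEq] at hs2
          rw [h60, headVal, hs2.1]
      · rw [← hr.xs x (by simp [hx])]
        have : x.1 ∈ e :: l₁.reverse := hs2 ▸ List.mem_map_of_mem hx
        rcases List.mem_cons.1 this with h | h
        · rw [h]; exact he
        · exact hl₁ _ (by simpa using h)
      · rw [← hr.xs x (by simp [hx])]
        have : x.1 ∈ l₂.reverse := hs1 ▸ List.mem_map_of_mem hx
        exact hl₂ _ (by simpa using this)
  have hlt : ∀ a ∈ R.map Prod.snd, a < n := fun a ha => by simpa using hr.perm.mem_iff.1 ha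
  have hTn : ∀ a ∈ T.map Prod.snd, a < n := fun a ha => hlt a (by rw [hR]; simp_all)
  have hlen : (T.map Prod.snd).length ≤ n := by
    have := hr.perm.length_eq
    rw [hR] at this
    simp at this ⊢
    omega
  have hfreq : ∀ a < n, freq p col q (colOf col a) =
      (T.map Prod.snd).countP fun b => cn b = cn a ∧ yOf p b ≤ q.2 := by
    intro a ha
    rw [freq_eq_countP, ← hr.perm.countP_eq, hR, List.map_append, List.countP_append]
    have : (s.map Prod.snd).countP (fun b => colOf col b = colOf col a ∧ xOf p b ≤ q.1 ∧
        yOf p b ≤ q.2) = 0 := by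
      refine List.countP_eq_zero.2 fun b hb => ?_
      obtain ⟨e, he, rfl⟩ := List.mem_map.1 hb
      simp [not_le.2 (hS e he)]
    rw [this, zero_add]
    refine List.countP_congr fun b hb => ?_
    have hbn := hTn b hb
    obtain ⟨e, he, rfl⟩ := List.mem_map.1 hb
    have hcol : colOf col e.2 = colOf col a ↔ cn e.2 = cn a := by
      refine ⟨hr.inj _ hbn _ ha, fun h => ?_⟩
      have h1 := (hr.node _ hbn).2.1
      rw [h, (hr.node _ ha).2.1] at h1
      exact (Val.colour.inj h1).symm
    simp [hT e he, hcol]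
  have hfz : ∀ c, 0 < freq p col q c → ∃ a ∈ T.map Prod.snd, colOf col a = c ∧ yOf p a ≤ q.2 := by
    intro c hc
    rw [freq_eq_countP, ← hr.perm.countP_eq, hR, List.countP_pos_iff] at hc
    obtain ⟨a, ha, h⟩ := hc
    simp only [decide_eq_true_eq] at h
    refine ⟨a, ?_, h.1, h.2.2⟩
    rw [List.map_append, List.mem_append] at ha
    refine ha.resolve_left fun ha => ?_
    obtain ⟨e, he, rfl⟩ := List.mem_map.1 ha
    exact absurd h.2.1 (not_le.2 (hS e he))
  -- The colour stored in a node; the default `0` is never used for colour nodes.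
  set γ : ℕ → ℕ := fun a => match σ.heap a 0 with | .colour c => c | _ => 0 with hγ
  have hγc : ∀ a < n, γ (cn a) = colOf col a := fun a ha => by
    rw [hγ]; simp only [(hr.node a ha).2.1]
  -- Distinct colour nodes carry distinct colours, so counting nodes amounts to counting colours.
  have hK : answerCard (yOf p) cn (T.map Prod.snd) q.2 ≤ numColours p col q := by
    have hinj : Set.InjOn γ (((T.map Prod.snd).filter fun a => yOf p a ≤ q.2).map cn).toFinset := by
      intro a ha b hb hab
      simp only [List.coe_toFinset, List.mem_map, List.mem_filter, Set.mem_ofPred_eq] at ha hb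
      obtain ⟨a, ⟨⟨e, he, rfl⟩, -⟩, rfl⟩ := ha
      obtain ⟨b, ⟨⟨e', he', rfl⟩, -⟩, rfl⟩ := hb
      have h1 := hTn _ (List.mem_map_of_mem he)
      have h2 := hTn _ (List.mem_map_of_mem he')
      rw [hγc _ h1, hγc _ h2] at hab
      exact hr.inj _ h1 _ h2 hab
    rw [answerCard, ← Finset.card_image_of_injOn hinj, ← Set.ncard_coe_finset, numColours]
    refine Set.ncard_le_ncard (fun c hc => ?_) (Set.toFinite _)
    simp only [Finset.coe_image, List.coe_toFinset, Set.mem_image, Set.mem_ofPred_eq, List.mem_map,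
      List.mem_filter, decide_eq_true_eq] at hc
    obtain ⟨-, ⟨a, ⟨⟨e, he, rfl⟩, hy⟩, rfl⟩, rfl⟩ := hc
    have h1 := hTn _ (List.mem_map_of_mem he)
    have hx := hT e he
    rw [hγc _ h1]
    refine ⟨⟨e.2, h1⟩, ?_, by simp [colOf, h1]⟩
    simp only [xOf, yOf, h1, dif_pos] at hx hy
    exact ⟨hx, hy⟩
  have hk1 : ∀ f, f ≠ 1 → f ≠ 2 → f ≠ 18 → Keeps f σ σ₁ := fun f _ _ _ =>
    hf₁.keeps f (by simp [searchCmd, whileSome, Cmd.keepsFld])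
  have hkk : ∀ f ∈ [4, 5, 6, 13, 14, 15, 16, 17, 18], Keeps f σ σ₁ := fun f _ =>
    hf₁.keeps f (by simp [searchCmd, whileSome, Cmd.keepsFld])
  rw [wp_seq]
  refine wp_walkCmd (n := n) (y := yOf p) (rk := rk) (cn := cn) (h := h) (F := fun _ => True)
    (S := fun a => ∃ b < n, cn b = a) (T := T.map Prod.snd) (z := q.2) (i := H) hTn
    (hlen.trans hW) (fun a ha => ⟨a, ha, rfl⟩) ?_ (by rw [hf₁.reg 1 rfl, h1]) hr.rank ?_
    fun u₂ σ₂ pre ks hf₂ hacc htot hkeys hu₂ => ?_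
  · rintro _ ⟨a, ha, rfl⟩
    rw [(hkk 18 (by simp)).2 _ (hr.node a ha).1, (hr.node a ha).2.2]
  · rw [h60]
    exact (hr.reps T ⟨s, hR.symm⟩).keeps (hkk 4 (by simp)) (hkk 5 (by simp)) (hkk 6 (by simp))
      fun a ha _ => ⟨trivial, fun f hf => (hkk f (by simp at hf ⊢; omega)).2 a ha⟩
  rw [wp_seq]
  have hnext : σ.next ≤ σ₂.next := hf₁.next.trans hf₂.next
  have hks : ∀ a ∈ ks, ∃ b ∈ T.map Prod.snd, yOf p b ≤ q.2 ∧ cn b = a := fun a ha => by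
    obtain ⟨b, hb, hb'⟩ := List.mem_map.1 (hkeys a ((hacc.mem a).1 ha))
    obtain ⟨h3, h4⟩ := List.mem_filter.1 hb
    exact ⟨b, h3, by simpa using h4, hb'⟩
  refine wp_resetCmd hacc fun u₃ σ₃ hf₃ hfl hu₃ => ?_
  rw [wp_move]
  intro hff
  have hold : ∀ a ∈ ks, a < σ.next := fun a ha => by
    obtain ⟨b, hb, -, rfl⟩ := hks a ha
    exact (hr.node b (hTn b hb)).1
  have h3 : ∀ a ∈ ks, ∀ f ∈ [0, 1, 2], σ₃.heap a f = σ₂.heap a f := fun a ha f hf =>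
    hf₃.heap f (by simp at hf; rcases hf with rfl | rfl | rfl <;> rfl) a
      ((hold a ha).trans_le hnext)
  have h00 : ∀ a < n, σ₃.heap (cn a) 0 = .colour (colOf col a) := fun a ha => by
    have := (hr.node a ha).1
    rw [hf₃.heap 0 rfl _ (this.trans_le hnext), hf₂.heap 0 rfl _ (this.trans_le hf₁.next),
      hf₁.heap 0 rfl _ this, (hr.node a ha).2.1]
  have htotf : ∀ a < n, total pre (cn a) = freq p col q (colOf col a) := fun a ha => by
    rw [htot, hfreq a ha]
  refine hQ _ _ hff ⟨ks.map fun a => (γ a, total pre a), ?_, ?_, fun c f => ?_⟩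
    (fun a ha => by simpa using hfl _ ⟨a, ha, rfl⟩) ?_
  · refine SpellsOut.of_outLst ?_ (fun a ha => ?_) fun a ha => ?_
    · simp only [State.set_reg, reduceIte, outLst_set]
      rw [hf₃.reg 71 rfl]
      exact hacc.out.congr fun a ha => h3 a ha 2 (by simp)
    · obtain ⟨b, hb, -, rfl⟩ := hks a ha
      rw [hγc b (hTn b hb)]
      exact h00 b (hTn b hb)
    · rw [State.set_heap, h3 a ha 1 (by simp), hacc.count a ha]
  · refine List.Nodup.of_map Prod.fst ?_
    rw [List.map_map]
    refine List.Nodup.map_on (fun a ha b hb hab => ?_) hacc.nodup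
    obtain ⟨a, ha', -, rfl⟩ := hks a ha
    obtain ⟨b, hb', -, rfl⟩ := hks b hb
    simp only [Function.comp_apply, hγc a (hTn a ha'), hγc b (hTn b hb')] at hab
    rw [hr.inj a (hTn a ha') b (hTn b hb') hab]
  · rw [List.mem_map]
    constructor
    · rintro ⟨a, ha, h⟩
      obtain ⟨b, hb, hy, rfl⟩ := hks a ha
      rw [hγc b (hTn b hb), htotf b (hTn b hb), Prod.mk.injEq] at h
      obtain ⟨rfl, rfl⟩ := h
      refine ⟨rfl, ?_⟩
      rw [hfreq b (hTn b hb), List.countP_pos_iff]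
      exact ⟨b, hb, by simpa using hy⟩
    · rintro ⟨rfl, hc⟩
      obtain ⟨a, ha, rfl, hy⟩ := hfz c hc
      rw [← htotf a (hTn a ha)] at hc ⊢
      refine ⟨cn a, (hacc.mem _).2 ?_, by rw [hγc a (hTn a ha)]⟩
      by_contra hn
      rw [total_eq_zero hn] at hc
      omega
  · have hkl : ks.length ≤ answerCard (yOf p) cn (T.map Prod.snd) q.2 := by
      rw [← List.toFinset_card_of_nodup hacc.nodup]
      refine Finset.card_le_card fun a ha => ?_
      rw [List.mem_toFinset] at ha ⊢
      exact hkeys a ((hacc.mem a).1 ha)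
    have hmono : walkCost h (answerCard (yOf p) cn (T.map Prod.snd) q.2) H ≤
        walkCost h (numColours p col q) H := by
      have : ∀ i K K', K ≤ K' → walkCost h K i ≤ walkCost h K' i := by
        intro i K K' hKK
        induction i with
        | zero => rfl
        | succ i ih => simp only [walkCost]; split_ifs <;> omega
      exact this _ _ _ hK
    omega

theorem queryCmd_noNew : queryCmd.noNew = true := rfl

theorem queryCmd_keepsFld {f : ℕ} (h1 : f ≠ 1) (h2 : f ≠ 2) (h18 : f ≠ 18) :
    queryCmd.keepsFld f none = true := by
  simp [queryCmd, searchCmd, walkCmd, turnCmd, accCmd, resetCmd, whileSome, Cmd.keepsFld,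
    Ne.symm h1, Ne.symm h2, Ne.symm h18]

/-- Readiness is an invariant of queries, and since they allocate nothing, the bound on the
allocated nodes persists through any sequence of them. -/
theorem Ready.answers {n : ℕ} {p : Fin n → ℝ × ℝ} {col : Fin n → ℕ} {h H d : ℕ} {cn rk : ℕ → ℕ}
    {Xe : ℕ → ℝ} {R : List (ℕ × ℕ)} {σ : State} (hr : Ready p col h H d cn rk Xe R σ) (hW : n ≤ W)
    {size : ℝ} (hsize : (σ.next : ℝ) ≤ size) {time : ℕ → ℝ}
    (htime : ∀ K : ℕ, ((7 * d + walkCost h K H + 4 * K + 30 : ℕ) : ℝ) ≤ time K)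
    (qs : List (ℝ × ℝ)) : Answers W queryCmd p col size time qs σ := by
  induction qs generalizing σ with
  | nil => trivial
  | cons q qs ih =>
    have hwf : (σ.pose q).WF := (hr.wf.set 0 (by simp)).set 1 (by simp)
    have hr' : Ready p col h H d cn rk Xe R (σ.pose q) :=
      hr.keeps hwf (by simp [State.pose]) (fun f _ _ _ => ⟨le_rfl, fun _ _ => rfl⟩)
        fun a ha => (hr.node a ha).2.2
    obtain ⟨u, σ', hex, hrep, hfl, hu⟩ := wp_queryCmd (W := W) (t := 0)
      (Q := fun u σ' => Reports p col q σ' ∧ (∀ a < n, σ'.heap (cn a) 18 = .nil) ∧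
        u ≤ 7 * d + walkCost h (numColours p col q) H + 4 * numColours p col q + 30) hr' hW
      (by simp [State.pose]) (by simp [State.pose])
      fun u σ' _ h1 h2 h3 => ⟨h1, h2, by omega⟩
    rw [Nat.zero_add] at hu
    have hnext : σ'.next = σ.next := hex.next_eq queryCmd_noNew
    have hr2 : Ready p col h H d cn rk Xe R σ' := hr'.keeps (hex.wf hwf) (hex.frame.reg 2 rfl)
      (fun f h1 h2 h18 => hex.frame.keeps f (queryCmd_keepsFld h1 h2 h18)) hfl
    refine ⟨u, σ', hex, le_trans ?_ (htime _), hrep, hr2.wf.sizeAtMost (by rwa [hnext]), ih hr2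
      (by rwa [hnext])⟩
    exact_mod_cast hu

/-! ### The construction -/

theorem inputState_wf {n : ℕ} (p : Fin n → ℝ × ℝ) (col : Fin n → ℕ) (s : ℕ) :
    (inputState p col s).WF := by
  refine ⟨fun r a h => ?_, fun b f a h => ?_⟩
  · have hn : (inputState p col s).next = n := rfl
    rw [hn]
    simp only [inputState] at h
    rcases r with _ | _ | r
    · by_cases h0 : 0 < n
      · simp only [h0, reduceIte, Val.ptr.injEq] at h
        omega
      · simp [h0] at h
    all_goals cases h
  · have hn : (inputState p col s).next = n := rfl
    rw [hn]
    simp only [inputState] at h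
    by_cases hb : b < n
    · rw [dif_pos hb] at h
      rcases f with _ | _ | _ | _ | f
      any_goals cases h
      by_cases hb' : b + 1 < n
      · simp only [hb', reduceIte, Val.ptr.injEq] at h
        omega
      · simp [hb'] at h
    · rw [dif_neg hb] at h
      cases h

/-- The construction program. -/
def buildCmd : Cmd :=
  readCmd ;; colourCmd ;; rankCmd ;; elemCmd ;; treeCmd ;; widthCmd ;; .new 108 ;;
    .store 108 23 10 ;; .const 110 0 ;; .store 108 24 110 ;; .store 108 25 21 ;; .move 97 108 ;;
    linkCmd

/-- Three sorts, at `100` each, and the search tree, at `50`, give `350 * n * Nat.clog 2 n`; the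
rates of the linking phase give the last term. Readiness is stated under `σ'.WF`, because
well-formedness follows from the execution and is supplied at the end. -/
theorem wp_buildCmd {n s : ℕ} {p : Fin n → ℝ × ℝ} {col : Fin n → ℕ} (hs : 2 ≤ s) (hsn : s ≤ n)
    (hW : 2 * n ≤ W) {Q : ℕ → State → Prop} {t : ℕ}
    (hQ : ∀ u σ' cn rk Xe R, (σ'.WF → Ready p col (Nat.log 2 s) (Nat.log 2 n + 1) (Nat.clog 2 n)
        cn rk Xe R σ') →
      u ≤ t + 350 * n * Nat.clog 2 n + 112 * n + 13 * Nat.log 2 n + 170 +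
        (eltRate (Nat.log 2 s) (Nat.log 2 n + 1) + ownRate (Nat.log 2 s) (Nat.log 2 n + 1)) * n →
      Q u σ') : Wp W buildCmd Q t (inputState p col s) := by
  simp only [buildCmd, wp_seq]
  have hn : 0 < n := by omega
  refine wp_readCmd hn (by omega) fun u₁ σ₁ hf₁ a1 a2 a3 a4 hu₁ => ?_
  have hlt₁ : ∀ a < n, a < σ₁.next := fun a ha => ha.trans_le hf₁.next
  have hne : (List.range n).reverse ≠ [] := by simp; omega
  have hmem : ∀ a, a ∈ (List.range n).reverse ↔ a < n := by simp
  have hlen : (List.range n).reverse.length = n := by simp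
  have r1 : σ₁.reg 1 = .int s := hf₁.reg 1 rfl
  rw [wp_seq]
  refine wp_colourCmd (C := colOf col) (l := (List.range n).reverse) hne
    (List.nodup_reverse.2 List.nodup_range)
    ⟨a1, fun a ha => ⟨hlt₁ a ((hmem a).1 ha), (a4 a ((hmem a).1 ha)).2.2⟩⟩
    fun u₂ σ₂ l₂ cn hf₂ b1 b2 b3 b4 hu₂ => ?_
  have k₂ : ∀ f ∈ [7, 8], Keeps f σ₁ σ₂ := fun f hf => hf₂.keeps f (by revert f; simp; decide)
  have hmem₂ : ∀ a, a ∈ l₂ ↔ a < n := fun a => b2.mem_iff.trans (hmem a)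
  have hlen₂ : l₂.length = n := b2.length_eq.trans hlen
  have hne₂ : l₂ ≠ [] := by rintro rfl; simp at hlen₂; omega
  have hlt₂ : ∀ a < n, a < σ₂.next := fun a ha => (hlt₁ a ha).trans_le hf₂.next
  rw [wp_seq]
  refine wp_rankCmd (Y := yOf p) (l := l₂) hne₂
    (b2.nodup_iff.2 (List.nodup_reverse.2 List.nodup_range)) (by omega)
    ⟨b1, fun a ha => ⟨hlt₂ a ((hmem₂ a).1 ha), by
      rw [(k₂ 8 (by simp)).2 a (hlt₁ a ((hmem₂ a).1 ha)), (a4 a ((hmem₂ a).1 ha)).2.1]⟩⟩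
    fun u₃ σ₃ l₃ hf₃ c1 c2 c3 c4 hu₃ => ?_
  have k₃ : ∀ f ∈ [0, 7, 8, 10, 18], Keeps f σ₂ σ₃ := fun f hf =>
    hf₃.keeps f (by revert f; simp; decide)
  have hmem₃ : ∀ a, a ∈ l₃ ↔ a < n := fun a => c2.mem_iff.trans (hmem₂ a)
  have hlen₃ : l₃.length = n := c2.length_eq.trans hlen₂
  have hne₃ : l₃ ≠ [] := by rintro rfl; simp at hlen₃; omega
  have hlt₃ : ∀ a < n, a < σ₃.next := fun a ha => (hlt₂ a ha).trans_le hf₃.next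
  have hnd₃ : l₃.Nodup := (c2.trans b2).nodup_iff.2 (List.nodup_reverse.2 List.nodup_range)
  rw [wp_seq]
  refine wp_elemCmd (X := xOf p) (l := l₃) hne₃
    ⟨c1, fun a ha => ⟨hlt₃ a ((hmem₃ a).1 ha), by
      rw [((k₂ 7 (by simp)).trans (k₃ 7 (by simp))).2 a (hlt₁ a ((hmem₃ a).1 ha)),
        (a4 a ((hmem₃ a).1 ha)).1]⟩⟩
    fun u₄ σ₄ R hf₄ d1 d2 d3 d4 d5 hu₄ => ?_
  have k₄ : ∀ f ∈ [0, 8, 10, 11, 18], Keeps f σ₃ σ₄ := fun f hf =>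
    hf₄.keeps f (by revert f; simp; decide)
  have hRlen : R.length = n := by rw [← List.length_map (f := Prod.snd), d2.length_eq, hlen₃]
  have hRne : R ≠ [] := by rintro rfl; simp at hRlen; omega
  -- The search tree needs keys as a function of elements; they are read off from the heap, with a
  -- default that does not matter.
  obtain ⟨Xe, hXe⟩ : ∃ Xe : ℕ → ℝ, ∀ e ∈ R, Xe e.1 = xOf p e.2 :=
    ⟨fun a => match σ₄.heap a 19 with | .real x => x | _ => 0, fun e he => by
      simp only [(d5 e he).2.2.1]⟩
  have htl : (R.reverse.map Prod.fst).length = n := by simp [hRlen]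
  rw [wp_seq]
  refine wp_treeCmd (X := Xe) (l := R.reverse.map Prod.fst) (by simpa using hRne)
    (by rw [List.map_map]; exact d1) (fun a ha => ?_) fun u₅ σ₅ hf₅ e1 hu₅ => ?_
  · obtain ⟨e, he, rfl⟩ := List.mem_map.1 ha
    have he : e ∈ R := by simpa using he
    exact ⟨(d5 e he).2.1.lt, (d5 e he).2.2.2, by rw [hXe e he]; exact (d5 e he).2.2.1⟩
  have k₅ : ∀ f ∈ [0, 4, 5, 8, 10, 11, 12, 13, 14, 15, 16, 17, 18, 23], Keeps f σ₄ σ₅ :=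
    fun f hf => hf₅.keeps f (by revert f; simp; decide)
  rw [wp_seq]
  refine wp_widthCmd (n := n) (s := s) hs hsn hW ?_ ?_ fun u₆ σ₆ hf₆ g1 hu₆ => ?_
  · rw [hf₅.reg 1 rfl, hf₄.reg 1 rfl, hf₃.reg 1 rfl, hf₂.reg 1 rfl, r1]
  · rw [hf₅.reg 3 rfl, hf₄.reg 3 rfl, hf₃.reg 3 rfl, hf₂.reg 3 rfl, a2]
  have k₆ : ∀ f ∈ [0, 4, 5, 8, 10, 11, 12, 13, 14, 15, 16, 17, 18, 19, 20, 21, 23], Keeps f σ₅ σ₆ :=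
    fun f hf => hf₆.keeps f (by revert f; simp; decide)
  have r10 : σ₆.reg 10 = σ₄.reg 10 := by rw [hf₆.reg 10 rfl, hf₅.reg 10 rfl]
  have r2 : σ₆.reg 2 = σ₅.reg 2 := hf₆.reg 2 rfl
  refine Wp.abstract fun G hG => ?_
  simp
  generalize hτ : State.set _ 97 _ = τ
  have hk0 : ∀ f, Keeps f σ₆ τ := fun f => ⟨by simp [← hτ], fun x hx => by simp [← hτ, hx.ne]⟩
  have hh : ∀ f, τ.heap σ₆.next f = if f = 25 then σ₆.reg 21 else if f = 24 then .int 0 else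
      if f = 23 then σ₆.reg 10 else .nil := by
    intro f; simp [← hτ]
  have t2 : τ.reg 2 = σ₅.reg 2 := by simp [← hτ, r2]
  have t97 : τ.reg 97 = .ptr σ₆.next := by simp [← hτ]
  have hnτ : τ.next = σ₆.next + 1 := by simp [← hτ]
  clear hτ
  have k₇ : ∀ f ∈ [0, 4, 5, 8, 10, 11, 12, 13, 14, 15, 16, 17, 18, 23], Keeps f σ₄ τ :=
    fun f hf => ((k₅ f hf).trans (k₆ f (by simp at hf ⊢; omega))).trans (hk0 f)
  have hrk : Ranking n (yOf p) l₃.idxOf := by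
    refine ⟨fun a ha => ?_, fun m hm => ?_, fun a ha b hb hab => ?_⟩
    · rw [← hlen₃]; exact List.idxOf_lt_length_iff.2 ((hmem₃ a).2 ha)
    · exact ⟨l₃[m], (hmem₃ _).1 (List.getElem_mem _), hnd₃.idxOf_getElem m (by omega)⟩
    · have ha' := List.idxOf_lt_length_iff.2 ((hmem₃ a).2 ha)
      have hb' := List.idxOf_lt_length_iff.2 ((hmem₃ b).2 hb)
      rcases hab.lt_or_eq with hlt | heq
      · have := List.pairwise_iff_getElem.1 c3 _ _ ha' hb' hlt
        simpa using this
      · rw [(List.idxOf_inj ((hmem₃ a).2 ha)).1 heq]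
  have hRn : ∀ e ∈ R, e.2 < n := fun e he =>
    (hmem₃ _).1 (d2.mem_iff.1 (List.mem_map_of_mem he))
  -- The strict inequality provides the unused last rank that the walk needs at the root.
  have hpow : n < 2 ^ (Nat.log 2 n + 1) := Nat.lt_pow_succ_log_self one_lt_two n
  have hpow' : 2 ^ (Nat.log 2 n + 1) ≤ 2 * n := by
    have := Nat.pow_log_le_self 2 hn.ne'
    rw [pow_succ]
    omega
  have h34 : ∀ f ∈ [0, 8, 10, 11, 18], Keeps f σ₃ τ := fun f hf =>
    (k₄ f hf).trans (k₇ f (by simp at hf ⊢; omega))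
  have hcn : ∀ a < n, cn a < σ₄.next := fun a ha =>
    (b3 a ((hmem a).2 ha)).2.1.trans_le (hf₃.next.trans hf₄.next)
  have k08 : ∀ f ∈ [0, 18], ∀ a < n, τ.heap (cn a) f = σ₂.heap (cn a) f := by
    intro f hf a ha
    have h2 := (b3 a ((hmem a).2 ha)).2.1
    exact (((k₃ f (by simp at hf ⊢; omega)).trans (k₄ f (by simp at hf ⊢; omega))).trans
      (k₇ f (by simp at hf ⊢; omega))).2 _ h2
  refine wp_linkCmd (n := n) (y := yOf p) (cn := cn) (rk := l₃.idxOf) (h := Nat.log 2 s)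
    (i := Nat.log 2 n + 1) (c := σ₆.next) (R := R) hrk
    ⟨by omega, ?_, by rw [hh]; rfl, ?_, by rw [hh]; rfl⟩ t97
    ⟨fun e he => ⟨(d5 e he).2.1.keeps fun f hf => k₇ f (by simp at hf ⊢; omega), ?_⟩, d4,
      fun e he => ?_, fun a ha _ _ => ?_, fun _ _ _ => Nat.zero_le _⟩
    ⟨fun a ha => ?_, fun a ha => ?_, fun a ha => ?_, fun a ha => ?_, fun a ha => ?_⟩
    (fun a ha => ?_) ?_ (by omega) fun u₇ σ₇ hf₇ i1 i2 hu₇ => ?_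
  · rw [hh]
    simp only [Nat.reduceEqDiff, reduceIte]
    rw [r10]
    exact d1.keeps (k₇ 4 (by simp)) (k₇ 5 (by simp))
  · rw [hh]
    exact g1.keeps (hk0 4) (hk0 5) (hk0 6)
  · exact hRn e he
  · rw [Nat.zero_add]
    exact (hrk.lt _ (hRn e he)).trans hpow
  · exact d2.mem_iff.2 ((hmem₃ a).2 ha)
  · exact (hlt₃ a ha).trans_le (h34 0 (by simp)).1
  · rw [((k₃ 8 (by simp)).trans (h34 8 (by simp))).2 a (hlt₂ a ha),
      (k₂ 8 (by simp)).2 a (hlt₁ a ha), (a4 a ha).2.1]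
  · rw [((k₃ 10 (by simp)).trans (h34 10 (by simp))).2 a (hlt₂ a ha),
      (b3 a ((hmem a).2 ha)).1]
  · rw [(h34 11 (by simp)).2 a (hlt₃ a ha), c4 a ((hmem₂ a).2 ha)]
  · exact (hcn a ha).trans_le (k₇ 0 (by simp)).1
  · rw [k08 18 (by simp) a ha, (b3 a ((hmem a).2 ha)).2.2.2]
  · omega
  · have k₈ : ∀ f ∈ [0, 19, 20, 21], Keeps f τ σ₇ := fun f hf =>
      hf₇.keeps f (by revert f; simp; decide)
    refine hG _ _ (hQ _ _ cn l₃.idxOf Xe R (fun hwf => ⟨hwf, ?_, hXe, d3, ?_, fun t' ht => ?_,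
      fun a ha => ⟨?_, ?_, i2 a ha⟩, fun a ha b hb => b4 a ((hmem a).2 ha) b ((hmem b).2 hb),
      fun a ha => ?_⟩) ?_)
    · rw [hf₇.reg 2 rfl, t2]
      rw [htl] at e1
      have k : ∀ f ∈ [19, 20, 21], Keeps f σ₅ σ₇ := fun f hf =>
        ((k₆ f (by simp at hf ⊢; omega)).trans (hk0 f)).trans (k₈ f (by simp at hf ⊢; omega))
      exact e1.keeps (k 19 (by simp)) (k 20 (by simp)) (k 21 (by simp))
    · exact ((d2.trans c2).trans b2).trans (List.reverse_perm _)
    · exact (i1 t' ht).keeps ⟨le_rfl, fun _ _ => rfl⟩ ⟨le_rfl, fun _ _ => rfl⟩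
        ⟨le_rfl, fun _ _ => rfl⟩ fun _ _ _ => ⟨trivial, fun _ _ => rfl⟩
    · exact ((hcn a ha).trans_le (k₇ 0 (by simp)).1).trans_le (k₈ 0 (by simp)).1
    · rw [(k₈ 0 (by simp)).2 _ ((hcn a ha).trans_le (k₇ 0 (by simp)).1), k08 0 (by simp) a ha,
        (b3 a ((hmem a).2 ha)).2.2.1]
    · have := hrk.lt a ha
      omega
    · rw [hlen] at hu₂
      rw [hlen₂] at hu₃
      rw [hlen₃] at hu₄
      rw [htl] at hu₅
      rw [hRlen] at hu₇
      have e1 : 100 * n * Nat.clog 2 n = 100 * (n * Nat.clog 2 n) := by ring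
      have e2 : 50 * n * Nat.clog 2 n = 50 * (n * Nat.clog 2 n) := by ring
      have e3 : 350 * n * Nat.clog 2 n = 350 * (n * Nat.clog 2 n) := by ring
      rw [e1] at hu₂ hu₃ hu₄
      rw [e2] at hu₅
      rw [e3]
      omega

/-! ### Bounds -/

/-- The number of multiples of `h` below `i` is `i / h` rounded up. Keeping track of the remainder
makes this an exact identity that passes through the induction. -/
theorem mul_count_mod {h : ℕ} (hh : 0 < h) (i : ℕ) :
    h * Nat.count (fun j => j % h = 0) i + (if i % h = 0 then 0 else i % h) =
      i + if i % h = 0 then 0 else h := by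
  induction i with
  | zero => simp
  | succ i ih =>
    have hmod : (i + 1) % h = if i % h + 1 = h then 0 else i % h + 1 := by
      rw [← Nat.mod_add_mod]
      split_ifs with hc
      · simp [hc]
      · exact Nat.mod_eq_of_lt (by have := Nat.mod_lt i hh; omega)
    rw [Nat.count_succ, Nat.mul_add, hmod]
    have hlt := Nat.mod_lt i hh
    generalize i % h = r at *
    by_cases h1 : r + 1 = h
    · rw [if_pos h1, if_pos rfl, if_pos rfl]
      split_ifs at ih ⊢ <;> omega
    · rw [if_neg h1, if_neg r.succ_ne_zero, if_neg r.succ_ne_zero]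
      split_ifs at ih ⊢ <;> omega

theorem mul_count_mod_le {h : ℕ} (hh : 0 < h) (i : ℕ) :
    h * Nat.count (fun j => j % h = 0) i + 1 ≤ i + h := by
  have := mul_count_mod hh i
  split_ifs at this <;> omega

/-- Adding `600` turns the recursion `x ↦ 600 + 2 * x` into plain doubling, which starts afresh at
every multiple of `h`. -/
theorem eltRate_succ_le {h : ℕ} (hh : 0 < h) (i : ℕ) :
    eltRate h (i + 1) + 600 ≤ 600 * 2 ^ (i % h + 1) := by
  induction i with
  | zero => simp [eltRate]
  | succ i ih =>
    rw [eltRate]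
    split_ifs with h0
    · rw [h0]; norm_num
    · have hmod : (i + 1) % h = i % h + 1 := by
        rw [← Nat.mod_add_mod] at h0 ⊢
        refine Nat.mod_eq_of_lt (lt_of_le_of_ne (Nat.mod_lt i hh) fun hc => h0 ?_)
        rw [hc, Nat.mod_self]
      rw [hmod, pow_succ]
      omega

theorem eltRate_le {h : ℕ} (hh : 0 < h) (i : ℕ) : eltRate h i ≤ 600 * 2 ^ h := by
  cases i with
  | zero => simp [eltRate]
  | succ i =>
    have h1 := eltRate_succ_le hh i
    have h2 : 2 ^ (i % h + 1) ≤ 2 ^ h := Nat.pow_le_pow_right (by norm_num) (Nat.mod_lt i hh)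
    omega

/-- Only cut levels contribute, each by the rate of the block below it. -/
theorem ownRate_le {h : ℕ} (hh : 0 < h) (i : ℕ) :
    ownRate h i ≤ 600 * 2 ^ h * Nat.count (fun j => j % h = 0) i := by
  induction i with
  | zero => simp [ownRate]
  | succ i ih =>
    have := eltRate_le hh i
    rw [ownRate, Nat.count_succ, Nat.mul_add]
    split_ifs <;> omega

theorem walkCost_eq (h K i : ℕ) : walkCost h K i =
    20 * (i + 1) + 11 * (2 * K + 1) * Nat.count (fun j => j % h = 0) i := by
  induction i with
  | zero => simp [walkCost]
  | succ i ih =>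
    rw [walkCost, ih, Nat.count_succ]
    split_ifs <;> ring

/-- Estimates for the parameters of the data structure. -/
theorem log_estimates {n s : ℕ} (hs : 2 ≤ s) (hsn : s ≤ n) :
    1 ≤ Real.logb s n ∧ 1 ≤ 2 * Real.log n ∧ (Nat.log 2 n : ℝ) ≤ 2 * Real.log n ∧
      Real.log n ≤ s * Real.logb s n ∧
      (Nat.count (fun j => j % Nat.log 2 s = 0) (Nat.log 2 n + 1) : ℝ) ≤ 3 * Real.logb s n := by
  have hs' : (2 : ℝ) ≤ s := by exact_mod_cast hs
  have hn' : (s : ℝ) ≤ n := by exact_mod_cast hsn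
  have hl2 : (1 : ℝ) / 2 < Real.log 2 := by have := Real.log_two_gt_d9; linarith
  have hls : Real.log 2 ≤ Real.log s := Real.log_le_log (by norm_num) hs'
  have hln : Real.log s ≤ Real.log n := Real.log_le_log (by linarith) hn'
  have hls0 : 0 < Real.log s := by linarith
  have hL : Real.logb s n * Real.log s = Real.log n := by
    rw [Real.logb, div_mul_cancel₀ _ hls0.ne']
  have hL1 : 1 ≤ Real.logb s n := by
    rw [Real.logb, le_div_iff₀ hls0]; linarith
  have hlog : (Nat.log 2 n : ℝ) * Real.log 2 ≤ Real.log n := by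
    rw [← Real.log_pow]
    refine Real.log_le_log (by positivity) ?_
    exact_mod_cast Nat.pow_log_le_self 2 (by omega)
  have hh : 0 < Nat.log 2 s := Nat.log_pos one_lt_two hs
  -- Rounding the logarithm down costs at most a factor of two, since it is at least `1`.
  have hlogs : Real.log s ≤ 2 * Nat.log 2 s * Real.log 2 := by
    have h1 : (s : ℝ) ≤ 2 ^ (2 * Nat.log 2 s) := by
      have h2 : s < 2 ^ (Nat.log 2 s + 1) := Nat.lt_pow_succ_log_self one_lt_two s
      have h3 : 2 ^ (Nat.log 2 s + 1) ≤ 2 ^ (2 * Nat.log 2 s) :=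
        Nat.pow_le_pow_right (by norm_num) (by omega)
      exact_mod_cast h2.le.trans h3
    have := Real.log_le_log (by linarith) h1
    rw [Real.log_pow] at this
    push_cast at this
    exact this
  refine ⟨hL1, by linarith, ?_, ?_, ?_⟩
  · have : (0 : ℝ) ≤ Nat.log 2 n := by positivity
    nlinarith
  -- As `log n` is `log s` times `log_s n`, this crude bound lets the sorting time disappear in the
  -- bound for linking.
  · have h1 : Real.log s ≤ s := (Real.log_le_sub_one_of_pos (by linarith)).trans (by linarith)
    rw [← hL]
    nlinarith
  · set G : ℝ := (Nat.count (fun j => j % Nat.log 2 s = 0) (Nat.log 2 n + 1) : ℝ) with hG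
    set k : ℝ := (Nat.log 2 s : ℝ) with hk
    have hk0 : 0 < k := by rw [hk]; exact_mod_cast hh
    have h1 : k * G ≤ Nat.log 2 n + k := by
      have := mul_count_mod_le hh (Nat.log 2 n + 1)
      rw [hk, hG]
      exact_mod_cast (by omega : Nat.log 2 s *
        Nat.count (fun j => j % Nat.log 2 s = 0) (Nat.log 2 n + 1) ≤ Nat.log 2 n + Nat.log 2 s)
    have h2 : (Nat.log 2 n : ℝ) ≤ 2 * Real.logb s n * k := by
      have h3 : (Nat.log 2 n : ℝ) * Real.log 2 ≤ (2 * Real.logb s n * k) * Real.log 2 := by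
        nlinarith
      exact le_of_mul_le_mul_right h3 (by linarith)
    -- The extra `1` comes from rounding up the number of cut levels; it is absorbed because the
    -- logarithm to base `s` is at least `1`.
    have h4 : k * G ≤ k * (2 * Real.logb s n + 1) := by nlinarith
    have h5 : G ≤ 2 * Real.logb s n + 1 := le_of_mul_le_mul_left h4 hk0
    linarith

/-- There is no factor `log n` here, although the time bound would allow it: the same estimate has
to serve for the size. -/
theorem build_bound {n s u : ℕ} (hs : 2 ≤ s) (hsn : s ≤ n)
    (hu : u ≤ 350 * n * Nat.clog 2 n + 112 * n + 13 * Nat.log 2 n + 170 +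
      (eltRate (Nat.log 2 s) (Nat.log 2 n + 1) + ownRate (Nat.log 2 s) (Nat.log 2 n + 1)) * n) :
    (u : ℝ) ≤ 3800 * (n * s * Real.logb s n) := by
  obtain ⟨h1, h2, h3, h4, h5⟩ := log_estimates hs hsn
  have hh : 0 < Nat.log 2 s := Nat.log_pos one_lt_two hs
  set G := Nat.count (fun j => j % Nat.log 2 s = 0) (Nat.log 2 n + 1)
  set L := Real.logb s n
  have hcl : Nat.clog 2 n ≤ Nat.log 2 n + 1 :=
    Nat.clog_le_of_le_pow (Nat.lt_pow_succ_log_self one_lt_two n).le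
  have hrate : eltRate (Nat.log 2 s) (Nat.log 2 n + 1) + ownRate (Nat.log 2 s) (Nat.log 2 n + 1) ≤
      600 * s * (1 + G) := by
    have e1 := eltRate_le hh (Nat.log 2 n + 1)
    have e2 := ownRate_le hh (Nat.log 2 n + 1)
    have e3 : 2 ^ Nat.log 2 s ≤ s := Nat.pow_log_le_self 2 (by omega)
    have e4 := Nat.mul_le_mul_right (1 + G) (Nat.mul_le_mul_left 600 e3)
    rw [mul_add, mul_one] at e4
    exact (Nat.add_le_add e1 e2).trans e4
  have hu' : u ≤ 350 * n * (Nat.log 2 n + 1) + 112 * n + 13 * Nat.log 2 n + 170 +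
      600 * s * (1 + G) * n := by
    refine hu.trans ?_
    gcongr
  have hu'' : (u : ℝ) ≤ 350 * n * (Nat.log 2 n + 1) + 112 * n + 13 * Nat.log 2 n + 170 +
      600 * s * (1 + G) * n := by exact_mod_cast hu'
  have hs' : (2 : ℝ) ≤ s := by exact_mod_cast hs
  have hn' : (2 : ℝ) ≤ n := by exact_mod_cast hs.trans hsn
  have g1 : 2 ≤ s * L := by nlinarith
  have g2 : (Nat.log 2 n : ℝ) ≤ 2 * (s * L) := by linarith
  have g3 : (n : ℝ) * (Nat.log 2 n + 1) ≤ n * (3 * (s * L)) := by gcongr; linarith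
  have g4 : s * L ≤ n * (s * L) := le_mul_of_one_le_left (by linarith) (by linarith)
  have g5 : (n : ℝ) * 1 ≤ n * (s * L) := by gcongr; linarith
  have g6 : (s : ℝ) * n * (1 + G) ≤ s * n * (4 * L) := by gcongr; linarith
  nlinarith

/-- The chains cost `11 * (2 * K + 1)` per cut level. The part with `K` uses that there are `O(log_s
n)` cut levels; for the part without `K` the trivial bound by the number of levels is enough. -/
theorem query_bound {n s : ℕ} (hs : 2 ≤ s) (hsn : s ≤ n) (K : ℕ) :
    ((7 * Nat.clog 2 n + walkCost (Nat.log 2 s) K (Nat.log 2 n + 1) + 4 * K + 30 : ℕ) : ℝ) ≤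
      300 * (Real.log n + K * Real.logb s n) := by
  obtain ⟨h1, h2, h3, h4, h5⟩ := log_estimates hs hsn
  rw [walkCost_eq]
  have hcl : Nat.clog 2 n ≤ Nat.log 2 n + 1 :=
    Nat.clog_le_of_le_pow (Nat.lt_pow_succ_log_self one_lt_two n).le
  have hG : Nat.count (fun j => j % Nat.log 2 s = 0) (Nat.log 2 n + 1) ≤ Nat.log 2 n + 1 :=
    Nat.count_le _
  set G := Nat.count (fun j => j % Nat.log 2 s = 0) (Nat.log 2 n + 1)
  set L := Real.logb s n
  have hcl' : (Nat.clog 2 n : ℝ) ≤ Nat.log 2 n + 1 := by exact_mod_cast hcl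
  have hG' : (G : ℝ) ≤ Nat.log 2 n + 1 := by exact_mod_cast hG
  push_cast
  have hK : (0 : ℝ) ≤ K := by positivity
  have g1 : (K : ℝ) * G ≤ K * (3 * L) := by gcongr
  have g2 : (K : ℝ) * 1 ≤ K * L := by gcongr
  nlinarith

end ColourFrequency

/-! ### Assembly of the programs and constants -/

theorem mainTheorem1 :
    ∃ (build query : ColourFrequency.Cmd) (C : ℕ),
      ∀ (n s φ : ℕ) (p : Fin n → ℝ × ℝ) (col : Fin n → ℕ),
        2 ≤ s → s ≤ n → (∀ i, 1 ≤ col i ∧ col i ≤ φ) →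
        ∃ (t : ℕ) (σ : ColourFrequency.State),
          ColourFrequency.Exec (C * n) build (ColourFrequency.inputState p col s) t σ ∧
          (t : ℝ) ≤ C * (n * s * Real.log n * Real.logb s n) ∧
          ColourFrequency.SizeAtMost σ (C * (n * s * Real.logb s n)) ∧
          ∀ qs : List (ℝ × ℝ),
            ColourFrequency.Answers (C * n) query p col (C * (n * s * Real.logb s n))
              (fun k => C * (Real.log n + k * Real.logb s n)) qs σ := by
  -- The constant has to cover `2 * 3800` for the time, where `1 ≤ 2 * Real.log n` is used, `3800`
  -- plus the input for the size, `300` for queries and `2` for the word limit.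
  refine ⟨ColourFrequency.buildCmd, ColourFrequency.queryCmd, 8000, ?_⟩
  intro n s φ p col hs hsn _
  obtain ⟨u, σ, hex, hready, hu⟩ := ColourFrequency.wp_buildCmd (W := 8000 * n) (p := p)
    (col := col) hs hsn (by omega) (t := 0)
    (Q := fun u σ => (σ.WF → ∃ cn rk Xe R, ColourFrequency.Ready p col (Nat.log 2 s)
      (Nat.log 2 n + 1) (Nat.clog 2 n) cn rk Xe R σ) ∧ (u : ℝ) ≤ 3800 * (n * s * Real.logb s n))
    fun u σ cn rk Xe R h1 h2 => ⟨fun h => ⟨cn, rk, Xe, R, h1 h⟩,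
      ColourFrequency.build_bound hs hsn (by omega)⟩
  rw [Nat.zero_add] at hu
  have hwf := hex.wf (ColourFrequency.inputState_wf p col s)
  obtain ⟨cn, rk, Xe, R, hr⟩ := hready hwf
  obtain ⟨h1, h2, -⟩ := ColourFrequency.log_estimates hs hsn
  have hs' : (2 : ℝ) ≤ s := by exact_mod_cast hs
  have hn' : (2 : ℝ) ≤ n := by exact_mod_cast hs.trans hsn
  have hsL : 1 ≤ s * Real.logb s n := by nlinarith
  have hnsL : (n : ℝ) * 1 ≤ n * (s * Real.logb s n) := by gcongr
  -- The nodes are the `n` input nodes and at most one per step of the construction.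
  have hnext : (σ.next : ℝ) ≤ (8000 : ℕ) * (n * s * Real.logb s n) := by
    have h3 : σ.next ≤ n + u := hex.next_le_add
    have h4 : (σ.next : ℝ) ≤ n + u := by exact_mod_cast h3
    push_cast
    nlinarith
  refine ⟨u, σ, hex, ?_, hwf.sizeAtMost hnext, hr.answers (by omega) hnext fun K => ?_⟩
  · push_cast
    -- The factor `log n` of the time bound is not needed, but it may be below `1`, hence the `2`.
    have h5 : n * s * Real.logb s n * 1 ≤ n * s * Real.logb s n * (2 * Real.log n) := by
      have : (0 : ℝ) ≤ n * s * Real.logb s n := by positivity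
      gcongr
    nlinarith
  · refine (ColourFrequency.query_bound hs hsn K).trans ?_
    push_cast
    have : 0 ≤ Real.log n + K * Real.logb s n := by positivity
    linarith
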